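/- **Setting.** Write points of $\mathbb{R}^3$ as $\vec{y}=(y,z)$ with cross-range part $y\in\mathbb{R}^2$ and range $z$. Let $k,k_d,a,\ell,r_o,L_x,L_z,d_A>0$ and $\sigma\in\mathbb{R}$, and put $$\lambda=\frac{2\pi}{k},\qquad \rho=\ell^{-3},\qquad \eta=\sigma\,\frac{4\pi a^3}{3},\qquad L_R=\frac{k r_o^2}{2}.$$ The particles have radius $a$ and are centred at the points $(\vec y_j)_j$ of a homogeneous Poisson point process on $\mathbb{R}^3$ of intensity $\rho$. They are illuminated by the Gaussian beam $$u_b(\vec y)=\frac{r_o^2}{R_z^2}\exp\Big(-\frac{|y|^2}{R_z^2}+ikz-k_dz\Big),\qquad R_z=r_o\Big(1+\frac{2iz}{kr_o^2}\Big)^{1/2},$$ emitted from the plane $z=0$ towards $z>0$. With $$G(\vec x,\vec y)=\frac{e^{(ik-k_d)|\vec x-\vec y|}}{4\pi|\vec x-\vec y|},$$ the field scattered by small particles, in the single-scattering approximation, is $$u_s(\vec x)=k^2\eta\sum_{j:\ z_j>0,\ |\vec x-\vec y_j|>a}G(\vec x,\vec y_j)\,u_b(\vec y_j),$$ where $z_j$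 is the range of $\vec y_j$; the field is observed outside the particles. **Scaling regime.** For $\delta>0$, write $A\ll_\delta B$ for $A\le\delta B$. The $\delta$-regime consists of the relations $$a\ll_\delta\lambda\ll_\delta\ell\ll_\delta r_o\ll_\delta L_x\ll_\delta L_z\ll_\delta L_R,\qquad \lambda\ll_\delta d_A\ll_\delta r_o,\qquad k_d\ll_\delta k,\qquad k_dL_x\le\delta,$$ together with $\log(L_z/a)\le\delta\,(L_x/r_o)^2$ (the Gaussian tail of the beam at the camera is negligible compared with every power of $L_z/a$). **Proposition 3.3.** For all $C\ge1$ and $\varepsilon>0$ there is $\delta>0$, depending only on $C$ and $\varepsilon$, such that the following holds for all parameters in the $\delta$-regime. Let $\vec X=(X,Z)$ and $\vec x$ be points of $\mathbb{R}^3$ with $$C^{-1}L_x\le|X|\le CL_x,\qquad C^{-1}L_z\le Z\le CL_z,\qquad |\vec x|\le d_A,$$ and let $\vec x_1=\vec X+\vec x/2$, $\vec x_2=\vec X-\vec x/2$. Then $u_s(\vec x_1),u_s(\vec x_2)\in L^4$, and with $M=\mathbb{E}[|u_s(\vec x_1)|^2]\;\mathbb{E}[|u_s(\vec x_2)|^2]$: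 1. (Gaussian summation rule) $$\Big|\operatorname{Cov}\big(|u_s(\vec x_1)|^2,|u_s(\vec x_2)|^2\big)-\big|\mathbb{E}[u_s(\vec x_1)\overline{u_s(\vec x_2)}]\big|^2\Big|\le\varepsilon M.$$ 2. (negligible pseudo-covariance) $$\big|\mathbb{E}[u_s(\vec x_1)u_s(\vec x_2)]\big|^2\le\varepsilon M.$$ 3. (size of the residual) The non-Gaussian residual $$\mathcal R=\mathbb{E}\big[|u_s(\vec x_1)|^2|u_s(\vec x_2)|^2\big]-M-\big|\mathbb{E}[u_s(\vec x_1)\overline{u_s(\vec x_2)}]\big|^2-\big|\mathbb{E}[u_s(\vec x_1)u_s(\vec x_2)]\big|^2$$ satisfies $$\big|2\pi^2\rho r_o^2|X|\,\mathcal R-M\big|\le\varepsilon M,\qquad \frac1{2\pi^2\rho r_o^2|X|}\le\varepsilon.$$ That is, $\mathcal R/M\approx 1/(2\pi^2\rho r_o^2|X|)\ll1$ whenever $M\neq 0$. -/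

import Mathlib

open MeasureTheory ProbabilityTheory

/-! ### Poisson point processes -/

/-- The (possibly infinite) number of the random points `y 0, y 1, …` that lie in `A`. -/
noncomputable def pointCount {Ω E : Type*} (y : ℕ → Ω → E) (A : Set E) (ω : Ω) : ENNReal :=
  ∑' j, A.indicator (fun _ => (1 : ENNReal)) (y j ω)

/-- The random points `y 0, y 1, …` form a Poisson point process with intensity measure `ν`:
the number of points in a measurable set `A` with `ν A < ∞` has the Poisson law of mean `ν A`,
and the numbers of points in pairwise disjoint measurable sets are independent. -/
structure IsPoissonProcess {Ω E : Type*} [MeasurableSpace Ω] [MeasurableSpace E]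
    (P : Measure Ω) (ν : Measure E) (y : ℕ → Ω → E) : Prop where
  measurable_point : ∀ j, Measurable (y j)
  law_count : ∀ A : Set E, MeasurableSet A → ν A ≠ ⊤ →
    P.map (pointCount y A) =
      (poissonMeasure (ν A).toNNReal).map (fun n : ℕ => (n : ENNReal))
  indep_count : ∀ (n : ℕ) (A : Fin n → Set E), (∀ i, MeasurableSet (A i)) →
    Pairwise (fun i j => Disjoint (A i) (A j)) →
    iIndepFun (fun i => pointCount y (A i)) P

/-! ### The scattered field -/

/-- Three-dimensional space; the laser beam propagates along the last coordinate axis. -/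
abbrev Space3 : Type := EuclideanSpace ℝ (Fin 3)

/-- The range coordinate `z` of a point, along the axis of the beam. -/
def rangeCoord (y : Space3) : ℝ := y 2

/-- The cross-range component of a point, in the plane orthogonal to the beam. -/
noncomputable def crossRange (y : Space3) : EuclideanSpace ℝ (Fin 2) := !₂[y 0, y 1]

/-- The physical parameters of the problem. -/
structure BeamParams where
  /-- wavenumber -/
  k : ℝ
  /-- damping coefficient -/
  kd : ℝ
  /-- radius of the particles -/
  a : ℝ
  /-- reflectivity of the particles -/
  σ : ℝ
  /-- mean distance between the particles -/
  ℓ : ℝ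
  /-- radius of the beam at its waist, in the plane `z = 0` -/
  ro : ℝ
  /-- cross-range scale of the camera -/
  Lx : ℝ
  /-- range scale of the camera -/
  Lz : ℝ
  /-- diameter of the aperture of the camera -/
  dA : ℝ

namespace BeamParams

/-- The wavelength. -/
noncomputable def wavelength (p : BeamParams) : ℝ := 2 * Real.pi / p.k

/-- The intensity of the Poisson cloud of particles: mean number per unit volume. -/
noncomputable def rho (p : BeamParams) : ℝ := 1 / p.ℓ ^ 3

/-- The scattering amplitude of a small particle: reflectivity times volume. -/
noncomputable def eta (p : BeamParams) : ℝ := p.σ * (4 * Real.pi * p.a ^ 3 / 3)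

/-- The Rayleigh length of the beam. -/
noncomputable def rayleighLength (p : BeamParams) : ℝ := p.k * p.ro ^ 2 / 2

/-- The complex beam radius `R_z` at range `z`. -/
noncomputable def beamRadius (p : BeamParams) (z : ℝ) : ℂ :=
  p.ro * (1 + 2 * Complex.I * z / (p.k * p.ro ^ 2)) ^ (1 / 2 : ℂ)

/-- The incident Gaussian beam `u_b`. -/
noncomputable def beam (p : BeamParams) (y : Space3) : ℂ :=
  (p.ro : ℂ) ^ 2 / p.beamRadius (rangeCoord y) ^ 2 *
    Complex.exp (-((‖crossRange y‖ : ℂ) ^ 2) / p.beamRadius (rangeCoord y) ^ 2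
      + Complex.I * p.k * rangeCoord y - p.kd * rangeCoord y)

/-- The outgoing Green's function of the damped Helmholtz equation. -/
noncomputable def green (p : BeamParams) (x y : Space3) : ℂ :=
  1 / (4 * Real.pi * (dist x y : ℂ)) *
    Complex.exp ((Complex.I * p.k - p.kd) * (dist x y : ℂ))

/-- The field scattered to `x` by a particle centred at `y`. Only particles illuminated by the
laser (located at range `0`, emitting towards positive ranges) contribute, and only if the point
of observation is outside the particle. -/
noncomputable def particleField (p : BeamParams) (x y : Space3) : ℂ :=
  {w : Space3 | 0 < rangeCoord w ∧ p.a < dist x w}.indicator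
    (fun w => (p.k : ℂ) ^ 2 * p.eta * p.green x w * p.beam w) y

/-- The scattered field `u_s(x)` in the single scattering approximation for small particles,
which are centred at the points `y 0, y 1, …`. -/
noncomputable def scatteredField {Ω : Type*} (p : BeamParams) (y : ℕ → Ω → Space3)
    (x : Space3) (ω : Ω) : ℂ :=
  ∑' j, p.particleField x (y j ω)

/-- The scaling regime, in which `A ≪ B` is quantified as `A ≤ δ * B`. -/
structure ScalingRegime (p : BeamParams) (δ : ℝ) : Prop where
  k_pos : 0 < p.k
  kd_pos : 0 < p.kd
  a_pos : 0 < p.a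
  ℓ_pos : 0 < p.ℓ
  ro_pos : 0 < p.ro
  Lx_pos : 0 < p.Lx
  Lz_pos : 0 < p.Lz
  dA_pos : 0 < p.dA
  /-- the particles are small -/
  a_wavelength : p.a ≤ δ * p.wavelength
  wavelength_ℓ : p.wavelength ≤ δ * p.ℓ
  ℓ_ro : p.ℓ ≤ δ * p.ro
  ro_Lx : p.ro ≤ δ * p.Lx
  Lx_Lz : p.Lx ≤ δ * p.Lz
  wavelength_dA : p.wavelength ≤ δ * p.dA
  dA_ro : p.dA ≤ δ * p.ro
  Lz_rayleigh : p.Lz ≤ δ * p.rayleighLength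
  kd_k : p.kd ≤ δ * p.k
  kd_Lx : p.kd * p.Lx ≤ δ
  /-- the Gaussian tail of the beam at the camera is negligible with respect to every power of
  the ratio of the largest and the smallest length scale -/
  log_tail : Real.log (p.Lz / p.a) ≤ δ * (p.Lx / p.ro) ^ 2

end BeamParams

/-! ### Moments -/

/-- `E[|u₁|²|u₂|²]` minus the three terms of the summation rule of zero-mean Gaussian fields. -/
noncomputable def nonGaussianResidual {Ω : Type*} [MeasurableSpace Ω] (P : Measure Ω)
    (u₁ u₂ : Ω → ℂ) : ℝ :=
  (∫ ω, ‖u₁ ω‖ ^ 2 * ‖u₂ ω‖ ^ 2 ∂P)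
    - (∫ ω, ‖u₁ ω‖ ^ 2 ∂P) * (∫ ω, ‖u₂ ω‖ ^ 2 ∂P)
    - ‖∫ ω, u₁ ω * (starRingEnd ℂ) (u₂ ω) ∂P‖ ^ 2
    - ‖∫ ω, u₁ ω * u₂ ω ∂P‖ ^ 2

/-! ### Moments of Poisson variables -/

/-! The scattered field is a linear statistic of a Poisson process, so its mixed cumulants are
integrals of products of one-particle fields against the intensity measure (Campbell's formula). Let
`f`, `g` be the one-particle fields at the two observation points. The fourth moment `E[|u₁|²|u₂|²]`
is a sum over the fifteen partitions of `{f, f̄, g, ḡ}`. Subtracting the three Gaussian terms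
removes all pairings; what is left is the single block `∫ |f|²|g|²` and terms that contain at least
one mean `∫ f` or `∫ g` as a factor (`IsPoissonProcess.abs_nonGaussianResidual_sub_le`).

It remains to estimate integrals. Put `D = |X|`, let `A` be the amplitude of the wave, `b = ρ A²
r_o² / D` and `N = ρ r_o² D`, so that `(A / D)² = b / N`. The claim follows
(`summation_rule_of_cumulants`) from `∫ |f|² ≈ π² b / 2`, `∫ |f|²|g|² ≈ π² b² / (8 N)`, `∫ f g =
o(b)` and `∫ f, ∫ g = o(A / D)`: they give `M ≈ π⁴ b² / 4` and a residual close to `M / (2 π² N)`,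
where `N ≫ 1` because `ℓ ≪ r_o ≪ D`.

The integrals of even powers of the modulus carry no phase. The beam is a Gaussian of width about
`r_o` around an axis at distance `D ≫ r_o` from the camera, and the damping is negligible at
distances of order `D`. Hence the integral factors asymptotically into a transversal Gaussian
integral `π r_o² / (2 n)` and the range integral of `(D² + (Z - z)²)⁻ⁿ`, a power of the Cauchy
density (`exists_lintegral_cutWave_ge`, `lintegral_cutWave_le`). Particles close to the camera see
only the Gaussian tail of the beam, which beats every needed power of `Z / a`.

The means and the pseudo-covariance are small by oscillation: the phase `k (r + z)` strictly
decreases as the particle moves off the axis towards the camera. The integrands extend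
holomorphically in the position of the particle. Shifting the cross-range coordinate that points to
the camera by `-iτ` gains `exp (-k D τ / (25 Z))`, which dominates the growth of the Gaussian since
`Z ≪ k r_o²` (`norm_integral_wave_box_le`). In `f g` both phases have the same sign and the same
shift works; in `f ḡ` they would cancel.

The shift loses strength as `z → ∞`, and the mean is only conditionally controlled there, uniformly
in the damping. For `z > 8 Z` the whole position vector is therefore rotated by `exp (iφ)`, `0 ≤ φ ≤
π / 6`. In logarithmic coordinates along rays this is a contour shift in a half-strip; the top edge
is exponentially small, and on the left edge the cross-range shift applies again in rotated
coordinates (`norm_integral_far_le`). -/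

lemma lintegral_poissonMeasure (r : NNReal) (g : ℕ → ENNReal) :
    ∫⁻ n, g n ∂poissonMeasure r =
      ∑' n : ℕ, ENNReal.ofReal (Real.exp (-r) * r ^ n / n.factorial) * g n := by
  rw [poissonMeasure, lintegral_sum_measure]
  simp

/-- The Stein–Chen identity: the term `n = 0` vanishes and the factor `n + 1` cancels in `(n + 1)!`.
Applied to powers of `n` it yields the moments recursively. -/
lemma lintegral_poissonMeasure_nat_mul (r : NNReal) (g : ℕ → ENNReal) :
    ∫⁻ n : ℕ, (n : ENNReal) * g n ∂poissonMeasure r =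
      r * ∫⁻ n, g (n + 1) ∂poissonMeasure r := by
  rw [lintegral_poissonMeasure, lintegral_poissonMeasure, tsum_eq_zero_add' ENNReal.summable,
    ← ENNReal.tsum_mul_left]
  simp only [Nat.cast_zero, zero_mul, mul_zero, zero_add]
  refine tsum_congr fun n => ?_
  rw [← mul_assoc, ← mul_assoc]
  congr 1
  rw [← ENNReal.ofReal_natCast, ← ENNReal.ofReal_mul (by positivity),
    ← ENNReal.ofReal_coe_nnreal, ← ENNReal.ofReal_mul (by positivity)]
  congr 1
  rw [Nat.factorial_succ]
  have : ((n.factorial : ℕ) : ℝ) ≠ 0 := by positivity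
  have h2 : ((n : ℝ) + 1) ≠ 0 := by positivity
  push_cast
  field_simp
  ring

lemma lintegral_poissonMeasure_moments (r : NNReal) :
    ∫⁻ n : ℕ, (n : ENNReal) ∂poissonMeasure r = r ∧
    ∫⁻ n : ℕ, (n : ENNReal) ^ 2 ∂poissonMeasure r = r + r ^ 2 ∧
    ∫⁻ n : ℕ, (n : ENNReal) ^ 3 ∂poissonMeasure r = r + 3 * r ^ 2 + r ^ 3 ∧
    ∫⁻ n : ℕ, (n : ENNReal) ^ 4 ∂poissonMeasure r = r + 7 * r ^ 2 + 6 * r ^ 3 + r ^ 4 := by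
  have mm : ∀ g : ℕ → ENNReal, Measurable g := fun g => measurable_of_countable g
  have h1 : ∫⁻ n : ℕ, (n : ENNReal) ∂poissonMeasure r = r := by
    have := lintegral_poissonMeasure_nat_mul r (fun _ => 1)
    simpa using this
  have h2 : ∫⁻ n : ℕ, (n : ENNReal) ^ 2 ∂poissonMeasure r = r + r ^ 2 := by
    have := lintegral_poissonMeasure_nat_mul r (fun n => n)
    simp only [← sq] at this
    rw [this]
    push_cast
    rw [lintegral_add_left (mm _), h1]
    simp only [lintegral_const, measure_univ]
    ring
  have h3 : ∫⁻ n : ℕ, (n : ENNReal) ^ 3 ∂poissonMeasure r = r + 3 * r ^ 2 + r ^ 3 := by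
    have := lintegral_poissonMeasure_nat_mul r (fun n => n ^ 2)
    have e : ∀ n : ℕ, (n : ENNReal) * n ^ 2 = n ^ 3 := fun n => by ring
    simp only [e] at this
    rw [this]
    have e2 : ∀ n : ℕ, ((n + 1 : ℕ) : ENNReal) ^ 2 = n ^ 2 + 2 * n + 1 := fun n => by
      push_cast; ring
    simp only [e2]
    rw [lintegral_add_left (mm _), lintegral_add_left (mm _), lintegral_const_mul _ (mm _), h1, h2]
    simp only [lintegral_const, measure_univ]
    ring
  refine ⟨h1, h2, h3, ?_⟩
  have := lintegral_poissonMeasure_nat_mul r (fun n => n ^ 3)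
  have e : ∀ n : ℕ, (n : ENNReal) * n ^ 3 = n ^ 4 := fun n => by ring
  simp only [e] at this
  rw [this]
  have e2 : ∀ n : ℕ, ((n + 1 : ℕ) : ENNReal) ^ 3 = n ^ 3 + 3 * n ^ 2 + 3 * n + 1 := fun n => by
    push_cast; ring
  simp only [e2]
  rw [lintegral_add_left (mm _), lintegral_add_left (mm _), lintegral_add_left (mm _),
    lintegral_const_mul _ (mm _), lintegral_const_mul _ (mm _), h1, h2, h3]
  simp only [lintegral_const, measure_univ]
  ring

/-- The mixed moments of orders one to four of the random variables `U c` are those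
of a compound Poisson family with cumulants `κ (c₁ * ⋯ * cₙ)`. -/
structure HasPoissonMoments {Ω R : Type*} [MeasurableSpace Ω] [Mul R] (P : Measure Ω)
    (U : R → Ω → ENNReal) (κ : R → ENNReal) : Prop where
  one : ∀ a, ∫⁻ ω, U a ω ∂P = κ a
  two : ∀ a b, ∫⁻ ω, U a ω * U b ω ∂P = κ (a * b) + κ a * κ b
  three : ∀ a b c, ∫⁻ ω, U a ω * U b ω * U c ω ∂P =
    κ (a * b * c) + κ (a * b) * κ c + κ (a * c) * κ b + κ (b * c) * κ a + κ a * κ b * κ c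
  four : ∀ a b c d, ∫⁻ ω, U a ω * U b ω * U c ω * U d ω ∂P =
    κ (a * b * c * d) + κ (a * b * c) * κ d + κ (a * b * d) * κ c + κ (a * c * d) * κ b
      + κ (b * c * d) * κ a
      + κ (a * b) * κ (c * d) + κ (a * c) * κ (b * d) + κ (a * d) * κ (b * c)
      + κ (a * b) * κ c * κ d + κ (a * c) * κ b * κ d + κ (a * d) * κ b * κ c
      + κ (b * c) * κ a * κ d + κ (b * d) * κ a * κ c + κ (c * d) * κ a * κ b
      + κ a * κ b * κ c * κ d

/-- Cumulants of independent families add: on expanding the products, each mixed expectation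
factors. Products of several `U a` and several `V b` occur, so independence is needed jointly for
the two families; this is why they factor through `X` and `Y`. -/
lemma HasPoissonMoments.add {Ω R : Type*} [MeasurableSpace Ω] [CommSemigroup R] {P : Measure Ω}
    [IsProbabilityMeasure P] {U V : R → Ω → ENNReal} {κ κ' : R → ENNReal}
    {S T : Type*} [MeasurableSpace S] [MeasurableSpace T] {X : Ω → S} {Y : Ω → T}
    {F : R → S → ENNReal} {G : R → T → ENNReal}
    (hX : Measurable X) (hY : Measurable Y) (hF : ∀ a, Measurable (F a))
    (hG : ∀ a, Measurable (G a)) (hU : ∀ a, U a = F a ∘ X) (hV : ∀ a, V a = G a ∘ Y)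
    (hXY : IndepFun X Y P)
    (h : HasPoissonMoments P U κ) (h' : HasPoissonMoments P V κ') :
    HasPoissonMoments P (fun a ω => U a ω + V a ω) (fun a => κ a + κ' a) := by
  have mU : ∀ a, Measurable (U a) := fun a => hU a ▸ (hF a).comp hX
  have mV : ∀ a, Measurable (V a) := fun a => hV a ▸ (hG a).comp hY
  have key : ∀ (p : S → ENNReal) (q : T → ENNReal), Measurable p → Measurable q →
      ∫⁻ ω, p (X ω) * q (Y ω) ∂P = (∫⁻ ω, p (X ω) ∂P) * ∫⁻ ω, q (Y ω) ∂P := by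
    intro p q hp hq
    exact lintegral_mul_eq_lintegral_mul_lintegral_of_indepFun''
      (hp.comp hX).aemeasurable (hq.comp hY).aemeasurable (hXY.comp hp hq)
  have eU : ∀ a ω, U a ω = F a (X ω) := fun a ω => by rw [hU a]; rfl
  have eV : ∀ a ω, V a ω = G a (Y ω) := fun a ω => by rw [hV a]; rfl
  have k11 : ∀ a b, ∫⁻ ω, U a ω * V b ω ∂P = κ a * κ' b := by
    intro a b
    rw [← h.one, ← h'.one]
    simp only [eU, eV]
    exact key (F a) (G b) (hF a) (hG b)
  have k21 : ∀ a b c, ∫⁻ ω, U a ω * U b ω * V c ω ∂P = (κ (a * b) + κ a * κ b) * κ' c := by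
    intro a b c
    rw [← h.two, ← h'.one]
    simp only [eU, eV]
    exact key (F a * F b) (G c) ((hF a).mul (hF b)) (hG c)
  have k12 : ∀ a b c, ∫⁻ ω, U a ω * (V b ω * V c ω) ∂P =
      κ a * (κ' (b * c) + κ' b * κ' c) := by
    intro a b c
    rw [← h.one, ← h'.two]
    simp only [eU, eV]
    exact key (F a) (G b * G c) (hF a) ((hG b).mul (hG c))
  have k31 : ∀ a b c d, ∫⁻ ω, U a ω * U b ω * U c ω * V d ω ∂P =
      (κ (a * b * c) + κ (a * b) * κ c + κ (a * c) * κ b + κ (b * c) * κ a + κ a * κ b * κ c)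
        * κ' d := by
    intro a b c d
    rw [← h.three, ← h'.one]
    simp only [eU, eV]
    exact key (F a * F b * F c) (G d) (((hF a).mul (hF b)).mul (hF c)) (hG d)
  have k13 : ∀ a b c d, ∫⁻ ω, U a ω * (V b ω * V c ω * V d ω) ∂P =
      κ a * (κ' (b * c * d) + κ' (b * c) * κ' d + κ' (b * d) * κ' c + κ' (c * d) * κ' b
        + κ' b * κ' c * κ' d) := by
    intro a b c d
    rw [← h.one, ← h'.three]
    simp only [eU, eV]
    exact key (F a) (G b * G c * G d) (hF a) (((hG b).mul (hG c)).mul (hG d))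
  have k22 : ∀ a b c d, ∫⁻ ω, U a ω * U b ω * (V c ω * V d ω) ∂P =
      (κ (a * b) + κ a * κ b) * (κ' (c * d) + κ' c * κ' d) := by
    intro a b c d
    rw [← h.two, ← h'.two]
    simp only [eU, eV]
    exact key (F a * F b) (G c * G d) ((hF a).mul (hF b)) ((hG c).mul (hG d))
  refine ⟨fun a => ?_, fun a b => ?_, fun a b c => ?_, fun a b c d => ?_⟩
  · rw [lintegral_add_left (mU a), h.one, h'.one]
  · have e : ∀ ω, (U a ω + V a ω) * (U b ω + V b ω) =
      U a ω * U b ω + (V a ω * V b ω + (U a ω * V b ω + U b ω * V a ω)) := fun ω => by ring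
    simp only [e]
    rw [lintegral_add_left (by fun_prop), lintegral_add_left (by fun_prop),
      lintegral_add_left (by fun_prop), h.two, h'.two, k11, k11]
    ring
  · have e : ∀ ω, (U a ω + V a ω) * (U b ω + V b ω) * (U c ω + V c ω) =
      U a ω * U b ω * U c ω + (V a ω * V b ω * V c ω +
        (U a ω * U b ω * V c ω + (U a ω * U c ω * V b ω + (U b ω * U c ω * V a ω
        + (U a ω * (V b ω * V c ω) + (U b ω * (V a ω * V c ω) + U c ω * (V a ω * V b ω)))))))
        := fun ω => by ring
    simp only [e]
    rw [lintegral_add_left (by fun_prop), lintegral_add_left (by fun_prop),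
      lintegral_add_left (by fun_prop), lintegral_add_left (by fun_prop),
      lintegral_add_left (by fun_prop), lintegral_add_left (by fun_prop),
      lintegral_add_left (by fun_prop), h.three, h'.three, k21, k21, k21, k12, k12, k12]
    ring
  · have e : ∀ ω, (U a ω + V a ω) * (U b ω + V b ω) * (U c ω + V c ω) * (U d ω + V d ω) =
      U a ω * U b ω * U c ω * U d ω + (V a ω * V b ω * V c ω * V d ω +
        (U a ω * U b ω * U c ω * V d ω + (U a ω * U b ω * U d ω * V c ω
        + (U a ω * U c ω * U d ω * V b ω + (U b ω * U c ω * U d ω * V a ω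
        + (U a ω * (V b ω * V c ω * V d ω) + (U b ω * (V a ω * V c ω * V d ω)
        + (U c ω * (V a ω * V b ω * V d ω) + (U d ω * (V a ω * V b ω * V c ω)
        + (U a ω * U b ω * (V c ω * V d ω) + (U a ω * U c ω * (V b ω * V d ω)
        + (U a ω * U d ω * (V b ω * V c ω) + (U b ω * U c ω * (V a ω * V d ω)
        + (U b ω * U d ω * (V a ω * V c ω) + U c ω * U d ω * (V a ω * V b ω)))))))))))))))
        := fun ω => by ring
    simp only [e]
    iterate 15 rw [lintegral_add_left (by fun_prop)]
    rw [h.four, h'.four]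
    iterate 4 rw [k31]
    iterate 4 rw [k13]
    iterate 6 rw [k22]
    ring

/-- All cumulants of a Poisson variable equal its mean, so the cumulant of the multiples `c₁ N, …,
cₙ N` depends only on the product of the coefficients. The moments `1, 7, 6, 1` count partitions of
four points by number of blocks. -/
lemma hasPoissonMoments_const_mul {Ω : Type*} [MeasurableSpace Ω] {P : Measure Ω}
    {N : Ω → ENNReal} (hN : Measurable N) {r : NNReal}
    (hlaw : P.map N = (poissonMeasure r).map (fun n : ℕ => (n : ENNReal))) :
    HasPoissonMoments P (fun (c : ENNReal) ω => c * N ω) (fun c => c * r) := by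
  obtain ⟨h1, h2, h3, h4⟩ := lintegral_poissonMeasure_moments r
  have key : ∀ g : ENNReal → ENNReal, Measurable g →
      ∫⁻ ω, g (N ω) ∂P = ∫⁻ n : ℕ, g n ∂poissonMeasure r := by
    intro g hg
    rw [← lintegral_map hg hN, hlaw, lintegral_map hg (measurable_of_countable _)]
  have k1 : ∫⁻ ω, N ω ∂P = r := by rw [← h1]; exact key id measurable_id
  have k2 := (key (· ^ 2) (by fun_prop)).trans h2
  have k3 := (key (· ^ 3) (by fun_prop)).trans h3
  have k4 := (key (· ^ 4) (by fun_prop)).trans h4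
  refine ⟨fun a => ?_, fun a b => ?_, fun a b c => ?_, fun a b c d => ?_⟩
  · rw [lintegral_const_mul _ hN, k1]
  · have e : ∀ ω, a * N ω * (b * N ω) = (a * b) * N ω ^ 2 := fun ω => by ring
    simp only [e]
    rw [lintegral_const_mul _ (by fun_prop), k2]
    ring
  · have e : ∀ ω, a * N ω * (b * N ω) * (c * N ω) = (a * b * c) * N ω ^ 3 := fun ω => by ring
    simp only [e]
    rw [lintegral_const_mul _ (by fun_prop), k3]
    ring
  · have e : ∀ ω, a * N ω * (b * N ω) * (c * N ω) * (d * N ω) = (a * b * c * d) * N ω ^ 4 :=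
      fun ω => by ring
    simp only [e]
    rw [lintegral_const_mul _ (by fun_prop), k4]
    ring

/-- The index set enters only through its multiplication, so the formulas pull back along any
multiplicative map. This serves for the evaluation of a coefficient vector at one coordinate and for
its restriction to the range of a simple function. -/
lemma HasPoissonMoments.comp {Ω R S : Type*} [MeasurableSpace Ω] [Mul R] [Mul S] {P : Measure Ω}
    {U : R → Ω → ENNReal} {κ : R → ENNReal} (h : HasPoissonMoments P U κ) (φ : S →ₙ* R) :
    HasPoissonMoments P (fun s => U (φ s)) (fun s => κ (φ s)) :=
  ⟨fun a => by rw [h.one], fun a b => by rw [h.two]; simp only [map_mul],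
    fun a b c => by rw [h.three]; simp only [map_mul],
    fun a b c d => by rw [h.four]; simp only [map_mul]⟩

/-- Linear combinations of independent Poisson variables. -/
lemma hasPoissonMoments_sum {Ω ι : Type*} [MeasurableSpace Ω] {P : Measure Ω}
    [IsProbabilityMeasure P] {N : ι → Ω → ENNReal} (hN : ∀ i, Measurable (N i)) {r : ι → NNReal}
    (hlaw : ∀ i, P.map (N i) = (poissonMeasure (r i)).map (fun n : ℕ => (n : ENNReal)))
    (hind : iIndepFun N P) (s : Finset ι) :
    HasPoissonMoments P (fun (c : ι → ENNReal) ω => ∑ i ∈ s, c i * N i ω)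
      (fun c => ∑ i ∈ s, c i * r i) := by
  classical
  induction s using Finset.induction_on with
  | empty => constructor <;> simp
  | insert i s hi ih =>
    simp only [Finset.sum_insert hi]
    have hI := hind.indepFun_finset {i} s (by simpa using hi) hN
    refine HasPoissonMoments.add (X := fun ω (j : ({i} : Finset ι)) => N j ω)
      (Y := fun ω (j : s) => N j ω)
      (F := fun c v => c i * v ⟨i, by simp⟩) (G := fun c v => ∑ j : s, c j * v j)
      (U := fun c ω => c i * N i ω) (κ := fun c => c i * r i)
      (measurable_pi_lambda _ fun j => hN j) (measurable_pi_lambda _ fun j => hN j)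
      (fun a => by fun_prop) (fun a => by fun_prop) (fun a => rfl) (fun a => ?_) hI ?_ ih
    · funext ω
      simp only [Function.comp]
      rw [Finset.sum_coe_sort s (fun j => a j * N j ω)]
    · exact (hasPoissonMoments_const_mul (hN i) (hlaw i)).comp
        (Pi.evalMonoidHom (fun _ : ι => ENNReal) i : (ι → ENNReal) →ₙ* ENNReal)

/-! ### Moments of sums over a Poisson process: nonnegative functions -/

/-- The sum of `f` over the random points. -/
noncomputable def pointSum {Ω E : Type*} (y : ℕ → Ω → E) (f : E → ENNReal) (ω : Ω) : ENNReal :=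
  ∑' j, f (y j ω)

lemma measurable_pointSum {Ω E : Type*} [MeasurableSpace Ω] [MeasurableSpace E]
    {y : ℕ → Ω → E} (hy : ∀ j, Measurable (y j)) {f : E → ENNReal} (hf : Measurable f) :
    Measurable (pointSum y f) :=
  Measurable.tsum fun j => hf.comp (hy j)

/-- `u` increases to `l`. -/
def MonoLim (u : ℕ → ENNReal) (l : ENNReal) : Prop := Monotone u ∧ ⨆ n, u n = l

namespace MonoLim

variable {u v : ℕ → ENNReal} {l m : ENNReal}

lemma add (hu : MonoLim u l) (hv : MonoLim v m) : MonoLim (fun n => u n + v n) (l + m) :=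
  ⟨hu.1.add hv.1, by rw [← ENNReal.iSup_add_iSup_of_monotone hu.1 hv.1, hu.2, hv.2]⟩

lemma mul (hu : MonoLim u l) (hv : MonoLim v m) : MonoLim (fun n => u n * v n) (l * m) := by
  refine ⟨fun i j h => mul_le_mul' (hu.1 h) (hv.1 h), ?_⟩
  rw [← hu.2, ← hv.2, ENNReal.iSup_mul]
  simp only [ENNReal.mul_iSup]
  refine le_antisymm (iSup_le fun n => le_iSup_of_le n (le_iSup_of_le n le_rfl)) ?_
  refine iSup_le fun i => iSup_le fun j => le_iSup_of_le (max i j) ?_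
  exact mul_le_mul' (hu.1 (le_max_left _ _)) (hv.1 (le_max_right _ _))

lemma unique (hu : MonoLim u l) (hv : MonoLim u m) : l = m := hu.2.symm.trans hv.2

lemma lintegral {α : Type*} [MeasurableSpace α] {μ : Measure α} {f : ℕ → α → ENNReal}
    {g : α → ENNReal} (hf : ∀ n, Measurable (f n)) (h : ∀ x, MonoLim (fun n => f n x) (g x)) :
    MonoLim (fun n => ∫⁻ x, f n x ∂μ) (∫⁻ x, g x ∂μ) := by
  have hm : Monotone f := fun i j hij x => (h x).1 hij
  refine ⟨fun i j hij => lintegral_mono (hm hij), ?_⟩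
  rw [← lintegral_iSup hf hm]
  exact lintegral_congr fun x => (h x).2

lemma tsum {f : ℕ → ℕ → ENNReal} {g : ℕ → ENNReal}
    (h : ∀ j, MonoLim (fun n => f n j) (g j)) :
    MonoLim (fun n => ∑' j, f n j) (∑' j, g j) := by
  have := MonoLim.lintegral (μ := Measure.count) (fun n => measurable_of_countable (f n)) h
  simpa only [lintegral_count] using this

end MonoLim

/-- The cut-off by `spanningSets` is needed since the counts have Poisson laws only on sets of
finite measure. -/
lemma exists_simpleFunc_monoLim {E : Type*} [MeasurableSpace E] (ν : Measure E) [SigmaFinite ν]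
    {f : E → ENNReal} (hf : Measurable f) (x : E) :
    MonoLim (fun n => (spanningSets ν n).indicator (SimpleFunc.eapprox f n) x) (f x) := by
  have hm : Monotone fun n => (spanningSets ν n).indicator (SimpleFunc.eapprox f n) x := by
    intro i j hij
    by_cases hi : x ∈ spanningSets ν i
    · simp only [Set.indicator_of_mem hi,
        Set.indicator_of_mem (monotone_spanningSets ν hij hi)]
      exact SimpleFunc.monotone_eapprox f hij x
    · simp [Set.indicator_of_notMem hi]
  refine ⟨hm, le_antisymm (iSup_le fun n => ?_) ?_⟩
  · refine (Set.indicator_le_self _ _ x).trans ?_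
    rw [← SimpleFunc.iSup_eapprox_apply hf x]
    exact le_iSup (fun n => SimpleFunc.eapprox f n x) n
  · conv_lhs => rw [← SimpleFunc.iSup_eapprox_apply hf x]
    have hx : x ∈ ⋃ n, spanningSets ν n := by rw [iUnion_spanningSets]; trivial
    obtain ⟨N, hN⟩ := Set.mem_iUnion.1 hx
    refine iSup_le fun n => le_iSup_of_le (max N n) ?_
    simp only [Set.indicator_of_mem (monotone_spanningSets ν (le_max_left N n) hN)]
    exact SimpleFunc.monotone_eapprox f (le_max_right _ _) x

lemma pointSum_monoLim {Ω E : Type*} [MeasurableSpace E] {y : ℕ → Ω → E} (ν : Measure E) [SigmaFinite ν] {f : E → ENNReal} (hf : Measurable f)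
    (ω : Ω) :
    MonoLim (fun n => pointSum y ((spanningSets ν n).indicator (SimpleFunc.eapprox f n)) ω)
      (pointSum y f ω) :=
  MonoLim.tsum fun j => exists_simpleFunc_monoLim ν hf (y j ω)

lemma measurable_indicator_eapprox {E : Type*} [MeasurableSpace E] (ν : Measure E) [SigmaFinite ν] (f : E → ENNReal) (n : ℕ) :
    Measurable ((spanningSets ν n).indicator (SimpleFunc.eapprox f n)) :=
  (SimpleFunc.measurable _).indicator (measurableSet_spanningSets ν n)

section PoissonProcess

variable {Ω E : Type*} [MeasurableSpace Ω] [MeasurableSpace E] {P : Measure Ω}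
  [IsProbabilityMeasure P] {ν : Measure E} {y : ℕ → Ω → E}

/-- The level sets of `q` inside `S` are disjoint with finite measure, so their counts are
independent Poisson variables and the sum over the points is a linear combination of them. Indexing
by `c` treats all functions of the same partition at once. -/
lemma IsPoissonProcess.hasPoissonMoments_map (h : IsPoissonProcess P ν y) {T : Type*}
    (q : SimpleFunc E T) {S : Set E} (hS : MeasurableSet S) (hνS : ν S ≠ ⊤) :
    HasPoissonMoments P (fun (c : T → ENNReal) => pointSum y (S.indicator (c ∘ q)))
      (fun c => ∫⁻ x in S, c (q x) ∂ν) := by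
  classical
  set A : q.range → Set E := fun t => S ∩ q ⁻¹' {(t : T)} with hA
  have mA : ∀ t, MeasurableSet (A t) := fun t => hS.inter (q.measurableSet_preimage _)
  have fA : ∀ t, ν (A t) ≠ ⊤ := fun t => ne_top_of_le_ne_top hνS (measure_mono Set.inter_subset_left)
  have dA : Pairwise fun s t => Disjoint (A s) (A t) := by
    intro s t hst
    refine Set.disjoint_left.2 fun x hx hx' => hst (Subtype.ext ?_)
    exact hx.2.symm.trans hx'.2
  have mN : ∀ t, Measurable (pointCount y (A t)) := fun t =>
    measurable_pointSum h.measurable_point (measurable_const.indicator (mA t))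
  have ind : iIndepFun (fun t => pointCount y (A t)) P := by
    -- Independence of counts is available for families indexed by `Fin n`.
    have e := Fintype.equivFin q.range
    have h1 := h.indep_count _ (fun i => A (e.symm i)) (fun i => mA _)
      (fun i j hij => dA (fun h => hij (e.symm.injective h)))
    have h2 := h1.precomp (g := e) e.injective
    simpa using h2
  have key := hasPoissonMoments_sum mN (fun t => h.law_count _ (mA t) (fA t)) ind Finset.univ
  have key2 := key.comp (S := T → ENNReal)
    (⟨fun c t => c t, fun _ _ => rfl⟩ : (T → ENNReal) →ₙ* (q.range → ENNReal))
  convert key2 using 1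
  · funext c ω
    simp only [pointSum, pointCount, MulHom.coe_mk]
    simp_rw [← ENNReal.tsum_mul_left]
    rw [← Summable.tsum_finsetSum (fun _ _ => ENNReal.summable)]
    refine tsum_congr fun j => ?_
    by_cases hj : y j ω ∈ S
    · rw [Set.indicator_of_mem hj,
        Finset.sum_eq_single (⟨q (y j ω), SimpleFunc.mem_range_self _ _⟩ : q.range)]
      · simp [hA, hj]
      · intro t _ ht
        have : y j ω ∉ A t := fun hh => ht (Subtype.ext hh.2.symm)
        simp [this]
      · simp
    · rw [Set.indicator_of_notMem hj]
      refine (Finset.sum_eq_zero fun t _ => ?_).symm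
      have : y j ω ∉ A t := fun hh => hj hh.1
      simp [this]
  · funext c
    simp only [MulHom.coe_mk]
    have e1 : ∫⁻ x in S, c (q x) ∂ν = ∫⁻ x in S, (q.map c) x ∂ν := rfl
    rw [e1, SimpleFunc.lintegral_eq_lintegral, SimpleFunc.map_lintegral,
      ← Finset.sum_coe_sort]
    refine Finset.sum_congr rfl fun t _ => ?_
    rw [ENNReal.coe_toNNReal (fA t), Measure.restrict_apply (q.measurableSet_preimage _), hA,
      Set.inter_comm]

variable [SigmaFinite ν]

/-- Simple approximations of the given functions are made constant on a common partition by pairing;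
every integral in the formula then passes to the limit by monotone convergence. The third moment
served only to run the induction for the fourth. -/
lemma IsPoissonProcess.hasPoissonMoments (h : IsPoissonProcess P ν y) :
    (∀ a : E → ENNReal, Measurable a → ∫⁻ ω, pointSum y a ω ∂P = ∫⁻ x, a x ∂ν) ∧
    (∀ a b : E → ENNReal, Measurable a → Measurable b →
      ∫⁻ ω, pointSum y a ω * pointSum y b ω ∂P =
        ∫⁻ x, a x * b x ∂ν + (∫⁻ x, a x ∂ν) * ∫⁻ x, b x ∂ν) ∧
    (∀ a b c d : E → ENNReal, Measurable a → Measurable b → Measurable c → Measurable d →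
      ∫⁻ ω, pointSum y a ω * pointSum y b ω * pointSum y c ω * pointSum y d ω ∂P =
      ∫⁻ x, a x * b x * c x * d x ∂ν
      + (∫⁻ x, a x * b x * c x ∂ν) * (∫⁻ x, d x ∂ν) + (∫⁻ x, a x * b x * d x ∂ν) * (∫⁻ x, c x ∂ν)
      + (∫⁻ x, a x * c x * d x ∂ν) * (∫⁻ x, b x ∂ν) + (∫⁻ x, b x * c x * d x ∂ν) * (∫⁻ x, a x ∂ν)
      + (∫⁻ x, a x * b x ∂ν) * (∫⁻ x, c x * d x ∂ν) + (∫⁻ x, a x * c x ∂ν) * (∫⁻ x, b x * d x ∂ν)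
      + (∫⁻ x, a x * d x ∂ν) * (∫⁻ x, b x * c x ∂ν)
      + (∫⁻ x, a x * b x ∂ν) * (∫⁻ x, c x ∂ν) * (∫⁻ x, d x ∂ν)
      + (∫⁻ x, a x * c x ∂ν) * (∫⁻ x, b x ∂ν) * (∫⁻ x, d x ∂ν)
      + (∫⁻ x, a x * d x ∂ν) * (∫⁻ x, b x ∂ν) * (∫⁻ x, c x ∂ν)
      + (∫⁻ x, b x * c x ∂ν) * (∫⁻ x, a x ∂ν) * (∫⁻ x, d x ∂ν)
      + (∫⁻ x, b x * d x ∂ν) * (∫⁻ x, a x ∂ν) * (∫⁻ x, c x ∂ν)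
      + (∫⁻ x, c x * d x ∂ν) * (∫⁻ x, a x ∂ν) * (∫⁻ x, b x ∂ν)
      + (∫⁻ x, a x ∂ν) * (∫⁻ x, b x ∂ν) * (∫⁻ x, c x ∂ν) * (∫⁻ x, d x ∂ν)) := by
  set S := spanningSets ν with hSdef
  set ap : (E → ENNReal) → ℕ → E → ENNReal :=
    fun f n => (S n).indicator (SimpleFunc.eapprox f n) with hap
  have mS : ∀ n, MeasurableSet (S n) := measurableSet_spanningSets ν
  have fS : ∀ n, ν (S n) ≠ ⊤ := fun n => (measure_spanningSets_lt_top ν n).ne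
  have map : ∀ f n, Measurable (ap f n) := fun f n => measurable_indicator_eapprox ν f n
  have mps : ∀ f n, Measurable (pointSum y (ap f n)) := fun f n =>
    measurable_pointSum h.measurable_point (map f n)
  have Lx : ∀ {f : E → ENNReal}, Measurable f → ∀ x, MonoLim (fun n => ap f n x) (f x) :=
    fun hf x => exists_simpleFunc_monoLim ν hf x
  have LU : ∀ {f : E → ENNReal}, Measurable f → ∀ ω,
      MonoLim (fun n => pointSum y (ap f n) ω) (pointSum y f ω) :=
    fun hf ω => pointSum_monoLim ν hf ω
  have in1 : ∀ n (u : E → ENNReal), ∫⁻ x in S n, u x ∂ν = ∫⁻ x, (S n).indicator u x ∂ν :=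
    fun n u => (lintegral_indicator (mS n) u).symm
  refine ⟨fun a ha => ?_, fun a b ha hb => ?_, fun a b c d ha hb hc hd => ?_⟩
  · refine (MonoLim.lintegral (mps a) (LU ha)).unique ?_
    have : ∀ n, ∫⁻ ω, pointSum y (ap a n) ω ∂P = ∫⁻ x, ap a n x ∂ν := by
      intro n
      have := (h.hasPoissonMoments_map (SimpleFunc.eapprox a n) (mS n) (fS n)).one id
      rw [in1] at this
      exact this
    simp only [this]
    exact MonoLim.lintegral (map a) (Lx ha)
  · refine (MonoLim.lintegral (fun n => (mps a n).mul (mps b n))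
      (fun ω => (LU ha ω).mul (LU hb ω))).unique ?_
    have i2 : ∀ n, ∫⁻ ω, pointSum y (ap a n) ω * pointSum y (ap b n) ω ∂P =
        ∫⁻ x, ap a n x * ap b n x ∂ν + (∫⁻ x, ap a n x ∂ν) * ∫⁻ x, ap b n x ∂ν := by
      intro n
      -- The two approximations are the coordinate functions of one simple function with values in
      -- pairs.
      have := (h.hasPoissonMoments_map ((SimpleFunc.eapprox a n).pair (SimpleFunc.eapprox b n))
        (mS n) (fS n)).two Prod.fst Prod.snd
      simp only [in1] at this
      refine this.trans ?_
      congr 1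
      refine lintegral_congr fun x => ?_
      by_cases hx : x ∈ S n <;> simp [hap, hx]
    refine Eq.subst (motive := fun u => MonoLim u _) (funext fun n => (i2 n).symm) ?_
    exact (MonoLim.lintegral (fun n => (map a n).mul (map b n))
      (fun x => (Lx ha x).mul (Lx hb x))).add
      ((MonoLim.lintegral (map a) (Lx ha)).mul (MonoLim.lintegral (map b) (Lx hb)))
  · refine (MonoLim.lintegral (fun n => (((mps a n).mul (mps b n)).mul (mps c n)).mul (mps d n))
      (fun ω => (((LU ha ω).mul (LU hb ω)).mul (LU hc ω)).mul (LU hd ω))).unique ?_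
    have I1 : ∀ {f : E → ENNReal}, Measurable f →
        MonoLim (fun n => ∫⁻ x, ap f n x ∂ν) (∫⁻ x, f x ∂ν) := fun hf =>
      MonoLim.lintegral (map _) (Lx hf)
    have I2 : ∀ {f g : E → ENNReal}, Measurable f → Measurable g →
        MonoLim (fun n => ∫⁻ x, ap f n x * ap g n x ∂ν) (∫⁻ x, f x * g x ∂ν) := fun hf hg =>
      MonoLim.lintegral (fun n => (map _ n).mul (map _ n)) (fun x => (Lx hf x).mul (Lx hg x))
    have I3 : ∀ {f g k : E → ENNReal}, Measurable f → Measurable g → Measurable k →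
        MonoLim (fun n => ∫⁻ x, ap f n x * ap g n x * ap k n x ∂ν)
          (∫⁻ x, f x * g x * k x ∂ν) := fun hf hg hk =>
      MonoLim.lintegral (fun n => ((map _ n).mul (map _ n)).mul (map _ n))
        (fun x => ((Lx hf x).mul (Lx hg x)).mul (Lx hk x))
    have I4 : MonoLim (fun n => ∫⁻ x, ap a n x * ap b n x * ap c n x * ap d n x ∂ν)
          (∫⁻ x, a x * b x * c x * d x ∂ν) :=
      MonoLim.lintegral (fun n => (((map _ n).mul (map _ n)).mul (map _ n)).mul (map _ n))
        (fun x => (((Lx ha x).mul (Lx hb x)).mul (Lx hc x)).mul (Lx hd x))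
    have e2 : ∀ n (u v : E → ENNReal) x, (S n).indicator (fun x => u x * v x) x =
        (S n).indicator u x * (S n).indicator v x := by
      intro n u v x
      by_cases hx : x ∈ S n <;> simp [hx]
    have i4 := fun n => (h.hasPoissonMoments_map
      (((SimpleFunc.eapprox a n).pair (SimpleFunc.eapprox b n)).pair
        ((SimpleFunc.eapprox c n).pair (SimpleFunc.eapprox d n)))
        (mS n) (fS n)).four (fun p => p.1.1) (fun p => p.1.2) (fun p => p.2.1) (fun p => p.2.2)
    simp only [in1, Pi.mul_apply, e2] at i4
    refine Eq.subst (motive := fun u => MonoLim u _) (funext fun n => (i4 n).symm) ?_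
    have A1 := I1 ha
    have B1 := I1 hb
    have C1 := I1 hc
    have D1 := I1 hd
    exact (((((((((((((I4.add ((I3 ha hb hc).mul D1)).add ((I3 ha hb hd).mul C1)).add
      ((I3 ha hc hd).mul B1)).add ((I3 hb hc hd).mul A1)).add
      ((I2 ha hb).mul (I2 hc hd))).add ((I2 ha hc).mul (I2 hb hd))).add
      ((I2 ha hd).mul (I2 hb hc))).add
      (((I2 ha hb).mul C1).mul D1)).add (((I2 ha hc).mul B1).mul D1)).add
      (((I2 ha hd).mul B1).mul C1)).add (((I2 hb hc).mul A1).mul D1)).add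
      (((I2 hb hd).mul A1).mul C1)).add (((I2 hc hd).mul A1).mul B1)).add
      (((A1.mul B1).mul C1).mul D1)

end PoissonProcess

/-! ### Moments of sums over a Poisson process: complex functions -/

/-- Bounded measurable complex functions. -/
structure BddMeas {E : Type*} [MeasurableSpace E] (f : E → ℂ) : Prop where
  meas : Measurable f
  bdd : ∃ B : ℝ, ∀ x, ‖f x‖ ≤ B

/-- Bounded measurable integrable complex functions. -/
structure BddInt {E : Type*} [MeasurableSpace E] (ν : Measure E) (f : E → ℂ) : Prop
    extends BddMeas f where
  int : Integrable f ν

namespace BddMeas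

variable {E : Type*} [MeasurableSpace E] {f g : E → ℂ}

lemma one : BddMeas (1 : E → ℂ) := ⟨measurable_one, 1, fun x => by simp⟩

lemma mul (hf : BddMeas f) (hg : BddMeas g) : BddMeas (f * g) := by
  obtain ⟨A, hA⟩ := hf.bdd
  obtain ⟨B, hB⟩ := hg.bdd
  refine ⟨hf.meas.mul hg.meas, A * B, fun x => ?_⟩
  rw [Pi.mul_apply, norm_mul]
  exact mul_le_mul (hA x) (hB x) (norm_nonneg _) ((norm_nonneg _).trans (hA x))

end BddMeas

namespace BddInt

variable {E : Type*} [MeasurableSpace E] {ν : Measure E} {f g : E → ℂ}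

lemma mul_right (hf : BddInt ν f) (hg : BddMeas g) : BddInt ν (f * g) := by
  refine ⟨hf.toBddMeas.mul hg, ?_⟩
  obtain ⟨B, hB⟩ := hg.bdd
  exact hf.int.mul_bdd hg.meas.aestronglyMeasurable (Filter.Eventually.of_forall hB)

lemma add (hf : BddInt ν f) (hg : BddInt ν g) : BddInt ν (f + g) := by
  obtain ⟨A, hA⟩ := hf.bdd
  obtain ⟨B, hB⟩ := hg.bdd
  exact ⟨⟨hf.meas.add hg.meas, A + B, fun x => (norm_add_le _ _).trans (add_le_add (hA x) (hB x))⟩,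
    hf.int.add hg.int⟩

lemma smul (c : ℂ) (hf : BddInt ν f) : BddInt ν (c • f) := by
  obtain ⟨A, hA⟩ := hf.bdd
  refine ⟨⟨hf.meas.const_smul c, ‖c‖ * A, fun x => ?_⟩, hf.int.smul c⟩
  rw [Pi.smul_apply, norm_smul]
  exact mul_le_mul_of_nonneg_left (hA x) (norm_nonneg _)

lemma conj (hf : BddInt ν f) : BddInt ν (fun x => (starRingEnd ℂ) (f x)) := by
  obtain ⟨A, hA⟩ := hf.bdd
  refine ⟨⟨Complex.continuous_conj.measurable.comp hf.meas, A, fun x => ?_⟩, ?_⟩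
  · simpa using hA x
  · exact (LinearIsometryEquiv.integrable_comp_iff (φ := f) Complex.conjLIE).2 hf.int

lemma ofReal_posPart {r : E → ℝ} (hr : Measurable r) (hi : Integrable r ν)
    (hb : ∃ B : ℝ, ∀ x, |r x| ≤ B) : BddInt ν (fun x => ((max (r x) 0 : ℝ) : ℂ)) := by
  obtain ⟨B, hB⟩ := hb
  refine ⟨⟨Complex.measurable_ofReal.comp (hr.max measurable_const), B, fun x => ?_⟩,
    hi.pos_part.ofReal⟩
  rw [Complex.norm_real, Real.norm_eq_abs, abs_of_nonneg (le_max_right _ _)]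
  exact max_le ((le_abs_self _).trans (hB x)) ((abs_nonneg _).trans (hB x))

end BddInt

/-- Functionals that are linear on the bounded integrable functions. -/
structure LinOn {E : Type*} [MeasurableSpace E] (ν : Measure E) (L : (E → ℂ) → ℂ) : Prop where
  map_add : ∀ f g, BddInt ν f → BddInt ν g → L (f + g) = L f + L g
  map_smul : ∀ (c : ℂ) f, BddInt ν f → L (c • f) = c * L f

namespace LinOn

variable {E : Type*} [MeasurableSpace E] {ν : Measure E} {L M : (E → ℂ) → ℂ}

lemma add (hL : LinOn ν L) (hM : LinOn ν M) : LinOn ν (fun f => L f + M f) :=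
  ⟨fun f g hf hg => by rw [hL.map_add f g hf hg, hM.map_add f g hf hg]; ring,
    fun c f hf => by rw [hL.map_smul c f hf, hM.map_smul c f hf]; ring⟩

lemma mul_const (hL : LinOn ν L) (c : ℂ) : LinOn ν (fun f => L f * c) :=
  ⟨fun f g hf hg => by rw [hL.map_add f g hf hg]; ring,
    fun c f hf => by rw [hL.map_smul c f hf]; ring⟩

lemma const_mul (hL : LinOn ν L) (c : ℂ) : LinOn ν (fun f => c * L f) :=
  ⟨fun f g hf hg => by rw [hL.map_add f g hf hg]; ring,
    fun c f hf => by rw [hL.map_smul c f hf]; ring⟩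

/-- The auxiliary `φ` allows the fixed factor to be written on either side of `f` or split into
several factors. -/
lemma integral {φ : (E → ℂ) → E → ℂ} {g : E → ℂ} (hg : BddMeas g) (h : ∀ f, φ f = f * g) :
    LinOn ν (fun f => ∫ x, φ f x ∂ν) := by
  refine ⟨fun u v hu hv => ?_, fun c u hu => ?_⟩
  · simp only [h, add_mul]
    exact integral_add (hu.mul_right hg).int (hv.mul_right hg).int
  · simp only [h, smul_mul_assoc]
    exact integral_const_mul c _

/-- Linear functionals that agree on nonnegative functions are equal. -/
lemma eq_of_nonneg (hL : LinOn ν L) (hM : LinOn ν M)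
    (h : ∀ r : E → ℝ, (∀ x, 0 ≤ r x) → BddInt ν (fun x => (r x : ℂ)) →
      L (fun x => (r x : ℂ)) = M (fun x => (r x : ℂ))) {f : E → ℂ} (hf : BddInt ν f) :
    L f = M f := by
  obtain ⟨B, hB⟩ := hf.bdd
  have bre : ∃ B : ℝ, ∀ x, |(f x).re| ≤ B := ⟨B, fun x => (Complex.abs_re_le_norm _).trans (hB x)⟩
  have bim : ∃ B : ℝ, ∀ x, |(f x).im| ≤ B := ⟨B, fun x => (Complex.abs_im_le_norm _).trans (hB x)⟩
  have bre' : ∃ B : ℝ, ∀ x, |-(f x).re| ≤ B := by simpa using bre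
  have bim' : ∃ B : ℝ, ∀ x, |-(f x).im| ≤ B := by simpa using bim
  have mre := Complex.measurable_re.comp hf.meas
  have mim := Complex.measurable_im.comp hf.meas
  have h1 : BddInt ν (fun x => ((max ((f x).re) 0 : ℝ) : ℂ)) :=
    BddInt.ofReal_posPart mre hf.int.re bre
  have h2 : BddInt ν (fun x => ((max (-(f x).re) 0 : ℝ) : ℂ)) :=
    BddInt.ofReal_posPart mre.neg hf.int.re.neg bre'
  have h3 : BddInt ν (fun x => ((max ((f x).im) 0 : ℝ) : ℂ)) :=
    BddInt.ofReal_posPart mim hf.int.im bim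
  have h4 : BddInt ν (fun x => ((max (-(f x).im) 0 : ℝ) : ℂ)) :=
    BddInt.ofReal_posPart mim.neg hf.int.im.neg bim'
  have e : f = ((fun x => ((max (f x).re 0 : ℝ) : ℂ))
      + (-1 : ℂ) • (fun x => ((max (-(f x).re) 0 : ℝ) : ℂ)))
      + ((Complex.I • (fun x => ((max (f x).im 0 : ℝ) : ℂ)))
      + (-Complex.I) • (fun x => ((max (-(f x).im) 0 : ℝ) : ℂ))) := by
    have hm : ∀ t : ℝ, max t 0 - max (-t) 0 = t := fun t => by
      rcases le_total t 0 with ht | ht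
      · rw [max_eq_right ht, max_eq_left (by linarith)]; ring
      · rw [max_eq_left ht, max_eq_right (by linarith)]; ring
    funext x
    apply Complex.ext
    · simp only [Pi.add_apply, Pi.smul_apply, smul_eq_mul, Complex.add_re, Complex.mul_re,
        Complex.ofReal_re, Complex.ofReal_im, Complex.I_re, Complex.I_im, Complex.neg_re,
        Complex.neg_im, Complex.one_re, Complex.one_im]
      linarith [hm (f x).re]
    · simp only [Pi.add_apply, Pi.smul_apply, smul_eq_mul, Complex.add_im, Complex.mul_im,
        Complex.ofReal_re, Complex.ofReal_im, Complex.I_re, Complex.I_im, Complex.neg_re,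
        Complex.neg_im, Complex.one_re, Complex.one_im]
      linarith [hm (f x).im]
  have gen : ∀ {N : (E → ℂ) → ℂ}, LinOn ν N → N f =
      (N (fun x => ((max (f x).re 0 : ℝ) : ℂ)) + (-1) * N (fun x => ((max (-(f x).re) 0 : ℝ) : ℂ)))
      + (Complex.I * N (fun x => ((max (f x).im 0 : ℝ) : ℂ))
      + (-Complex.I) * N (fun x => ((max (-(f x).im) 0 : ℝ) : ℂ))) := by
    intro N hN
    conv_lhs => rw [e]
    rw [hN.map_add _ _ (h1.add (h2.smul _)) ((h3.smul _).add (h4.smul _)),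
      hN.map_add _ _ h1 (h2.smul _), hN.map_add _ _ (h3.smul _) (h4.smul _),
      hN.map_smul _ _ h2, hN.map_smul _ _ h3, hN.map_smul _ _ h4]
  rw [gen hL, gen hM, h _ (fun x => le_max_right _ _) h1, h _ (fun x => le_max_right _ _) h2,
    h _ (fun x => le_max_right _ _) h3, h _ (fun x => le_max_right _ _) h4]

end LinOn

/-- The sum of a complex function over the random points. -/
noncomputable def complexPointSum {Ω E : Type*} (y : ℕ → Ω → E) (f : E → ℂ) (ω : Ω) : ℂ :=
  ∑' j, f (y j ω)

/-- Hölder's inequality twice: `L⁴ · L⁴ ⊆ L²` and `L² · L² ⊆ L¹`. -/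
lemma MemLp.integrable_mul_four {Ω : Type*} [MeasurableSpace Ω] {P : Measure Ω} {u v w z : Ω → ℂ} (hu : MemLp u 4 P) (hv : MemLp v 4 P)
    (hw : MemLp w 4 P) (hz : MemLp z 4 P) :
    Integrable (fun ω => u ω * (v ω * w ω * z ω)) P := by
  have h42 : ENNReal.HolderTriple 4 4 2 := ⟨by
    rw [← two_mul, ← ENNReal.toReal_eq_toReal_iff' (by finiteness) (by finiteness)]
    simp; norm_num⟩
  have h22 : ENNReal.HolderTriple 2 2 1 := inferInstance
  have h1 : MemLp (v * u) 2 P := hu.mul hv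
  have h2 : MemLp (z * w) 2 P := hw.mul hz
  have h3 : MemLp ((z * w) * (v * u)) 1 P := h1.mul h2
  refine (memLp_one_iff_integrable.1 h3).congr (Filter.Eventually.of_forall fun ω => ?_)
  simp only [Pi.mul_apply]
  ring

lemma MemLp.integrable_mul_two {Ω : Type*} [MeasurableSpace Ω] {P : Measure Ω}
    [IsProbabilityMeasure P] {u v : Ω → ℂ} (hu : MemLp u 4 P) (hv : MemLp v 4 P) :
    Integrable (fun ω => u ω * v ω) P := by
  have h1 : MemLp (1 : Ω → ℂ) 4 P := memLp_const 1
  refine (MemLp.integrable_mul_four hu hv h1 h1).congr (Filter.Eventually.of_forall fun ω => ?_)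
  simp

section PoissonProcess

variable {Ω E : Type*} [MeasurableSpace Ω] [MeasurableSpace E] {P : Measure Ω}
  [IsProbabilityMeasure P] {ν : Measure E} [SigmaFinite ν] {y : ℕ → Ω → E} {f g : E → ℂ}

lemma BddInt.lintegral_enorm_ne_top {E : Type*} [MeasurableSpace E] {ν : Measure E} {f : E → ℂ}
    (hf : BddInt ν f) : ∫⁻ x, ‖f x‖ₑ ∂ν ≠ ⊤ := hf.int.hasFiniteIntegral.ne

/-- Each of the fifteen terms is a product of integrals of `‖f‖`, …, `‖f‖⁴`, all finite for a
bounded integrable function. -/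
lemma IsPoissonProcess.lintegral_pointSum_pow_four_ne_top (h : IsPoissonProcess P ν y)
    (hf : BddInt ν f) : ∫⁻ ω, pointSum y (fun x => ‖f x‖ₑ) ω ^ 4 ∂P ≠ ⊤ := by
  have m : Measurable fun x => ‖f x‖ₑ := hf.meas.enorm
  have e : ∀ ω, pointSum y (fun x => ‖f x‖ₑ) ω ^ 4 = pointSum y (fun x => ‖f x‖ₑ) ω *
      pointSum y (fun x => ‖f x‖ₑ) ω * pointSum y (fun x => ‖f x‖ₑ) ω *
      pointSum y (fun x => ‖f x‖ₑ) ω := fun ω => by ring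
  simp only [e]
  rw [h.hasPoissonMoments.2.2 _ _ _ _ m m m m]
  have h1 := hf.lintegral_enorm_ne_top
  have h2 := (hf.mul_right hf.toBddMeas).lintegral_enorm_ne_top
  have h3 := ((hf.mul_right hf.toBddMeas).mul_right hf.toBddMeas).lintegral_enorm_ne_top
  have h4 := (((hf.mul_right hf.toBddMeas).mul_right hf.toBddMeas).mul_right
    hf.toBddMeas).lintegral_enorm_ne_top
  simp only [Pi.mul_apply, enorm_mul] at h2 h3 h4
  finiteness

lemma IsPoissonProcess.ae_pointSum_ne_top (h : IsPoissonProcess P ν y)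
    (hf : BddInt ν f) : ∀ᵐ ω ∂P, pointSum y (fun x => ‖f x‖ₑ) ω ≠ ⊤ := by
  have m : Measurable fun x => ‖f x‖ₑ := hf.meas.enorm
  have h1 := hf.lintegral_enorm_ne_top
  rw [← h.hasPoissonMoments.1 _ m] at h1
  filter_upwards [ae_lt_top (measurable_pointSum h.measurable_point m) h1] with ω hω
  exact hω.ne

lemma summable_of_pointSum_ne_top {Ω E : Type*} {y : ℕ → Ω → E} {f : E → ℂ} {ω : Ω}
    (h : pointSum y (fun x => ‖f x‖ₑ) ω ≠ ⊤) : Summable fun j => f (y j ω) := by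
  refine Summable.of_nnnorm ?_
  rw [← ENNReal.tsum_coe_ne_top_iff_summable]
  exact h

lemma IsPoissonProcess.ae_summable (h : IsPoissonProcess P ν y)
    (hf : BddInt ν f) : ∀ᵐ ω ∂P, Summable fun j => f (y j ω) := by
  filter_upwards [h.ae_pointSum_ne_top hf] with ω hω
  exact summable_of_pointSum_ne_top hω

lemma IsPoissonProcess.memLp_complexPointSum (h : IsPoissonProcess P ν y)
    (hf : BddInt ν f) : MemLp (complexPointSum y f) 4 P := by
  have hm : AEStronglyMeasurable (complexPointSum y f) P := by
    -- The value `0` of a divergent `tsum` is harmless: the series converges absolutely almost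
    -- surely, so the sum is an almost sure limit of measurable partial sums.
    refine aestronglyMeasurable_of_tendsto_ae Filter.atTop
      (f := fun (n : ℕ) ω => ∑ j ∈ Finset.range n, f (y j ω)) (fun n => ?_) ?_
    · exact (Finset.measurable_fun_sum _ fun j _ =>
        hf.meas.comp (h.measurable_point j)).aestronglyMeasurable
    · filter_upwards [h.ae_summable hf] with ω hω
      exact hω.hasSum.tendsto_sum_nat
  refine ⟨hm, ?_⟩
  rw [eLpNorm_lt_top_iff_lintegral_rpow_enorm_lt_top (by norm_num) (by norm_num)]
  have e : ((4 : ENNReal).toReal) = ((4 : ℕ) : ℝ) := by norm_num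
  simp only [e, ENNReal.rpow_natCast]
  refine lt_of_le_of_lt (lintegral_mono fun ω => ?_)
    (h.lintegral_pointSum_pow_four_ne_top hf).lt_top
  exact pow_le_pow_left' enorm_tsum_le_tsum_enorm 4

lemma IsPoissonProcess.complexPointSum_add (h : IsPoissonProcess P ν y)
    (hf : BddInt ν f) (hg : BddInt ν g) :
    ∀ᵐ ω ∂P, complexPointSum y (f + g) ω = complexPointSum y f ω + complexPointSum y g ω := by
  filter_upwards [h.ae_summable hf, h.ae_summable hg] with ω h1 h2
  exact h1.tsum_add h2

lemma complexPointSum_smul {Ω E : Type*} (y : ℕ → Ω → E) (f : E → ℂ) (c : ℂ) (ω : Ω) :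
    complexPointSum y (c • f) ω = c * complexPointSum y f ω := tsum_mul_left

lemma complexPointSum_conj {Ω E : Type*} (y : ℕ → Ω → E) (f : E → ℂ) (ω : Ω) :
    complexPointSum y (fun x => (starRingEnd ℂ) (f x)) ω =
      (starRingEnd ℂ) (complexPointSum y f ω) := by
  simp only [complexPointSum]
  exact (Complex.conj_tsum _).symm

lemma IsPoissonProcess.linOn_mul (h : IsPoissonProcess P ν y) {φ : (E → ℂ) → Ω → ℂ} {W : Ω → ℂ}
    (hW : ∀ f, BddInt ν f → Integrable (fun ω => complexPointSum y f ω * W ω) P)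
    (hφ : ∀ f ω, φ f ω = complexPointSum y f ω * W ω) :
    LinOn ν (fun f => ∫ ω, φ f ω ∂P) := by
  refine ⟨fun f g hf hg => ?_, fun c f hf => ?_⟩
  · simp only [hφ]
    rw [← integral_add (hW f hf) (hW g hg)]
    refine integral_congr_ae ?_
    filter_upwards [h.complexPointSum_add hf hg] with ω hω
    rw [hω]
    ring
  · simp only [hφ, complexPointSum_smul, mul_assoc]
    exact integral_const_mul c _

lemma complexPointSum_ofReal {Ω E : Type*} {y : ℕ → Ω → E} {r : E → ℝ} (hr : ∀ x, 0 ≤ r x)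
    (ω : Ω) :
    complexPointSum y (fun x => (r x : ℂ)) ω =
      ((pointSum y (fun x => ENNReal.ofReal (r x)) ω).toReal : ℂ) := by
  simp only [complexPointSum, pointSum] at *
  rw [ENNReal.tsum_toReal_eq (fun j => ENNReal.ofReal_ne_top), Complex.ofReal_tsum]
  simp only [ENNReal.toReal_ofReal (hr _)]

end PoissonProcess

/-! ### Second and fourth mixed moments of complex sums. -/

section PoissonProcess

variable {Ω E : Type*} [MeasurableSpace Ω] [MeasurableSpace E] {P : Measure Ω}
  [IsProbabilityMeasure P] {ν : Measure E} [SigmaFinite ν] {y : ℕ → Ω → E}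

lemma BddInt.integral_eq_toReal {E : Type*} [MeasurableSpace E] {ν : Measure E} {f : E → ℂ}
    (hf : BddInt ν f) {F : E → ENNReal} (h : ∀ x, f x = ((F x).toReal : ℂ)) (hF : ∀ x, F x ≠ ⊤) :
    ∫ x, f x ∂ν = ((∫⁻ x, F x ∂ν).toReal : ℂ) ∧ ∫⁻ x, F x ∂ν ≠ ⊤ := by
  have hFm : ∀ x, F x = ‖f x‖ₑ := fun x => by
    rw [h x, ← ofReal_norm, Complex.norm_real, Real.norm_eq_abs,
      abs_of_nonneg ENNReal.toReal_nonneg, ENNReal.ofReal_toReal (hF x)]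
  have hm : Measurable F := by
    rw [funext hFm]
    exact hf.meas.enorm
  refine ⟨?_, ?_⟩
  · simp only [h]
    rw [integral_complex_ofReal, integral_toReal hm.aemeasurable
      (Filter.Eventually.of_forall fun x => (hF x).lt_top)]
  · simp only [hFm]
    exact hf.lintegral_enorm_ne_top

lemma BddInt.meas_ofReal {E : Type*} [MeasurableSpace E] {ν : Measure E} {r : E → ℝ}
    (h : BddInt ν (fun x => (r x : ℂ))) : Measurable fun x => ENNReal.ofReal (r x) :=
  ENNReal.measurable_ofReal.comp (Complex.measurable_re.comp h.meas)

lemma IsPoissonProcess.ae_pointSum_ofReal_ne_top (h : IsPoissonProcess P ν y) {r : E → ℝ}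
    (h0 : ∀ x, 0 ≤ r x) (hr : BddInt ν (fun x => (r x : ℂ))) :
    ∀ᵐ ω ∂P, pointSum y (fun x => ENNReal.ofReal (r x)) ω ≠ ⊤ := by
  have := h.ae_pointSum_ne_top hr
  have e : ∀ x, ‖(r x : ℂ)‖ₑ = ENNReal.ofReal (r x) := fun x => by
    rw [← ofReal_norm, Complex.norm_real, Real.norm_eq_abs, abs_of_nonneg (h0 x)]
  simpa only [e] using this

/-- Both sides are linear in each argument, so it suffices to treat nonnegative functions, where the
formula is the one for `ENNReal`-valued sums. -/
lemma IsPoissonProcess.integral_two (h : IsPoissonProcess P ν y) {a b : E → ℂ}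
    (ha : BddInt ν a) (hb : BddInt ν b) :
    ∫ ω, complexPointSum y a ω * complexPointSum y b ω ∂P =
      ∫ x, (a * b) x ∂ν + (∫ x, a x ∂ν) * ∫ x, b x ∂ν := by
  have hL : ∀ {f}, BddInt ν f → MemLp (complexPointSum y f) 4 P := fun hf =>
    h.memLp_complexPointSum hf
  have L1 : ∀ {b}, BddInt ν b →
      LinOn ν (fun f => ∫ ω, complexPointSum y f ω * complexPointSum y b ω ∂P) := fun hb =>
    h.linOn_mul (fun f hf => MemLp.integrable_mul_two (hL hf) (hL hb)) (fun f ω => rfl)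
  have L2 : ∀ {a}, BddInt ν a →
      LinOn ν (fun f => ∫ ω, complexPointSum y a ω * complexPointSum y f ω ∂P) := fun ha =>
    h.linOn_mul (fun f hf => MemLp.integrable_mul_two (hL hf) (hL ha)) (fun f ω => mul_comm _ _)
  have R1 : ∀ {b}, BddInt ν b → LinOn ν (fun f => ∫ x, (f * b) x ∂ν + (∫ x, f x ∂ν) * ∫ x, b x ∂ν)
      := fun hb => (LinOn.integral hb.toBddMeas (fun f => rfl)).add
        ((LinOn.integral BddMeas.one (φ := id) (fun f => by simp)).mul_const _)
  have R2 : ∀ {a}, BddInt ν a → LinOn ν (fun f => ∫ x, (a * f) x ∂ν + (∫ x, a x ∂ν) * ∫ x, f x ∂ν)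
      := fun ha => (LinOn.integral ha.toBddMeas (fun f => mul_comm _ _)).add
        ((LinOn.integral BddMeas.one (φ := id) (fun f => by simp)).const_mul _)
  refine (L1 hb).eq_of_nonneg (R1 hb) (fun r h0 hr => ?_) ha
  refine (L2 hr).eq_of_nonneg (R2 hr) (fun s k0 hs => ?_) hb
  obtain ⟨e1, n1⟩ := hr.integral_eq_toReal (F := fun x => ENNReal.ofReal (r x))
    (fun x => by rw [ENNReal.toReal_ofReal (h0 x)]) (fun x => ENNReal.ofReal_ne_top)
  obtain ⟨e2, n2⟩ := hs.integral_eq_toReal (F := fun x => ENNReal.ofReal (s x))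
    (fun x => by rw [ENNReal.toReal_ofReal (k0 x)]) (fun x => ENNReal.ofReal_ne_top)
  obtain ⟨e3, n3⟩ := (hr.mul_right hs.toBddMeas).integral_eq_toReal
    (F := fun x => ENNReal.ofReal (r x) * ENNReal.ofReal (s x))
    (fun x => by
      rw [ENNReal.toReal_mul, ENNReal.toReal_ofReal (k0 x), ENNReal.toReal_ofReal (h0 x)]
      simp) (fun x => by finiteness)
  rw [e1, e2, e3]
  simp only [complexPointSum_ofReal h0, complexPointSum_ofReal k0]
  have m1 := measurable_pointSum h.measurable_point hr.meas_ofReal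
  have m2 := measurable_pointSum h.measurable_point hs.meas_ofReal
  simp only [← Complex.ofReal_mul, ← ENNReal.toReal_mul, ← Complex.ofReal_add]
  rw [integral_complex_ofReal, integral_toReal,
    h.hasPoissonMoments.2.1 _ _ hr.meas_ofReal hs.meas_ofReal, ENNReal.toReal_add n3 (by finiteness)]
  · exact (m1.mul m2).aemeasurable
  · filter_upwards [h.ae_pointSum_ofReal_ne_top h0 hr,
      h.ae_pointSum_ofReal_ne_top k0 hs] with ω h1 h2
    exact (ENNReal.mul_ne_top h1 h2).lt_top

/-- The fourth mixed moment of a compound Poisson family, in terms of its cumulants `κ`. -/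
def fourthMoment {R : Type*} [Mul R] (κ : R → ℂ) (a b c d : R) : ℂ :=
  κ (a * b * c * d) + κ (a * b * c) * κ d + κ (a * b * d) * κ c + κ (a * c * d) * κ b
    + κ (b * c * d) * κ a
    + κ (a * b) * κ (c * d) + κ (a * c) * κ (b * d) + κ (a * d) * κ (b * c)
    + κ (a * b) * κ c * κ d + κ (a * c) * κ b * κ d + κ (a * d) * κ b * κ c
    + κ (b * c) * κ a * κ d + κ (b * d) * κ a * κ c + κ (c * d) * κ a * κ b
    + κ a * κ b * κ c * κ d

/-- Cyclic symmetry makes linearity in the first slot sufficient. -/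
lemma fourthMoment_rotate {R : Type*} [CommSemigroup R] (κ : R → ℂ) (a b c d : R) :
    fourthMoment κ a b c d = fourthMoment κ b c d a := by
  simp only [fourthMoment, mul_comm _ a, ← mul_assoc]
  ring

lemma linOn_fourthMoment {E : Type*} [MeasurableSpace E] {ν : Measure E} {b c d : E → ℂ}
    (hb : BddMeas b) (hc : BddMeas c) (hd : BddMeas d) :
    LinOn ν (fun f => fourthMoment (fun g => ∫ x, g x ∂ν) f b c d) := by
  have L0 : LinOn ν (fun f => ∫ x, f x ∂ν) :=
    LinOn.integral BddMeas.one (φ := id) (fun f => by simp)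
  have L1 : ∀ {b : E → ℂ}, BddMeas b → LinOn ν (fun f => ∫ x, (f * b) x ∂ν) := fun hb =>
    LinOn.integral hb (fun f => rfl)
  have L2 : ∀ {b c : E → ℂ}, BddMeas b → BddMeas c → LinOn ν (fun f => ∫ x, (f * b * c) x ∂ν) :=
    fun hb hc => LinOn.integral (hb.mul hc) (fun f => mul_assoc _ _ _)
  have L3 : LinOn ν (fun f => ∫ x, (f * b * c * d) x ∂ν) :=
    LinOn.integral (hb.mul (hc.mul hd)) (fun f => by ring)
  simp only [fourthMoment]
  exact (((((((((((((L3.add ((L2 hb hc).mul_const _)).add ((L2 hb hd).mul_const _)).add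
    ((L2 hc hd).mul_const _)).add (L0.const_mul _)).add ((L1 hb).mul_const _)).add
    ((L1 hc).mul_const _)).add ((L1 hd).mul_const _)).add
    (((L1 hb).mul_const _).mul_const _)).add (((L1 hc).mul_const _).mul_const _)).add
    (((L1 hd).mul_const _).mul_const _)).add ((L0.const_mul _).mul_const _)).add
    ((L0.const_mul _).mul_const _)).add ((L0.const_mul _).mul_const _)).add
    (((L0.mul_const _).mul_const _).mul_const _)

lemma IsPoissonProcess.integral_four_of_nonneg (h : IsPoissonProcess P ν y) {r s t w : E → ℝ}
    (h1 : ∀ x, 0 ≤ r x) (h2 : ∀ x, 0 ≤ s x) (h3 : ∀ x, 0 ≤ t x) (h4 : ∀ x, 0 ≤ w x)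
    {a b c d : E → ℂ} (hr : BddInt ν a) (hs : BddInt ν b) (ht : BddInt ν c) (hw : BddInt ν d)
    (ea : a = fun x => (r x : ℂ)) (eb : b = fun x => (s x : ℂ)) (ec : c = fun x => (t x : ℂ))
    (ed : d = fun x => (w x : ℂ)) :
    ∫ ω, complexPointSum y a ω * (complexPointSum y b ω * complexPointSum y c ω *
      complexPointSum y d ω) ∂P = fourthMoment (fun g => ∫ x, g x ∂ν) a b c d := by
  have toR : ∀ {f : E → ℂ} {r : E → ℝ}, BddInt ν f → (∀ x, 0 ≤ r x) → (f = fun x => (r x : ℂ)) →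
      ∀ x, f x = ((ENNReal.ofReal (r x)).toReal : ℂ) := fun {f r} _ h0 e x => by
    rw [ENNReal.toReal_ofReal (h0 x), e]
  have a1 := toR hr h1 ea
  have b1 := toR hs h2 eb
  have c1 := toR ht h3 ec
  have d1 := toR hw h4 ed
  have nR : ∀ (r : E → ℝ) x, ENNReal.ofReal (r x) ≠ ⊤ := fun r x => ENNReal.ofReal_ne_top
  have J1 : ∀ {f : E → ℂ} {F : E → ENNReal}, BddInt ν f → (∀ x, f x = ((F x).toReal : ℂ)) →
      (∀ x, F x ≠ ⊤) → ∫ x, f x ∂ν = ((∫⁻ x, F x ∂ν).toReal : ℂ) ∧ ∫⁻ x, F x ∂ν ≠ ⊤ :=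
    fun hf e n => hf.integral_eq_toReal e n
  have J2 : ∀ {f g : E → ℂ} {F G : E → ENNReal}, BddInt ν f → BddInt ν g →
      (∀ x, f x = ((F x).toReal : ℂ)) → (∀ x, g x = ((G x).toReal : ℂ)) →
      (∀ x, F x ≠ ⊤) → (∀ x, G x ≠ ⊤) →
      ∫ x, (f * g) x ∂ν = ((∫⁻ x, F x * G x ∂ν).toReal : ℂ) ∧ ∫⁻ x, F x * G x ∂ν ≠ ⊤ :=
    fun hf hg e e' n n' => (hf.mul_right hg.toBddMeas).integral_eq_toReal
      (fun x => by rw [Pi.mul_apply, e, e', ENNReal.toReal_mul, Complex.ofReal_mul])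
      (fun x => ENNReal.mul_ne_top (n x) (n' x))
  have J3 : ∀ {f g k : E → ℂ} {F G K : E → ENNReal}, BddInt ν f → BddInt ν g → BddInt ν k →
      (∀ x, f x = ((F x).toReal : ℂ)) → (∀ x, g x = ((G x).toReal : ℂ)) →
      (∀ x, k x = ((K x).toReal : ℂ)) →
      (∀ x, F x ≠ ⊤) → (∀ x, G x ≠ ⊤) → (∀ x, K x ≠ ⊤) →
      ∫ x, (f * g * k) x ∂ν = ((∫⁻ x, F x * G x * K x ∂ν).toReal : ℂ) ∧
        ∫⁻ x, F x * G x * K x ∂ν ≠ ⊤ :=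
    fun hf hg hk e e' e'' n n' n'' => J2 (hf.mul_right hg.toBddMeas) hk
      (fun x => by rw [Pi.mul_apply, e, e', ENNReal.toReal_mul, Complex.ofReal_mul]) e''
      (fun x => ENNReal.mul_ne_top (n x) (n' x)) n''
  obtain ⟨ia, na⟩ := J1 hr a1 (nR r)
  obtain ⟨ib, nb⟩ := J1 hs b1 (nR s)
  obtain ⟨ic, nc⟩ := J1 ht c1 (nR t)
  obtain ⟨id, nd⟩ := J1 hw d1 (nR w)
  obtain ⟨iab, nab⟩ := J2 hr hs a1 b1 (nR r) (nR s)
  obtain ⟨iac, nac⟩ := J2 hr ht a1 c1 (nR r) (nR t)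
  obtain ⟨iad, nad⟩ := J2 hr hw a1 d1 (nR r) (nR w)
  obtain ⟨ibc, nbc⟩ := J2 hs ht b1 c1 (nR s) (nR t)
  obtain ⟨ibd, nbd⟩ := J2 hs hw b1 d1 (nR s) (nR w)
  obtain ⟨icd, ncd⟩ := J2 ht hw c1 d1 (nR t) (nR w)
  obtain ⟨iabc, nabc⟩ := J3 hr hs ht a1 b1 c1 (nR r) (nR s) (nR t)
  obtain ⟨iabd, nabd⟩ := J3 hr hs hw a1 b1 d1 (nR r) (nR s) (nR w)
  obtain ⟨iacd, nacd⟩ := J3 hr ht hw a1 c1 d1 (nR r) (nR t) (nR w)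
  obtain ⟨ibcd, nbcd⟩ := J3 hs ht hw b1 c1 d1 (nR s) (nR t) (nR w)
  obtain ⟨iabcd, nabcd⟩ := J3 (hr.mul_right hs.toBddMeas) ht hw
    (fun x => by rw [Pi.mul_apply, a1, b1, ← Complex.ofReal_mul, ← ENNReal.toReal_mul]) c1 d1
    (fun x => ENNReal.mul_ne_top (nR r x) (nR s x)) (nR t) (nR w)
  simp only [fourthMoment]
  rw [ia, ib, ic, id, iab, iac, iad, ibc, ibd, icd, iabc, iabd, iacd, ibcd, iabcd]
  rw [ea] at hr
  rw [eb] at hs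
  rw [ec] at ht
  rw [ed] at hw
  have m1 := measurable_pointSum h.measurable_point hr.meas_ofReal
  have m2 := measurable_pointSum h.measurable_point hs.meas_ofReal
  have m3 := measurable_pointSum h.measurable_point ht.meas_ofReal
  have m4 := measurable_pointSum h.measurable_point hw.meas_ofReal
  simp only [ea, eb, ec, ed, complexPointSum_ofReal h1, complexPointSum_ofReal h2,
    complexPointSum_ofReal h3, complexPointSum_ofReal h4]
  simp only [← Complex.ofReal_mul, ← ENNReal.toReal_mul, ← mul_assoc]
  rw [integral_complex_ofReal, integral_toReal,
    h.hasPoissonMoments.2.2 _ _ _ _ hr.meas_ofReal hs.meas_ofReal ht.meas_ofReal hw.meas_ofReal]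
  · iterate 14 rw [ENNReal.toReal_add (by finiteness) (by finiteness)]
    push_cast
    rfl
  · exact (((m1.mul m2).mul m3).mul m4).aemeasurable
  · filter_upwards [h.ae_pointSum_ofReal_ne_top h1 hr, h.ae_pointSum_ofReal_ne_top h2 hs,
      h.ae_pointSum_ofReal_ne_top h3 ht, h.ae_pointSum_ofReal_ne_top h4 hw] with ω k1 k2 k3 k4
    exact (ENNReal.mul_ne_top (ENNReal.mul_ne_top (ENNReal.mul_ne_top k1 k2) k3) k4).lt_top

lemma IsPoissonProcess.integral_four (h : IsPoissonProcess P ν y) {a b c d : E → ℂ}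
    (ha : BddInt ν a) (hb : BddInt ν b) (hc : BddInt ν c) (hd : BddInt ν d) :
    ∫ ω, complexPointSum y a ω * (complexPointSum y b ω * complexPointSum y c ω *
      complexPointSum y d ω) ∂P = fourthMoment (fun g => ∫ x, g x ∂ν) a b c d := by
  have hL : ∀ {f}, BddInt ν f → MemLp (complexPointSum y f) 4 P := fun hf =>
    h.memLp_complexPointSum hf
  have Lin : ∀ {b c d}, BddInt ν b → BddInt ν c → BddInt ν d →
      LinOn ν (fun f => ∫ ω, complexPointSum y f ω * (complexPointSum y b ω *
        complexPointSum y c ω * complexPointSum y d ω) ∂P) := fun hb hc hd =>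
    h.linOn_mul (fun f hf => MemLp.integrable_mul_four (hL hf) (hL hb) (hL hc) (hL hd))
      (fun f ω => rfl)
  have rot : ∀ a b c d : E → ℂ, ∫ ω, complexPointSum y a ω * (complexPointSum y b ω *
      complexPointSum y c ω * complexPointSum y d ω) ∂P = ∫ ω, complexPointSum y b ω *
      (complexPointSum y c ω * complexPointSum y d ω * complexPointSum y a ω) ∂P :=
    fun a b c d => integral_congr_ae (Filter.Eventually.of_forall fun ω => by ring)
  -- The slots are reduced to nonnegative functions one at a time; after each reduction a cyclic
  -- rotation brings the next slot to the front.
  refine (Lin hb hc hd).eq_of_nonneg (linOn_fourthMoment hb.toBddMeas hc.toBddMeas hd.toBddMeas)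
    (fun r h1 hr => ?_) ha
  rw [rot, fourthMoment_rotate]
  refine (Lin hc hd hr).eq_of_nonneg (linOn_fourthMoment hc.toBddMeas hd.toBddMeas hr.toBddMeas)
    (fun s h2 hs => ?_) hb
  rw [rot, fourthMoment_rotate]
  refine (Lin hd hr hs).eq_of_nonneg (linOn_fourthMoment hd.toBddMeas hr.toBddMeas hs.toBddMeas)
    (fun t h3 ht => ?_) hc
  rw [rot, fourthMoment_rotate]
  refine (Lin hr hs ht).eq_of_nonneg (linOn_fourthMoment hr.toBddMeas hs.toBddMeas ht.toBddMeas)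
    (fun w h4 hw => ?_) hd
  exact h.integral_four_of_nonneg h4 h1 h2 h3 hw hr hs ht rfl rfl rfl rfl

end PoissonProcess

/-! ### Intensities, covariance and the non-Gaussian residual. -/

section PoissonProcess

variable {Ω E : Type*} [MeasurableSpace Ω] [MeasurableSpace E] {P : Measure Ω}
  [IsProbabilityMeasure P] {ν : Measure E} [SigmaFinite ν] {y : ℕ → Ω → E} {f g : E → ℂ}

lemma IsPoissonProcess.integral_mul_conj (h : IsPoissonProcess P ν y)
    (hf : BddInt ν f) (hg : BddInt ν g) :
    ∫ ω, complexPointSum y f ω * (starRingEnd ℂ) (complexPointSum y g ω) ∂P =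
      ∫ x, f x * (starRingEnd ℂ) (g x) ∂ν + (∫ x, f x ∂ν) * (starRingEnd ℂ) (∫ x, g x ∂ν) := by
  simp only [← complexPointSum_conj]
  rw [h.integral_two hf hg.conj, integral_conj]
  rfl

lemma ofReal_integral_norm_sq {E : Type*} [MeasurableSpace E] (ν : Measure E) (f : E → ℂ) :
    ((∫ x, ‖f x‖ ^ 2 ∂ν : ℝ) : ℂ) = ∫ x, f x * (starRingEnd ℂ) (f x) ∂ν := by
  rw [← integral_complex_ofReal]
  refine integral_congr_ae (Filter.Eventually.of_forall fun x => ?_)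
  simp only
  rw [Complex.mul_conj, Complex.normSq_eq_norm_sq]

lemma IsPoissonProcess.integral_norm_sq (h : IsPoissonProcess P ν y) (hf : BddInt ν f) :
    ∫ ω, ‖complexPointSum y f ω‖ ^ 2 ∂P = ∫ x, ‖f x‖ ^ 2 ∂ν + ‖∫ x, f x ∂ν‖ ^ 2 := by
  have := h.integral_mul_conj hf hf
  rw [← ofReal_integral_norm_sq, ← ofReal_integral_norm_sq, Complex.mul_conj,
    Complex.normSq_eq_norm_sq] at this
  exact_mod_cast this

/-- Among the partitions of `{f, f̄, g, ḡ}`, only the one with a single block survives without a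
factor `∫ f` or `∫ g` after the subtraction of the Gaussian terms. -/
lemma IsPoissonProcess.abs_nonGaussianResidual_sub_le (h : IsPoissonProcess P ν y)
    (hf : BddInt ν f) (hg : BddInt ν g) :
    |nonGaussianResidual P (complexPointSum y f) (complexPointSum y g)
        - ∫ x, ‖f x‖ ^ 2 * ‖g x‖ ^ 2 ∂ν| ≤
      2 * ‖∫ x, g x ∂ν‖ * (∫ x, ‖f x‖ ^ 2 * ‖g x‖ ∂ν)
        + 2 * ‖∫ x, f x ∂ν‖ * (∫ x, ‖f x‖ * ‖g x‖ ^ 2 ∂ν)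
        + 2 * ‖∫ x, f x ∂ν‖ ^ 2 * ‖∫ x, g x ∂ν‖ ^ 2 := by
  set cf : E → ℂ := fun x => (starRingEnd ℂ) (f x) with hcf
  set cg : E → ℂ := fun x => (starRingEnd ℂ) (g x) with hcg
  set κ : (E → ℂ) → ℂ := fun u => ∫ x, u x ∂ν with hκ
  have hF := h.integral_four hf hf.conj hg hg.conj
  have e4 : ((∫ ω, ‖complexPointSum y f ω‖ ^ 2 * ‖complexPointSum y g ω‖ ^ 2 ∂P : ℝ) : ℂ) =
      fourthMoment κ f cf g cg := by
    rw [← hF, ← integral_complex_ofReal]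
    refine integral_congr_ae (Filter.Eventually.of_forall fun ω => ?_)
    simp only [complexPointSum_conj]
    push_cast
    rw [← Complex.mul_conj', ← Complex.mul_conj']
    ring
  have e1 : ((∫ ω, ‖complexPointSum y f ω‖ ^ 2 ∂P : ℝ) : ℂ) = κ (f * cf) + κ f * κ cf := by
    rw [ofReal_integral_norm_sq, h.integral_mul_conj hf hf, ← integral_conj]
    rfl
  have e2 : ((∫ ω, ‖complexPointSum y g ω‖ ^ 2 ∂P : ℝ) : ℂ) = κ (g * cg) + κ g * κ cg := by
    rw [ofReal_integral_norm_sq, h.integral_mul_conj hg hg, ← integral_conj]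
    rfl
  have conjκ : ∀ u : E → ℂ, (starRingEnd ℂ) (κ u) = κ (fun x => (starRingEnd ℂ) (u x)) :=
    fun u => integral_conj.symm
  have ccf : (fun x => (starRingEnd ℂ) (cf x)) = f := by funext x; simp [hcf]
  have ccg : (fun x => (starRingEnd ℂ) (cg x)) = g := by funext x; simp [hcg]
  have e3 : ((‖∫ ω, complexPointSum y f ω * (starRingEnd ℂ) (complexPointSum y g ω) ∂P‖ ^ 2 : ℝ)
      : ℂ) = (κ (f * cg) + κ f * κ cg) * (κ (cf * g) + κ cf * κ g) := by
    have : ∫ ω, complexPointSum y f ω * (starRingEnd ℂ) (complexPointSum y g ω) ∂P =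
        κ (f * cg) + κ f * κ cg := by
      rw [h.integral_mul_conj hf hg, ← integral_conj]
      rfl
    rw [this]
    push_cast
    rw [← Complex.mul_conj', map_add, map_mul, conjκ, conjκ f, conjκ cg, ccg]
    congr 3
    funext x
    simp [hcf, hcg]
  have e5 : ((‖∫ ω, complexPointSum y f ω * complexPointSum y g ω ∂P‖ ^ 2 : ℝ) : ℂ) =
      (κ (f * g) + κ f * κ g) * (κ (cf * cg) + κ cf * κ cg) := by
    rw [h.integral_two hf hg]
    push_cast
    rw [← Complex.mul_conj', map_add, map_mul]
    change _ * ((starRingEnd ℂ) (κ (f * g)) + (starRingEnd ℂ) (κ f) * (starRingEnd ℂ) (κ g)) = _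
    rw [conjκ, conjκ f, conjκ g]
    congr 3
    funext x
    simp [hcf, hcg]
  have e6 : ((∫ x, ‖f x‖ ^ 2 * ‖g x‖ ^ 2 ∂ν : ℝ) : ℂ) = κ (f * cf * g * cg) := by
    rw [← integral_complex_ofReal]
    refine integral_congr_ae (Filter.Eventually.of_forall fun x => ?_)
    simp only [Pi.mul_apply, hcf, hcg]
    push_cast
    rw [← Complex.mul_conj', ← Complex.mul_conj']
    ring
  -- The four terms of type `3 + 1` remain. Each Gaussian term contains the product of the four
  -- means once, and the fourth moment contains it once, so its coefficient is `1 - 3 = -2`. The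
  -- partitions of types `2 + 2` and `2 + 1 + 1` cancel.
  have key : ((nonGaussianResidual P (complexPointSum y f) (complexPointSum y g)
        - ∫ x, ‖f x‖ ^ 2 * ‖g x‖ ^ 2 ∂ν : ℝ) : ℂ) =
      κ (f * cf * g) * κ cg + κ (f * cf * cg) * κ g + κ (f * g * cg) * κ cf
        + κ (cf * g * cg) * κ f - 2 * (κ f * κ cf) * (κ g * κ cg) := by
    simp only [nonGaussianResidual]
    rw [Complex.ofReal_sub, Complex.ofReal_sub, Complex.ofReal_sub, Complex.ofReal_sub,
      Complex.ofReal_mul, e1, e2, e3, e4, e5, e6]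
    simp only [fourthMoment]
    ring
  have nb : ∀ (u : E → ℂ) (v : E → ℝ), (∀ x, ‖u x‖ = v x) → ‖κ u‖ ≤ ∫ x, v x ∂ν := by
    intro u v huv
    refine (norm_integral_le_integral_norm _).trans (le_of_eq ?_)
    simp only [huv]
  have n1 := nb (f * cf * g) (fun x => ‖f x‖ ^ 2 * ‖g x‖) (fun x => by
    simp only [Pi.mul_apply, norm_mul, hcf, RCLike.norm_conj]; ring)
  have n2 := nb (f * cf * cg) (fun x => ‖f x‖ ^ 2 * ‖g x‖) (fun x => by
    simp only [Pi.mul_apply, norm_mul, hcf, hcg, RCLike.norm_conj]; ring)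
  have n3 := nb (f * g * cg) (fun x => ‖f x‖ * ‖g x‖ ^ 2) (fun x => by
    simp only [Pi.mul_apply, norm_mul, hcg, RCLike.norm_conj]; ring)
  have n4 := nb (cf * g * cg) (fun x => ‖f x‖ * ‖g x‖ ^ 2) (fun x => by
    simp only [Pi.mul_apply, norm_mul, hcf, hcg, RCLike.norm_conj]; ring)
  have c1 : ‖κ cf‖ = ‖κ f‖ := by rw [← conjκ]; simp
  have c2 : ‖κ cg‖ = ‖κ g‖ := by rw [← conjκ]; simp
  rw [← Real.norm_eq_abs, ← Complex.norm_real, key]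
  refine (norm_sub_le _ _).trans ?_
  refine (add_le_add ((norm_add_le _ _).trans (add_le_add ((norm_add_le _ _).trans (add_le_add
    (norm_add_le _ _) le_rfl)) le_rfl)) le_rfl).trans ?_
  simp only [norm_mul, c1, c2]
  have k1 := mul_le_mul_of_nonneg_right n1 (norm_nonneg (κ g))
  have k2 := mul_le_mul_of_nonneg_right n2 (norm_nonneg (κ g))
  have k3 := mul_le_mul_of_nonneg_right n3 (norm_nonneg (κ f))
  have k4 := mul_le_mul_of_nonneg_right n4 (norm_nonneg (κ f))
  have e : ‖(2 : ℂ)‖ = 2 := by simp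
  rw [e]
  change _ ≤ 2 * ‖κ g‖ * _ + 2 * ‖κ f‖ * _ + 2 * ‖κ f‖ ^ 2 * ‖κ g‖ ^ 2
  linarith

lemma covariance_norm_sq_sub {Ω : Type*} [MeasurableSpace Ω] {P : Measure Ω}
    [IsProbabilityMeasure P] {u v : Ω → ℂ} (hu : MemLp u 4 P) (hv : MemLp v 4 P) :
    cov[fun ω => ‖u ω‖ ^ 2, fun ω => ‖v ω‖ ^ 2; P]
        - ‖∫ ω, u ω * (starRingEnd ℂ) (v ω) ∂P‖ ^ 2 =
      nonGaussianResidual P u v + ‖∫ ω, u ω * v ω ∂P‖ ^ 2 := by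
  have sq : ∀ {w : Ω → ℂ}, MemLp w 4 P → MemLp (fun ω => ‖w ω‖ ^ 2) 2 P := by
    intro w hw
    have h42 : ENNReal.HolderTriple 4 4 2 := ⟨by
      rw [← two_mul, ← ENNReal.toReal_eq_toReal_iff' (by finiteness) (by finiteness)]
      simp; norm_num⟩
    have := (hw.norm).mul hw.norm (r := 2)
    refine this.congr_norm ?_ ?_
    · exact (hw.norm.aestronglyMeasurable.pow 2)
    · exact Filter.Eventually.of_forall fun ω => by simp; ring
  rw [covariance_eq_sub (sq hu) (sq hv), nonGaussianResidual]
  simp only [Pi.mul_apply]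
  ring

end PoissonProcess

/-! ### Complexified waves -/

lemma cpow_half_sq (Q : ℂ) : (Q ^ (1 / 2 : ℂ)) ^ 2 = Q := by
  simp

lemma cpow_half_re_pos {Q : ℂ} (hQ : 0 < Q.re) : 0 < (Q ^ (1 / 2 : ℂ)).re := by
  have h0 : Q ≠ 0 := fun h => by simp [h] at hQ
  rw [Complex.cpow_def_of_ne_zero h0, Complex.exp_re]
  have him : (Complex.log Q * (1 / 2)).im = Q.arg / 2 := by
    have : (1 / 2 : ℂ) = ((1 / 2 : ℝ) : ℂ) := by push_cast; rfl
    rw [this, Complex.im_mul_ofReal, Complex.log_im]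
    ring
  rw [him]
  refine mul_pos (Real.exp_pos _) (Real.cos_pos_of_mem_Ioo ⟨?_, ?_⟩)
  · linarith [Complex.neg_pi_lt_arg Q]
  · have := Complex.abs_arg_lt_pi_div_two_iff.2 (Or.inl hQ)
    linarith [(abs_lt.1 this).2, Real.pi_pos]

/-- Real part of `q² = Q` for `q = Q ^ (1 / 2)`. It bounds `q.re` from below; the imaginary part `2
q.re q.im = Q.im` then gives the sign and the size of `q.im`, that is, the decay of `exp (i k q)`.
-/
lemma cpow_half_re_sq {Q : ℂ} :
    (Q ^ (1 / 2 : ℂ)).re ^ 2 = Q.re + (Q ^ (1 / 2 : ℂ)).im ^ 2 := by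
  have := congrArg Complex.re (cpow_half_sq Q)
  rw [sq, Complex.mul_re] at this
  linarith

lemma cpow_half_two_mul_re_mul_im {Q : ℂ} :
    2 * (Q ^ (1 / 2 : ℂ)).re * (Q ^ (1 / 2 : ℂ)).im = Q.im := by
  have := congrArg Complex.im (cpow_half_sq Q)
  rw [sq, Complex.mul_im] at this
  linarith

lemma le_cpow_half_re {Q : ℂ} {m : ℝ} (hQ : 0 < Q.re) (h : m ^ 2 ≤ Q.re) :
    m ≤ (Q ^ (1 / 2 : ℂ)).re := by
  refine le_of_sq_le_sq ?_ (cpow_half_re_pos hQ).le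
  rw [cpow_half_re_sq]
  nlinarith [sq_nonneg (Q ^ (1 / 2 : ℂ)).im]

lemma cpow_half_re_le {Q : ℂ} {M : ℝ} (hM : 0 ≤ M) (h : ‖Q‖ ≤ M ^ 2) :
    (Q ^ (1 / 2 : ℂ)).re ≤ M := by
  refine (Complex.re_le_norm _).trans ?_
  refine le_of_sq_le_sq ?_ hM
  rw [← norm_pow, cpow_half_sq]
  exact h

lemma cpow_half_ofReal {r : ℝ} (hr : 0 ≤ r) : ((r ^ 2 : ℝ) : ℂ) ^ (1 / 2 : ℂ) = r := by
  have : (1 / 2 : ℂ) = ((1 / 2 : ℝ) : ℂ) := by push_cast; rfl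
  rw [this, ← Complex.ofReal_cpow (by positivity), ← Real.sqrt_eq_rpow, Real.sqrt_sq hr]

/-- The parameters of the scattered wave; `D` and `Z` are the cross-range and range coordinates
of the camera. -/
structure WaveParams where
  k : ℝ
  kd : ℝ
  a : ℝ
  ro : ℝ
  D : ℝ
  Z : ℝ

namespace WaveParams

/-- The Rayleigh length. -/
noncomputable def L (w : WaveParams) : ℝ := w.k * w.ro ^ 2 / 2

/-- The holomorphic extension of the square of the distance. -/
def sqDist (x : Fin 3 → ℝ) (u v z : ℂ) : ℂ := (x 0 - u) ^ 2 + (x 1 - v) ^ 2 + (x 2 - z) ^ 2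

/-- The normalized wave at `x` scattered by a particle at `(u, v, z)`, extended holomorphically
to complex positions of the particle. -/
noncomputable def wave (w : WaveParams) (x : Fin 3 → ℝ) (u v z : ℂ) : ℂ :=
  Complex.exp ((Complex.I * w.k - w.kd) * (sqDist x u v z ^ (1 / 2 : ℂ) + z) + w.kd * w.Z)
    / sqDist x u v z ^ (1 / 2 : ℂ) * (1 + Complex.I * z / w.L)⁻¹
    * Complex.exp (-((u ^ 2 + v ^ 2) * (w.ro ^ 2 * (1 + Complex.I * z / w.L))⁻¹))

lemma norm_wave (w : WaveParams) (x : Fin 3 → ℝ) (u v z : ℂ) :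
    ‖w.wave x u v z‖ =
      Real.exp (-w.k * ((sqDist x u v z ^ (1 / 2 : ℂ)).im + z.im)
        + w.kd * (w.Z - (sqDist x u v z ^ (1 / 2 : ℂ)).re - z.re))
      / ‖sqDist x u v z ^ (1 / 2 : ℂ)‖ * ‖1 + Complex.I * z / w.L‖⁻¹
      * Real.exp (-((u ^ 2 + v ^ 2) * (w.ro ^ 2 * (1 + Complex.I * z / w.L))⁻¹).re) := by
  rw [wave, norm_mul, norm_mul, norm_div, Complex.norm_exp, Complex.norm_exp, norm_inv,
    Complex.neg_re]
  congr 4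
  simp only [Complex.add_re, Complex.mul_re, Complex.sub_re, Complex.sub_im, Complex.mul_im,
    Complex.add_im, Complex.I_re, Complex.I_im, Complex.ofReal_re, Complex.ofReal_im]
  ring

/-- A bound of the wave where the real part of the squared distance is positive. -/
lemma norm_wave_le (w : WaveParams) (hk : 0 ≤ w.k) {x : Fin 3 → ℝ} {u v z : ℂ}
    {m s A B g : ℝ} (hm : 0 < m) (hQ : m ^ 2 ≤ (sqDist x u v z).re)
    (hs : s ≤ (sqDist x u v z ^ (1 / 2 : ℂ)).im + z.im)
    (hA : w.kd * (w.Z - (sqDist x u v z ^ (1 / 2 : ℂ)).re - z.re) ≤ A)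
    (hB : 0 < B) (hB' : B ≤ ‖1 + Complex.I * z / w.L‖)
    (hg : g ≤ ((u ^ 2 + v ^ 2) * (w.ro ^ 2 * (1 + Complex.I * z / w.L))⁻¹).re) :
    ‖w.wave x u v z‖ ≤ Real.exp A / (m * B) * Real.exp (-w.k * s - g) := by
  have hm2 : m ≤ ‖sqDist x u v z ^ (1 / 2 : ℂ)‖ :=
    (le_cpow_half_re (lt_of_lt_of_le (by positivity) hQ) hQ).trans (Complex.re_le_norm _)
  rw [norm_wave]
  calc _ ≤ Real.exp (-w.k * s + A) / m * B⁻¹ * Real.exp (-g) := by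
        have h1 := mul_le_mul_of_nonneg_left hs hk
        have h2 : -w.k * ((sqDist x u v z ^ (1 / 2 : ℂ)).im + z.im)
          + w.kd * (w.Z - (sqDist x u v z ^ (1 / 2 : ℂ)).re - z.re) ≤ -w.k * s + A := by linarith
        gcongr
    _ = _ := by
        rw [Real.exp_add, sub_eq_add_neg, Real.exp_add]
        field_simp

end WaveParams

/-! ### The scaling regime, and the beam factor on rotated rays. -/

namespace WaveParams

/-- The scaling regime in terms of the coordinates `D`, `Z` of the camera and a small
parameter `t`. -/
structure Regime (w : WaveParams) (t : ℝ) : Prop where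
  k_pos : 0 < w.k
  kd_pos : 0 < w.kd
  a_pos : 0 < w.a
  ro_pos : 0 < w.ro
  D_pos : 0 < w.D
  Z_pos : 0 < w.Z
  t_pos : 0 < t
  t_le : t ≤ 1 / 10000
  a_ro : w.a ≤ t * w.ro
  ro_D : w.ro ≤ t * w.D
  D_Z : w.D ≤ t * w.Z
  Z_L : w.Z ≤ t * w.L
  kd_D : w.kd * w.D ≤ t
  tail : (w.Z / w.a) ^ 16 * Real.exp (-(t * (w.D / w.ro) ^ 2)) ≤ t

/-- The point `x` is close to the centre `(D, 0, Z)` of the camera. -/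
structure Close (w : WaveParams) (t : ℝ) (x : Fin 3 → ℝ) : Prop where
  zero : |x 0 - w.D| ≤ t * w.D
  one : |x 1| ≤ t * w.D
  two : |x 2 - w.Z| ≤ t * w.D

lemma Regime.L_pos {w : WaveParams} {t : ℝ} (h : w.Regime t) : 0 < w.L := by
  have := h.k_pos
  have := h.ro_pos
  rw [L]
  positivity

/-- A unit complex number `c + i s` in the sector of opening `π / 6`. -/
structure Sector (c s : ℝ) : Prop where
  unit : c ^ 2 + s ^ 2 = 1
  c_nonneg : 0 ≤ c
  s_nonneg : 0 ≤ s
  opening : 1 / 2 ≤ c ^ 2 - s ^ 2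

namespace Sector

variable {c s : ℝ}

lemma c_ge (h : Sector c s) : 43 / 50 ≤ c := by nlinarith [h.unit, h.opening, h.c_nonneg]

lemma c_le (h : Sector c s) : c ≤ 1 := by nlinarith [h.unit, sq_nonneg s, h.c_nonneg]

lemma s_le (h : Sector c s) : s ≤ 1 / 2 := by nlinarith [h.unit, h.opening, h.s_nonneg]

end Sector

/-- The complex factor of the beam at range `r (c + i s) z`. -/
noncomputable def beta (w : WaveParams) (E : ℂ) (z : ℝ) : ℂ := 1 + Complex.I * (E * z) / w.L

lemma beta_re (w : WaveParams) (r c s z : ℝ) :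
    (w.beta (r * (c + s * Complex.I)) z).re = 1 - r * s * (z / w.L) := by
  have : w.beta (r * (c + s * Complex.I)) z =
      ((1 - r * s * (z / w.L) : ℝ) : ℂ) + ((r * c * (z / w.L) : ℝ) : ℂ) * Complex.I := by
    simp only [beta]
    push_cast
    linear_combination ((r : ℂ) * s * z / w.L) * Complex.I_sq
  rw [this]
  simp

lemma beta_im (w : WaveParams) (r c s z : ℝ) :
    (w.beta (r * (c + s * Complex.I)) z).im = r * c * (z / w.L) := by
  have : w.beta (r * (c + s * Complex.I)) z =
      ((1 - r * s * (z / w.L) : ℝ) : ℂ) + ((r * c * (z / w.L) : ℝ) : ℂ) * Complex.I := by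
    simp only [beta]
    push_cast
    linear_combination ((r : ℂ) * s * z / w.L) * Complex.I_sq
  rw [this]
  simp

lemma normSq_beta (w : WaveParams) {r c s z : ℝ} (h : Sector c s) :
    Complex.normSq (w.beta (r * (c + s * Complex.I)) z) =
      1 - 2 * r * s * (z / w.L) + (r * (z / w.L)) ^ 2 := by
  rw [Complex.normSq_apply, beta_re, beta_im]
  linear_combination (r * (z / w.L)) ^ 2 * h.unit

/-- The squared modulus is `(r z / L - s)² + c²`, and `c² ≥ 3 / 4` in the sector. Rotated ranges
thus stay away from the zero of the beam factor. -/
lemma normSq_beta_ge (w : WaveParams) {r c s z : ℝ} (h : Sector c s) :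
    3 / 4 ≤ Complex.normSq (w.beta (r * (c + s * Complex.I)) z) := by
  rw [normSq_beta w h]
  nlinarith [sq_nonneg (r * (z / w.L) - s), h.unit, h.opening]

lemma norm_beta_ge (w : WaveParams) {r c s z : ℝ} (h : Sector c s) :
    1 / 2 ≤ ‖w.beta (r * (c + s * Complex.I)) z‖ := by
  have := normSq_beta_ge w (r := r) (z := z) h
  rw [Complex.normSq_eq_norm_sq] at this
  nlinarith [norm_nonneg (w.beta (r * (c + s * Complex.I)) z)]

/-- `E ^ 2 / beta`, the coefficient of the Gaussian profile in rotated coordinates. -/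
noncomputable def gaussCoeff (w : WaveParams) (E : ℂ) (z : ℝ) : ℂ := E ^ 2 * (w.beta E z)⁻¹

lemma gaussCoeff_re (w : WaveParams) {r c s z : ℝ} (h : Sector c s) :
    (w.gaussCoeff (r * (c + s * Complex.I)) z).re =
      r ^ 2 * (c ^ 2 - s ^ 2 + r * (z / w.L) * s) /
        Complex.normSq (w.beta (r * (c + s * Complex.I)) z) := by
  rw [gaussCoeff, Complex.mul_re, Complex.inv_re, Complex.inv_im, beta_re, beta_im]
  have e : ((r : ℂ) * (c + s * Complex.I)) ^ 2 = ((r ^ 2 * (c ^ 2 - s ^ 2) : ℝ) : ℂ) +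
      ((r ^ 2 * (2 * c * s) : ℝ) : ℂ) * Complex.I := by
    push_cast
    linear_combination ((r : ℂ) ^ 2 * s ^ 2) * Complex.I_sq
  rw [e]
  simp only [Complex.add_re, Complex.add_im, Complex.ofReal_re, Complex.ofReal_im, Complex.mul_re,
    Complex.mul_im, Complex.I_re, Complex.I_im]
  generalize Complex.normSq (w.beta (r * (c + s * Complex.I)) z) = N
  generalize z / w.L = ζ
  simp only [div_eq_mul_inv]
  linear_combination N⁻¹ * (r ^ 3 * ζ * s) * h.unit

/-- The opening of the sector gives `Re E² ≥ r² / 2`, and `|β|²` exceeds `1` by at most a small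
multiple of `r²` because `z ≪ L`. Hence the Gaussian profile still decays after rotation. -/
lemma gaussCoeff_re_ge (w : WaveParams) {r c s z : ℝ} (h : Sector c s) (hr : 1 ≤ r)
    (hz : 0 ≤ z / w.L) (hz' : z / w.L ≤ 1 / 10) :
    1 / 4 ≤ (w.gaussCoeff (r * (c + s * Complex.I)) z).re := by
  have h0 := normSq_beta_ge w (r := r) (z := z) h
  rw [gaussCoeff_re w h, le_div_iff₀ (by linarith), normSq_beta w h]
  set ζ := z / w.L
  have h1 : 0 ≤ r * ζ * s := by have := h.s_nonneg; positivity
  have h2 : r * ζ ≤ r * (1 / 10) := mul_le_mul_of_nonneg_left hz' (by linarith)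
  have h3 : 0 ≤ r * ζ := by positivity
  have h4 : r ^ 2 * (1 / 2) ≤ r ^ 2 * (c ^ 2 - s ^ 2 + r * ζ * s) :=
    mul_le_mul_of_nonneg_left (by linarith [h.opening]) (by positivity)
  nlinarith

lemma norm_gaussCoeff_le (w : WaveParams) {c s z : ℝ} (h : Sector c s) :
    ‖w.gaussCoeff (c + s * Complex.I) z‖ ≤ 2 := by
  have h0 := norm_beta_ge w (r := 1) (z := z) h
  rw [Complex.ofReal_one, one_mul] at h0
  have e : ‖(c + s * Complex.I : ℂ)‖ ^ 2 = 1 := by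
    rw [← Complex.normSq_eq_norm_sq, Complex.normSq_add_mul_I]
    exact h.unit
  rw [gaussCoeff, norm_mul, norm_pow, e, one_mul, norm_inv]
  exact inv_le_of_inv_le₀ (by norm_num) (by linarith)

lemma gauss_exponent (w : WaveParams) (E u v : ℂ) (z : ℝ) :
    ((E * u) ^ 2 + (E * v) ^ 2) * (w.ro ^ 2 * (1 + Complex.I * (E * z) / w.L))⁻¹ =
      w.gaussCoeff E z * (u ^ 2 + v ^ 2) * (((w.ro ^ 2)⁻¹ : ℝ) : ℂ) := by
  rw [gaussCoeff, beta, mul_inv]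
  push_cast
  ring

lemma gauss_exponent_re_ge (w : WaveParams) {r c s z : ℝ} (h : Sector c s) (hr : 1 ≤ r)
    (hz : 0 ≤ z / w.L) (hz' : z / w.L ≤ 1 / 10) (u v : ℝ) :
    (u ^ 2 + v ^ 2) / (4 * w.ro ^ 2) ≤
      ((((r * (c + s * Complex.I) : ℂ) * u) ^ 2 + ((r * (c + s * Complex.I) : ℂ) * v) ^ 2) *
        (w.ro ^ 2 * (1 + Complex.I * ((r * (c + s * Complex.I) : ℂ) * z) / w.L))⁻¹).re := by
  rw [gauss_exponent, Complex.re_mul_ofReal]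
  have e : ((u : ℂ) ^ 2 + (v : ℂ) ^ 2) = ((u ^ 2 + v ^ 2 : ℝ) : ℂ) := by push_cast; rfl
  rw [e, Complex.re_mul_ofReal]
  have h1 := gaussCoeff_re_ge w h hr hz hz'
  calc _ = (1 / 4) * (u ^ 2 + v ^ 2) * (w.ro ^ 2)⁻¹ := by
        rw [mul_comm 4, div_mul_eq_div_div, div_eq_mul_inv, div_eq_mul_inv]; ring
    _ ≤ _ := by gcongr

/-- The price of the shift by `-iτ` in the Gaussian exponent: at most `D² / (120 r_o²)`, a small
part of the decay available at `|u| = D / 2`. -/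
lemma gauss_exponent_box (w : WaveParams) (hD : 0 ≤ w.D) {c s z : ℝ} (h : Sector c s)
    (hz : 0 ≤ z / w.L) (hz' : z / w.L ≤ 1 / 10) {u v τ : ℝ} (hu : |u| ≤ w.D / 2) (hτ : 0 ≤ τ)
    (hτ' : τ ≤ w.D / 256) :
    (u ^ 2 / 4 - w.D ^ 2 / 120) / w.ro ^ 2 ≤
      ((((c + s * Complex.I : ℂ) * (u - τ * Complex.I)) ^ 2 + ((c + s * Complex.I : ℂ) * v) ^ 2) *
        (w.ro ^ 2 * (1 + Complex.I * ((c + s * Complex.I : ℂ) * z) / w.L))⁻¹).re := by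
  rw [gauss_exponent, Complex.re_mul_ofReal, div_eq_mul_inv]
  gcongr
  have h1 := gaussCoeff_re_ge w h le_rfl hz hz'
  rw [Complex.ofReal_one, one_mul] at h1
  have h2 := norm_gaussCoeff_le w (z := z) h
  set Γ := w.gaussCoeff (c + s * Complex.I) z
  have e : (u - τ * Complex.I : ℂ) ^ 2 + (v : ℂ) ^ 2 =
      ((u ^ 2 + v ^ 2 - τ ^ 2 : ℝ) : ℂ) + ((-2 * u * τ : ℝ) : ℂ) * Complex.I := by
    push_cast
    linear_combination (τ : ℂ) ^ 2 * Complex.I_sq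
  rw [e, Complex.mul_re]
  simp only [Complex.add_re, Complex.add_im, Complex.ofReal_re, Complex.ofReal_im, Complex.mul_re,
    Complex.mul_im, Complex.I_re, Complex.I_im]
  have h3 : |Γ.im| ≤ 2 := (Complex.abs_im_le_norm _).trans h2
  have h4 : Γ.re ≤ 2 := (Complex.re_le_norm _).trans h2
  have h5 : |u * τ| ≤ w.D / 2 * (w.D / 256) := by
    rw [abs_mul, abs_of_nonneg hτ]
    exact mul_le_mul hu hτ' hτ (by positivity)
  -- The loss is `2 |Im Γ · u τ| + Re Γ · τ² ≤ D² / 128 + D² / 32768 < D² / 120`.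
  have h6 : |Γ.im * (u * τ)| ≤ 2 * (w.D / 2 * (w.D / 256)) := by
    rw [abs_mul]
    exact mul_le_mul h3 h5 (abs_nonneg _) (by norm_num)
  have h7 := (abs_le.1 h6).1
  have h8 : τ ^ 2 ≤ (w.D / 256) ^ 2 := pow_le_pow_left₀ hτ hτ' 2
  have h9 : Γ.re * τ ^ 2 ≤ 2 * (w.D / 256) ^ 2 := mul_le_mul h4 h8 (sq_nonneg _) (by norm_num)
  have h10 : (1 / 4) * u ^ 2 ≤ Γ.re * (u ^ 2 + v ^ 2) := by
    nlinarith [sq_nonneg u, sq_nonneg v]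
  nlinarith

end WaveParams

/-! ### The wave on the shifted cross-range rectangle. -/

namespace WaveParams

/-- Real part of the squared distance in rotated coordinates, with the first coordinate shifted
by `-τ` in the imaginary direction. -/
lemma sqDist_re (x : Fin 3 → ℝ) (c s u v z τ : ℝ) :
    (sqDist x ((c + s * Complex.I) * (u - τ * Complex.I)) ((c + s * Complex.I) * v)
      ((c + s * Complex.I) * z)).re =
    (x 0 - c * u - s * τ) ^ 2 - (c * τ - s * u) ^ 2 + ((x 1 - c * v) ^ 2 - (s * v) ^ 2)
      + ((x 2 - c * z) ^ 2 - (s * z) ^ 2) := by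
  simp only [sqDist, sq, Complex.add_re, Complex.sub_re, Complex.sub_im, Complex.add_im,
    Complex.ofReal_re, Complex.ofReal_im, Complex.mul_re, Complex.mul_im, Complex.I_re,
    Complex.I_im]
  ring

lemma sqDist_im (x : Fin 3 → ℝ) (c s u v z τ : ℝ) :
    (sqDist x ((c + s * Complex.I) * (u - τ * Complex.I)) ((c + s * Complex.I) * v)
      ((c + s * Complex.I) * z)).im =
    2 * (x 0 - c * u - s * τ) * (c * τ - s * u) - 2 * (x 1 - c * v) * (s * v)
      - 2 * (x 2 - c * z) * (s * z) := by
  simp only [sqDist, sq, Complex.add_re, Complex.sub_re, Complex.sub_im, Complex.add_im,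
    Complex.ofReal_re, Complex.ofReal_im, Complex.mul_re, Complex.mul_im, Complex.I_re,
    Complex.I_im]
  ring

lemma norm_sqDist_le {x : Fin 3 → ℝ} {c s u v z τ : ℝ} (h : Sector c s) :
    ‖sqDist x ((c + s * Complex.I) * (u - τ * Complex.I)) ((c + s * Complex.I) * v)
      ((c + s * Complex.I) * z)‖ ≤ (|x 0| + |u| + |τ|) ^ 2 + (|x 1| + |v|) ^ 2
        + (|x 2| + |z|) ^ 2 := by
  have e : ‖(c + s * Complex.I : ℂ)‖ = 1 := by
    have : ‖(c + s * Complex.I : ℂ)‖ ^ 2 = 1 := by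
      rw [← Complex.normSq_eq_norm_sq, Complex.normSq_add_mul_I]
      exact h.unit
    nlinarith [norm_nonneg (c + s * Complex.I : ℂ)]
  have n : ∀ (p : ℝ) (q : ℂ), ‖(p : ℂ) - (c + s * Complex.I) * q‖ ≤ |p| + ‖q‖ := by
    intro p q
    refine (norm_sub_le _ _).trans ?_
    rw [norm_mul, e, one_mul, Complex.norm_real, Real.norm_eq_abs]
  refine (norm_add_le _ _).trans (add_le_add ((norm_add_le _ _).trans (add_le_add ?_ ?_)) ?_)
  · rw [norm_pow]
    refine pow_le_pow_left₀ (norm_nonneg _) ((n _ _).trans ?_) 2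
    have : ‖(u - τ * Complex.I : ℂ)‖ ≤ |u| + |τ| := by
      refine (norm_sub_le _ _).trans (le_of_eq ?_)
      simp
    linarith
  · rw [norm_pow]
    refine pow_le_pow_left₀ (norm_nonneg _) ((n _ _).trans (le_of_eq ?_)) 2
    simp
  · rw [norm_pow]
    refine pow_le_pow_left₀ (norm_nonneg _) ((n _ _).trans (le_of_eq ?_)) 2
    simp

section

variable {w : WaveParams} {t : ℝ} {x : Fin 3 → ℝ} {c s u v z τ : ℝ}

/-- The set of rotations and ranges for which the cross-range coordinate can be shifted. -/
def Admissible (w : WaveParams) (c s z : ℝ) : Prop :=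
  Sector c s ∧ ((s = 0 ∧ 0 < z ∧ z ≤ 8 * w.Z) ∨ z = 8 * w.Z)

lemma Admissible.z_pos (hE : w.Admissible c s z) (hw : w.Regime t) : 0 < z ∧ z ≤ 8 * w.Z := by
  have := hw.Z_pos
  rcases hE.2 with h | h
  · exact h.2
  · exact ⟨by linarith, h.le⟩

lemma Regime.div_L (hw : w.Regime t) (hz : 0 < z ∧ z ≤ 8 * w.Z) :
    0 ≤ z / w.L ∧ z / w.L ≤ 1 / 10 := by
  have hL := hw.L_pos
  refine ⟨div_nonneg hz.1.le hL.le, ?_⟩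
  rw [div_le_iff₀ hL]
  have := hw.Z_L
  have := hw.t_le
  nlinarith

/-- A positive real part keeps the squared distance on the principal branch. Without rotation the
gap of about `D / 2` between the box and the camera dominates `τ`. With rotation the range is `8 Z`,
and `(x 2 - c z)² ≥ (5 Z)²` beats `(s z)² ≤ (4 Z)²` and the cross-range terms. The second statement
serves to bound the damping factor. -/
lemma sqDist_re_box (hw : w.Regime t) (hx : w.Close t x) (hE : w.Admissible c s z)
    (hu : |u| ≤ w.D / 2) (hv : |v| ≤ w.D / 2) (hτ : 0 ≤ τ) (hτ' : τ ≤ w.D / 256) :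
    (w.D / 4) ^ 2 ≤ (sqDist x ((c + s * Complex.I) * (u - τ * Complex.I))
      ((c + s * Complex.I) * v) ((c + s * Complex.I) * z)).re ∧
    (c = 1 → s = 0 → (x 2 - z) ^ 2 ≤ (sqDist x ((c + s * Complex.I) * (u - τ * Complex.I))
      ((c + s * Complex.I) * v) ((c + s * Complex.I) * z)).re) := by
  have hD := hw.D_pos
  have hZ := hw.Z_pos
  have h0 := abs_le.1 (hx.zero.trans (mul_le_mul_of_nonneg_right hw.t_le hD.le))
  have h2 := abs_le.1 (hx.two.trans (mul_le_mul_of_nonneg_right hw.t_le hD.le))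
  have hDZ := hw.D_Z.trans (mul_le_mul_of_nonneg_right hw.t_le hZ.le)
  have hu' := abs_le.1 hu
  have hv' := abs_le.1 hv
  rw [sqDist_re]
  have near : s = 0 → c = 1 → (w.D / 4) ^ 2 ≤ (x 0 - c * u - s * τ) ^ 2 - (c * τ - s * u) ^ 2 := by
    rintro rfl rfl
    nlinarith
  have base : ∀ {A B C : ℝ}, s = 0 → (w.D / 4) ^ 2 ≤ A →
      (w.D / 4) ^ 2 ≤ A + (B ^ 2 - (s * v) ^ 2) + (C ^ 2 - (s * z) ^ 2) := by
    rintro A B C rfl hA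
    nlinarith [sq_nonneg B, sq_nonneg C]
  obtain ⟨hS, hcase⟩ := hE
  refine ⟨?_, ?_⟩
  · rcases hcase with ⟨rfl, _, _⟩ | rfl
    · have hc : c = 1 := by nlinarith [hS.unit, hS.c_nonneg]
      exact base rfl (near rfl hc)
    · have hc := hS.c_ge
      have hs := hS.s_le
      have hs0 := hS.s_nonneg
      have h3 : (5 * w.Z) ^ 2 ≤ (x 2 - c * (8 * w.Z)) ^ 2 := by
        have : 5 * w.Z ≤ c * (8 * w.Z) - x 2 := by nlinarith
        nlinarith
      have h4 : (s * (8 * w.Z)) ^ 2 ≤ (4 * w.Z) ^ 2 := by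
        have : s * (8 * w.Z) ≤ 4 * w.Z := by nlinarith
        have h40 : 0 ≤ s * (8 * w.Z) := by positivity
        exact pow_le_pow_left₀ h40 this 2
      have h5 : (s * v) ^ 2 ≤ w.D ^ 2 := by
        have : |s * v| ≤ w.D := by
          rw [abs_mul, abs_of_nonneg hs0]
          nlinarith [abs_nonneg v]
        nlinarith [sq_abs (s * v), abs_nonneg (s * v)]
      have h6 : (c * τ - s * u) ^ 2 ≤ w.D ^ 2 := by
        have : |c * τ - s * u| ≤ w.D := by
          refine (abs_sub _ _).trans ?_
          rw [abs_mul, abs_mul, abs_of_nonneg hs0, abs_of_nonneg hS.c_nonneg, abs_of_nonneg hτ]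
          nlinarith [abs_nonneg u, hS.c_le]
        nlinarith [sq_abs (c * τ - s * u), abs_nonneg (c * τ - s * u)]
      nlinarith [sq_nonneg (x 0 - c * u - s * τ), sq_nonneg (x 1 - c * v)]
  · rintro rfl rfl
    have := near rfl rfl
    nlinarith [sq_nonneg (x 1 - 1 * v), sq_nonneg (w.D / 4)]

/-- The gain is `2 A c τ`, where `A ≥ 49 D / 100` is the offset towards the camera and `2 · 0.49 ·
0.86 ≥ 4 / 5`. The other cross-range terms cost at most `4 s D²`; the range term, nonzero only at `z
= 8 Z`, is of size `s Z²` and pays for them. -/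
lemma sqDist_im_box (hw : w.Regime t) (hx : w.Close t x) (hE : w.Admissible c s z)
    (hu : |u| ≤ w.D / 2) (hv : |v| ≤ w.D / 2) (hτ : 0 ≤ τ) (hτ' : τ ≤ w.D / 256) :
    4 / 5 * w.D * τ ≤ (sqDist x ((c + s * Complex.I) * (u - τ * Complex.I))
      ((c + s * Complex.I) * v) ((c + s * Complex.I) * z)).im := by
  have hD := hw.D_pos
  have hZ := hw.Z_pos
  have h0 := abs_le.1 (hx.zero.trans (mul_le_mul_of_nonneg_right hw.t_le hD.le))
  have h1 := abs_le.1 (hx.one.trans (mul_le_mul_of_nonneg_right hw.t_le hD.le))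
  have h2 := abs_le.1 (hx.two.trans (mul_le_mul_of_nonneg_right hw.t_le hD.le))
  have hDZ := hw.D_Z.trans (mul_le_mul_of_nonneg_right hw.t_le hZ.le)
  have hu' := abs_le.1 hu
  have hv' := abs_le.1 hv
  obtain ⟨hS, hcase⟩ := hE
  have hc := hS.c_ge
  have hc1 := hS.c_le
  have hs := hS.s_le
  have hs0 := hS.s_nonneg
  rw [sqDist_im]
  have cu : |c * u| ≤ w.D / 2 := by
    rw [abs_mul, abs_of_nonneg hS.c_nonneg]
    nlinarith [abs_nonneg u]
  have cv : |c * v| ≤ w.D / 2 := by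
    rw [abs_mul, abs_of_nonneg hS.c_nonneg]
    nlinarith [abs_nonneg v]
  have cu' := abs_le.1 cu
  have cv' := abs_le.1 cv
  have sτ : 0 ≤ s * τ := mul_nonneg hs0 hτ
  have sτ' : s * τ ≤ w.D / 256 := by nlinarith
  set A := x 0 - c * u - s * τ with hA
  have A1 : 49 / 100 * w.D ≤ A := by linarith
  have A2 : A ≤ 2 * w.D := by linarith
  have A0 : 0 ≤ A := by linarith
  have t1 : 4 / 5 * w.D * τ ≤ 2 * A * (c * τ) := by
    have : 2 * (49 / 100 * w.D) * (43 / 50 * τ) ≤ 2 * A * (c * τ) := by gcongr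
    nlinarith [mul_nonneg hD.le hτ]
  have t2 : 2 * A * (s * u) ≤ s * (2 * w.D ^ 2) := by
    have : A * u ≤ w.D ^ 2 := by nlinarith
    have := mul_le_mul_of_nonneg_left this hs0
    linarith
  have t3 : 2 * (x 1 - c * v) * (s * v) ≤ s * (2 * w.D ^ 2) := by
    have : (x 1 - c * v) * v ≤ w.D ^ 2 := by
      have h : |(x 1 - c * v) * v| ≤ w.D * (w.D / 2) := by
        rw [abs_mul]
        exact mul_le_mul (abs_le.2 ⟨by linarith, by linarith⟩) hv (abs_nonneg _) hD.le
      nlinarith [le_abs_self ((x 1 - c * v) * v)]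
    have := mul_le_mul_of_nonneg_left this hs0
    linarith
  have t4 : s * (4 * w.D ^ 2) ≤ -(2 * (x 2 - c * z) * (s * z)) := by
    rcases hcase with ⟨rfl, _, _⟩ | rfl
    · simp
    · have h3 : 43 / 50 * (8 * w.Z) ≤ c * (8 * w.Z) :=
        mul_le_mul_of_nonneg_right hc (by linarith)
      have h4 : w.Z ≤ c * (8 * w.Z) - x 2 := by linarith
      have h5 := mul_le_mul_of_nonneg_right h4 hZ.le
      have h6 : w.D ^ 2 ≤ w.Z ^ 2 := pow_le_pow_left₀ hD.le (by linarith) 2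
      have h7 : 4 * w.D ^ 2 ≤ 16 * ((c * (8 * w.Z) - x 2) * w.Z) := by
        rw [sq w.Z] at h6
        have := mul_pos hD hD
        linarith
      have h8 := mul_le_mul_of_nonneg_left h7 hs0
      linarith
  have t5 : 2 * A * (c * τ - s * u) = 2 * A * (c * τ) - 2 * A * (s * u) := by ring
  linarith

/-- The only obstructions to holomorphy are the branch cut of the distance and the zero of the beam
factor. -/
lemma differentiableAt_wave_comp {f g h : ℂ → ℂ} {ζ : ℂ}
    (hf : DifferentiableAt ℂ f ζ) (hg : DifferentiableAt ℂ g ζ) (hh : DifferentiableAt ℂ h ζ)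
    (hQ : 0 < (sqDist x (f ζ) (g ζ) (h ζ)).re) (hβ : 1 + Complex.I * h ζ / w.L ≠ 0)
    (hro : w.ro ≠ 0) :
    DifferentiableAt ℂ (fun ζ => w.wave x (f ζ) (g ζ) (h ζ)) ζ := by
  have dQ : DifferentiableAt ℂ (fun ζ => sqDist x (f ζ) (g ζ) (h ζ)) ζ := by
    simp only [sqDist]
    fun_prop
  have dq : DifferentiableAt ℂ (fun ζ => sqDist x (f ζ) (g ζ) (h ζ) ^ (1 / 2 : ℂ)) ζ :=
    dQ.cpow (differentiableAt_const _) (Or.inl hQ)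
  have q0 : sqDist x (f ζ) (g ζ) (h ζ) ^ (1 / 2 : ℂ) ≠ 0 := fun h0 => by
    have := cpow_half_re_pos hQ
    rw [h0] at this
    simp at this
  have hro' : (w.ro : ℂ) ^ 2 * (1 + Complex.I * h ζ / w.L) ≠ 0 :=
    mul_ne_zero (pow_ne_zero _ (Complex.ofReal_ne_zero.2 hro)) hβ
  have dβ : DifferentiableAt ℂ (fun ζ => 1 + Complex.I * h ζ / w.L) ζ := by fun_prop
  unfold wave
  refine (((DifferentiableAt.cexp ?_).div dq q0).mul (dβ.inv hβ)).mul (DifferentiableAt.cexp ?_)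
  · exact (((dq.add hh).const_mul _).add_const _)
  · exact (((hf.pow 2).add (hg.pow 2)).mul ((dβ.const_mul _).inv hro')).neg

/-- The bound of the wave on the shifted rectangle. -/
lemma norm_wave_box_le (hw : w.Regime t) (hx : w.Close t x) (hE : w.Admissible c s z)
    (hu : |u| ≤ w.D / 2) (hv : |v| ≤ w.D / 2) (hτ : 0 ≤ τ) (hτ' : τ ≤ w.D / 256) :
    ‖w.wave x ((c + s * Complex.I) * (u - τ * Complex.I)) ((c + s * Complex.I) * v)
      ((c + s * Complex.I) * z)‖ ≤ 24 / w.D *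
      Real.exp (-(w.k * (w.D * τ / (25 * w.Z))) - (u ^ 2 / 4 - w.D ^ 2 / 120) / w.ro ^ 2) := by
  have hD := hw.D_pos
  have hZ := hw.Z_pos
  have h0 := abs_le.1 (hx.zero.trans (mul_le_mul_of_nonneg_right hw.t_le hD.le))
  have h1 := hx.one.trans (mul_le_mul_of_nonneg_right hw.t_le hD.le)
  have h2 := abs_le.1 (hx.two.trans (mul_le_mul_of_nonneg_right hw.t_le hD.le))
  have hDZ := hw.D_Z.trans (mul_le_mul_of_nonneg_right hw.t_le hZ.le)
  obtain ⟨hQ, hQ2⟩ := sqDist_re_box hw hx hE hu hv hτ hτ'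
  have hI := sqDist_im_box hw hx hE hu hv hτ hτ'
  have hz := hE.z_pos hw
  have hz0 := hz.1
  have hS := hE.1
  have hN := norm_sqDist_le (x := x) (u := u) (v := v) (z := z) (τ := τ) hS
  set Q := sqDist x ((c + s * Complex.I) * (u - τ * Complex.I)) ((c + s * Complex.I) * v)
      ((c + s * Complex.I) * z) with hQdef
  have hQpos : 0 < Q.re := lt_of_lt_of_le (by positivity) hQ
  have rp := cpow_half_re_pos hQpos
  have rl : (Q ^ (1 / 2 : ℂ)).re ≤ 10 * w.Z := by
    refine cpow_half_re_le (by positivity) (hN.trans ?_)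
    have a1 : |x 0| ≤ 2 * w.D := abs_le.2 ⟨by linarith, by linarith⟩
    have a2 : |x 2| ≤ 3 / 2 * w.Z := abs_le.2 ⟨by linarith, by linarith⟩
    rw [abs_of_nonneg hτ, abs_of_pos hz.1]
    have b1 : (|x 0| + |u| + τ) ^ 2 ≤ (w.Z / 10) ^ 2 :=
      pow_le_pow_left₀ (by positivity) (by linarith) 2
    have b2 : (|x 1| + |v|) ^ 2 ≤ (w.Z / 10) ^ 2 :=
      pow_le_pow_left₀ (by positivity) (by linarith) 2
    have b3 : (|x 2| + z) ^ 2 ≤ (19 / 2 * w.Z) ^ 2 :=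
      pow_le_pow_left₀ (by positivity) (by linarith) 2
    nlinarith
  -- From `2 q.re q.im = Q.im ≥ 4 D τ / 5` and `q.re ≤ 10 Z`.
  have him : w.D * τ / (25 * w.Z) ≤ (Q ^ (1 / 2 : ℂ)).im := by
    rw [div_le_iff₀ (by positivity)]
    have e := cpow_half_two_mul_re_mul_im (Q := Q)
    have i0 : 0 ≤ (Q ^ (1 / 2 : ℂ)).im := by
      by_contra hneg
      have h3 : 0 ≤ 4 / 5 * w.D * τ := by positivity
      have := mul_neg_of_pos_of_neg rp (not_le.1 hneg)
      linarith
    have := mul_le_mul_of_nonneg_right rl i0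
    linarith
  have zim : ((c + s * Complex.I : ℂ) * z).im = s * z := by simp
  have zre : ((c + s * Complex.I : ℂ) * z).re = c * z := by simp
  -- Without rotation `q.re ≥ |x 2 - z|`, so the travelled length `q.re + z` falls short of `Z` by
  -- at most `D`, and `k_d D` is small. At `z = 8 Z` the range alone exceeds `Z`.
  have hA : w.kd * (w.Z - (Q ^ (1 / 2 : ℂ)).re - ((c + s * Complex.I : ℂ) * z).re) ≤ 1 / 2 := by
    rw [zre]
    have : w.Z - (Q ^ (1 / 2 : ℂ)).re - c * z ≤ w.D := by
      rcases hE.2 with ⟨rfl, _, _⟩ | rfl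
      · have hc : c = 1 := by nlinarith [hS.unit, hS.c_nonneg]
        have := le_cpow_half_re hQpos ((sq_abs _).le.trans (hQ2 hc rfl))
        have := le_abs_self (x 2 - z)
        subst hc
        linarith
      · have h3 : 43 / 50 * (8 * w.Z) ≤ c * (8 * w.Z) :=
          mul_le_mul_of_nonneg_right hS.c_ge (by linarith)
        linarith
    have h3 := mul_le_mul_of_nonneg_left this hw.kd_pos.le
    linarith [hw.kd_D, hw.t_le]
  have hβ := norm_beta_ge w (r := 1) (z := z) hS
  rw [Complex.ofReal_one, one_mul] at hβ
  obtain ⟨l1, l2⟩ := hw.div_L hz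
  have := norm_wave_le w hw.k_pos.le (x := x) (m := w.D / 4) (by positivity) hQ
    (s := w.D * τ / (25 * w.Z)) (by
      rw [zim]
      have : 0 ≤ s * z := mul_nonneg hS.s_nonneg hz.1.le
      linarith) hA (by norm_num) hβ
      (gauss_exponent_box w hD.le hS l1 l2 (v := v) hu hτ hτ')
  refine this.trans ?_
  have he : Real.exp (1 / 2) / (w.D / 4 * (1 / 2)) ≤ 24 / w.D := by
    have : Real.exp (1 / 2) ≤ 3 := by
      have := Real.exp_one_lt_d9
      have := Real.exp_le_exp.2 (by norm_num : (1 / 2 : ℝ) ≤ 1)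
      linarith
    rw [div_le_div_iff₀ (by positivity) hD]
    have := mul_le_mul_of_nonneg_right this hD.le
    linarith
  refine (mul_le_mul_of_nonneg_right he (Real.exp_pos _).le).trans (le_of_eq ?_)
  rw [neg_mul]

end

end WaveParams

/-! ### Contour shifts -/

/-- Cauchy's theorem on the rectangle below `[-d, d]`: the integral over the top side is replaced by
those over the other three, of total length `2 d + 2 τ`. -/
lemma norm_intervalIntegral_le_of_shift {F : ℂ → ℂ} {d τ T : ℝ} (hd : 0 ≤ d) (hτ : 0 ≤ τ)
    (hF : ∀ u s : ℝ, |u| ≤ d → 0 ≤ s → s ≤ τ → DifferentiableAt ℂ F (u - s * Complex.I))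
    (hbot : ∀ u : ℝ, |u| ≤ d → ‖F (u - τ * Complex.I)‖ ≤ T)
    (hside : ∀ u s : ℝ, |u| = d → 0 ≤ s → s ≤ τ → ‖F (u - s * Complex.I)‖ ≤ T) :
    ‖∫ u in (-d)..d, F u‖ ≤ (2 * d + 2 * τ) * T := by
  have key := Complex.integral_boundary_rect_eq_zero_of_differentiableOn F
    (-(d : ℂ) - τ * Complex.I) d (by
      intro ζ hζ
      obtain ⟨h1, h2⟩ := hζ
      simp only [Complex.sub_re, Complex.neg_re, Complex.ofReal_re, Complex.mul_re, Complex.I_re,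
        Complex.ofReal_im, Complex.I_im, Complex.sub_im, Complex.neg_im, Complex.mul_im,
        Set.mem_preimage] at h1 h2
      norm_num at h1 h2
      rw [Set.uIcc_of_le (by linarith)] at h1 h2
      have := hF ζ.re (-ζ.im) (abs_le.2 ⟨h1.1, h1.2⟩) (by linarith [h2.2]) (by linarith [h2.1])
      have e : ((ζ.re : ℂ) - ((-ζ.im : ℝ) : ℂ) * Complex.I) = ζ := by
        rw [Complex.ofReal_neg, neg_mul, sub_neg_eq_add, Complex.re_add_im]
      rw [e] at this
      exact this.differentiableWithinAt)
  simp only [Complex.sub_re, Complex.neg_re, Complex.ofReal_re, Complex.mul_re, Complex.I_re,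
    Complex.ofReal_im, Complex.I_im, Complex.sub_im, Complex.neg_im, Complex.mul_im] at key
  norm_num at key
  have b1 : ‖∫ x in (-d)..d, F (x - τ * Complex.I)‖ ≤ T * |d - -d| :=
    intervalIntegral.norm_integral_le_of_norm_le_const fun u hu => by
      rw [Set.uIoc_of_le (by linarith)] at hu
      exact hbot u (abs_le.2 ⟨hu.1.le, hu.2⟩)
  have b2 : ‖∫ s in (-τ)..0, F (d + s * Complex.I)‖ ≤ T * |0 - -τ| :=
    intervalIntegral.norm_integral_le_of_norm_le_const fun s hs => by
      rw [Set.uIoc_of_le (by linarith)] at hs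
      have := hside d (-s) (abs_of_nonneg hd) (by linarith [hs.2]) (by linarith [hs.1])
      simpa using this
  have b3 : ‖∫ s in (-τ)..0, F (-d + s * Complex.I)‖ ≤ T * |0 - -τ| :=
    intervalIntegral.norm_integral_le_of_norm_le_const fun s hs => by
      rw [Set.uIoc_of_le (by linarith)] at hs
      have := hside (-d) (-s) (by rw [abs_neg, abs_of_nonneg hd]) (by linarith [hs.2])
        (by linarith [hs.1])
      simpa using this
  have e : ∫ u in (-d)..d, F u = (∫ x in (-d)..d, F (x - τ * Complex.I)) +
      Complex.I * (∫ s in (-τ)..0, F (d + s * Complex.I)) -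
      Complex.I * (∫ s in (-τ)..0, F (-d + s * Complex.I)) := by
    simp only [sub_eq_add_neg] at key ⊢
    linear_combination -key
  rw [e]
  refine (norm_sub_le _ _).trans ((add_le_add_left (norm_add_le _ _) _).trans ?_)
  rw [norm_mul, norm_mul, Complex.norm_I, one_mul, one_mul]
  rw [abs_of_nonneg (by linarith)] at b1 b2 b3
  linarith

lemma norm_setIntegral_box_le {F : ℝ → ℂ → ℂ} {d τ T : ℝ} (hd : 0 ≤ d) (hτ : 0 ≤ τ) (hT : 0 ≤ T)
    (hF : ∀ v u s : ℝ, |v| ≤ d → |u| ≤ d → 0 ≤ s → s ≤ τ →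
      DifferentiableAt ℂ (F v) (u - s * Complex.I))
    (hbot : ∀ v u : ℝ, |v| ≤ d → |u| ≤ d → ‖F v (u - τ * Complex.I)‖ ≤ T)
    (hside : ∀ v u s : ℝ, |v| ≤ d → |u| = d → 0 ≤ s → s ≤ τ → ‖F v (u - s * Complex.I)‖ ≤ T) :
    ‖∫ q : ℝ × ℝ in Set.Icc (-d) d ×ˢ Set.Icc (-d) d, F q.2 q.1‖ ≤
      (2 * d) * ((2 * d + 2 * τ) * T) := by
  by_cases hi : IntegrableOn (fun q : ℝ × ℝ => F q.2 q.1) (Set.Icc (-d) d ×ˢ Set.Icc (-d) d)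
  · rw [Measure.volume_eq_prod] at hi ⊢
    rw [← setIntegral_prod_swap, setIntegral_prod _ (by
      exact hi.swap)]
    have := norm_setIntegral_le_of_norm_le_const (μ := (volume : Measure ℝ)) (s := Set.Icc (-d) d)
      (f := fun v : ℝ => ∫ u in Set.Icc (-d) d, F v u) (C := (2 * d + 2 * τ) * T)
      (by simp) (fun v hv => by
        have hv' := abs_le.2 hv
        rw [integral_Icc_eq_integral_Ioc, ← intervalIntegral.integral_of_le (by linarith)]
        exact norm_intervalIntegral_le_of_shift hd hτ (fun u s => hF v u s hv')
          (fun u => hbot v u hv') (fun u s => hside v u s hv'))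
    refine this.trans (le_of_eq ?_)
    rw [Measure.real, Real.volume_Icc, ENNReal.toReal_ofReal (by linarith)]
    ring
  -- The integral of a non-integrable function is `0` by convention, so integrability need not be
  -- assumed.
  · rw [integral_undef hi, norm_zero]
    positivity

/-! ### Contour shift of the wave and of the product of two waves. -/

namespace WaveParams

variable {w : WaveParams} {t : ℝ} {x x' : Fin 3 → ℝ} {c s z : ℝ}

/-- Smallness of `Z` against the Rayleigh length `k r_o² / 2`, in the form needed for the gain of
the shift to beat every Gaussian cost `D² / r_o²`. -/
lemma Regime.div_ro_sq_le (hw : w.Regime t) :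
    10000 * (w.D ^ 2 / w.ro ^ 2) ≤ w.k * w.D ^ 2 / (2 * w.Z) := by
  have hro := hw.ro_pos
  have hZ := hw.Z_pos
  have h1 := hw.Z_L
  have h2 := mul_le_mul_of_nonneg_right hw.t_le hw.L_pos.le
  rw [L] at h1 h2
  have h3 : 20000 * w.Z ≤ w.k * w.ro ^ 2 := by linarith
  rw [mul_div_assoc', div_le_div_iff₀ (by positivity) (by positivity)]
  have := mul_le_mul_of_nonneg_left h3 (sq_nonneg w.D)
  linarith

/-- The bound of the wave on the edges of the shifted rectangle. -/
noncomputable def edgeBound (w : WaveParams) : ℝ :=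
  24 / w.D * Real.exp (-(w.D ^ 2 / (20 * w.ro ^ 2)))

lemma Regime.edgeBound_nonneg (hw : w.Regime t) : 0 ≤ w.edgeBound := by
  have := hw.D_pos
  rw [edgeBound]
  positivity

lemma norm_wave_bottom_le (hw : w.Regime t) (hx : w.Close t x) (hE : w.Admissible c s z)
    {u v : ℝ} (hv : |v| ≤ w.D / 2) (hu : |u| ≤ w.D / 2) :
    ‖w.wave x ((c + s * Complex.I) * (u - ((w.D / 256 : ℝ) : ℂ) * Complex.I))
      ((c + s * Complex.I) * v) ((c + s * Complex.I) * z)‖ ≤ w.edgeBound := by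
  have hD := hw.D_pos
  have hZ := hw.Z_pos
  refine (norm_wave_box_le hw hx hE hu hv (by positivity) le_rfl).trans ?_
  rw [edgeBound]
  gcongr
  have h1 := hw.div_ro_sq_le
  -- With `τ = D / 256` the gain is at least `10000 / 3200 · D² / r_o²`, well above the required `1
  -- / 20 + 1 / 120`.
  have h2 : w.k * (w.D * (w.D / 256) / (25 * w.Z)) = w.k * w.D ^ 2 / (2 * w.Z) / 3200 := by
    field_simp
    ring
  have h3 : (u ^ 2 / 4 - w.D ^ 2 / 120) / w.ro ^ 2 =
    u ^ 2 / 4 / w.ro ^ 2 - (w.D ^ 2 / w.ro ^ 2) / 120 := by ring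
  have h4 : w.D ^ 2 / (20 * w.ro ^ 2) = (w.D ^ 2 / w.ro ^ 2) / 20 := by
    rw [mul_comm, div_mul_eq_div_div]
  have h5 : 0 ≤ u ^ 2 / 4 / w.ro ^ 2 := by positivity
  have h6 : 0 ≤ w.D ^ 2 / w.ro ^ 2 := by positivity
  rw [h2, h3, h4]
  linarith

lemma norm_wave_side_le (hw : w.Regime t) (hx : w.Close t x) (hE : w.Admissible c s z)
    {u v τ : ℝ} (hv : |v| ≤ w.D / 2) (hu : |u| = w.D / 2) (hτ : 0 ≤ τ) (hτ' : τ ≤ w.D / 256) :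
    ‖w.wave x ((c + s * Complex.I) * (u - τ * Complex.I)) ((c + s * Complex.I) * v)
      ((c + s * Complex.I) * z)‖ ≤ w.edgeBound := by
  have hD := hw.D_pos
  have hZ := hw.Z_pos
  have hk := hw.k_pos
  refine (norm_wave_box_le hw hx hE hu.le hv hτ hτ').trans ?_
  rw [edgeBound]
  gcongr
  have h2 : 0 ≤ w.k * (w.D * τ / (25 * w.Z)) := by positivity
  have hu2 : u ^ 2 = w.D ^ 2 / 4 := by rw [← sq_abs, hu]; ring
  -- On the sides the Gaussian decay alone suffices: `1 / 16 - 1 / 120 = 13 / 240 ≥ 1 / 20`.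
  have h3 : (u ^ 2 / 4 - w.D ^ 2 / 120) / w.ro ^ 2 = (w.D ^ 2 / w.ro ^ 2) * (13 / 240) := by
    rw [hu2]; ring
  have h4 : w.D ^ 2 / (20 * w.ro ^ 2) = (w.D ^ 2 / w.ro ^ 2) / 20 := by
    rw [mul_comm, div_mul_eq_div_div]
  have h6 : 0 ≤ w.D ^ 2 / w.ro ^ 2 := by positivity
  rw [h3, h4]
  linarith

lemma differentiableAt_wave_box (hw : w.Regime t) (hx : w.Close t x) (hE : w.Admissible c s z)
    {u v τ : ℝ} (hv : |v| ≤ w.D / 2) (hu : |u| ≤ w.D / 2) (hτ : 0 ≤ τ) (hτ' : τ ≤ w.D / 256) :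
    DifferentiableAt ℂ (fun ζ : ℂ => w.wave x ((c + s * Complex.I) * ζ)
      ((c + s * Complex.I) * v) ((c + s * Complex.I) * z)) (u - τ * Complex.I) := by
  have hQ := (sqDist_re_box hw hx hE hu hv hτ hτ').1
  have hD := hw.D_pos
  have hβ := norm_beta_ge w (r := 1) (z := z) hE.1
  rw [Complex.ofReal_one, one_mul] at hβ
  refine differentiableAt_wave_comp (f := fun ζ => (c + s * Complex.I) * ζ)
    (g := fun _ => (c + s * Complex.I) * v) (h := fun _ => (c + s * Complex.I) * z)
    (by fun_prop) (by fun_prop) (by fun_prop) (lt_of_lt_of_le (by positivity) hQ) ?_ hw.ro_pos.ne'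
  intro h0
  rw [beta, h0, norm_zero] at hβ
  linarith

/-- The square of cross-range positions at which the contour is shifted. -/
def box (d : ℝ) : Set (ℝ × ℝ) := Set.Icc (-d) d ×ˢ Set.Icc (-d) d

lemma norm_integral_wave_box_le (hw : w.Regime t) (hx : w.Close t x) (hE : w.Admissible c s z) :
    ‖∫ q : ℝ × ℝ in box (w.D / 2), w.wave x ((c + s * Complex.I) * q.1)
      ((c + s * Complex.I) * q.2) ((c + s * Complex.I) * z)‖ ≤ 2 * w.D ^ 2 * w.edgeBound := by
  have hD := hw.D_pos
  have hT := hw.edgeBound_nonneg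
  refine (norm_setIntegral_box_le (F := fun v ζ => w.wave x ((c + s * Complex.I) * ζ)
    ((c + s * Complex.I) * v) ((c + s * Complex.I) * z)) (d := w.D / 2) (τ := w.D / 256)
    (T := w.edgeBound) (by positivity) (by positivity) hT
    (fun v u τ hv hu h h' => differentiableAt_wave_box hw hx hE hv hu h h')
    (fun v u hv hu => norm_wave_bottom_le hw hx hE hv hu)
    (fun v u τ hv hu h h' => norm_wave_side_le hw hx hE hv hu h h')).trans ?_
  have := mul_nonneg (sq_nonneg w.D) hT
  nlinarith

/-- Without conjugation the phases of the two waves add, so the same shift makes both factors small.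
-/
lemma norm_integral_wave_mul_wave_box_le (hw : w.Regime t) (hx : w.Close t x)
    (hx' : w.Close t x') (hE : w.Admissible c s z) :
    ‖∫ q : ℝ × ℝ in box (w.D / 2), w.wave x ((c + s * Complex.I) * q.1)
      ((c + s * Complex.I) * q.2) ((c + s * Complex.I) * z) *
      w.wave x' ((c + s * Complex.I) * q.1)
      ((c + s * Complex.I) * q.2) ((c + s * Complex.I) * z)‖ ≤ 2 * w.D ^ 2 * w.edgeBound ^ 2 := by
  have hD := hw.D_pos
  have hT := hw.edgeBound_nonneg
  refine (norm_setIntegral_box_le (F := fun v ζ => w.wave x ((c + s * Complex.I) * ζ)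
    ((c + s * Complex.I) * v) ((c + s * Complex.I) * z) * w.wave x' ((c + s * Complex.I) * ζ)
    ((c + s * Complex.I) * v) ((c + s * Complex.I) * z)) (d := w.D / 2) (τ := w.D / 256)
    (T := w.edgeBound ^ 2) (by positivity) (by positivity) (by positivity)
    (fun v u τ hv hu h h' => (differentiableAt_wave_box hw hx hE hv hu h h').mul
      (differentiableAt_wave_box hw hx' hE hv hu h h'))
    (fun v u hv hu => ?_) (fun v u τ hv hu h h' => ?_)).trans ?_
  · rw [norm_mul, sq]
    exact mul_le_mul (norm_wave_bottom_le hw hx hE hv hu) (norm_wave_bottom_le hw hx' hE hv hu)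
      (norm_nonneg _) hT
  · rw [norm_mul, sq]
    exact mul_le_mul (norm_wave_side_le hw hx hE hv hu h h')
      (norm_wave_side_le hw hx' hE hv hu h h') (norm_nonneg _) hT
  · have := mul_nonneg (sq_nonneg w.D) (sq_nonneg w.edgeBound)
    nlinarith

end WaveParams

/-! ### Gaussian and Cauchy integrals -/

lemma integrable_gaussian_prod {b : ℝ} (hb : 0 < b) :
    Integrable (fun q : ℝ × ℝ => Real.exp (-(b * (q.1 ^ 2 + q.2 ^ 2)))) := by
  have := (integrable_exp_neg_mul_sq hb).mul_prod (integrable_exp_neg_mul_sq hb)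
  refine this.congr (Filter.Eventually.of_forall fun q => ?_)
  simp only
  rw [← Real.exp_add]
  congr 1
  ring

lemma integral_gaussian_prod {b : ℝ} (hb : 0 < b) :
    ∫ q : ℝ × ℝ, Real.exp (-(b * (q.1 ^ 2 + q.2 ^ 2))) = Real.pi / b := by
  have := integral_prod_mul (μ := (volume : Measure ℝ)) (ν := (volume : Measure ℝ))
    (fun x => Real.exp (-b * x ^ 2)) (fun x => Real.exp (-b * x ^ 2))
  rw [integral_gaussian, Real.mul_self_sqrt (by positivity)] at this
  rw [← this, Measure.volume_eq_prod]
  refine integral_congr_ae (Filter.Eventually.of_forall fun q => ?_)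
  simp only
  rw [← Real.exp_add]
  congr 1
  ring

lemma lintegral_gaussian_prod {b : ℝ} (hb : 0 < b) :
    ∫⁻ q : ℝ × ℝ, ENNReal.ofReal (Real.exp (-(b * (q.1 ^ 2 + q.2 ^ 2)))) =
      ENNReal.ofReal (Real.pi / b) := by
  rw [← integral_gaussian_prod hb, ofReal_integral_eq_lintegral_ofReal (integrable_gaussian_prod hb)
    (Filter.Eventually.of_forall fun q => (Real.exp_pos _).le)]

/-- The integral of a power of the Cauchy density. -/
noncomputable def cauchyIntegral (n : ℕ) : ℝ := ∫ x : ℝ, ((1 + x ^ 2)⁻¹) ^ n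

lemma integrable_inv_one_add_sq_pow {n : ℕ} (hn : n ≠ 0) :
    Integrable (fun x : ℝ => ((1 + x ^ 2)⁻¹) ^ n) := by
  refine integrable_inv_one_add_sq.mono' (by fun_prop) (Filter.Eventually.of_forall fun x => ?_)
  have h : (0 : ℝ) ≤ (1 + x ^ 2)⁻¹ := by positivity
  rw [Real.norm_of_nonneg (by positivity)]
  exact pow_le_of_le_one h (inv_le_one_of_one_le₀ (by nlinarith [sq_nonneg x])) hn

lemma cauchyIntegral_one : cauchyIntegral 1 = Real.pi := by
  simp [cauchyIntegral]

lemma cauchyIntegral_two : cauchyIntegral 2 = Real.pi / 2 := by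
  -- Explicit primitive of `(1 + x²)⁻²`.
  have hd : ∀ x : ℝ, HasDerivAt (fun x => (1 / 2) * (x * (1 + x ^ 2)⁻¹ + Real.arctan x))
      (((1 + x ^ 2)⁻¹) ^ 2) x := by
    intro x
    have h1 : (1 + x ^ 2) ≠ 0 := by positivity
    have h2 : HasDerivAt (fun x : ℝ => 1 + x ^ 2) (2 * x) x := by
      simpa using (hasDerivAt_pow 2 x).const_add 1
    have := (((hasDerivAt_id x).mul (h2.inv h1)).add (Real.hasDerivAt_arctan x)).const_mul (1 / 2)
    refine this.congr_deriv ?_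
    simp only [id, Pi.inv_apply]
    field_simp
    ring
  have h0 : Filter.Tendsto (fun x : ℝ => x * (1 + x ^ 2)⁻¹) (Filter.cocompact ℝ) (nhds 0) := by
    have : Filter.Tendsto (fun x : ℝ => ‖x‖⁻¹) (Filter.cocompact ℝ) (nhds 0) :=
      tendsto_inv_atTop_zero.comp (tendsto_norm_cocompact_atTop (E := ℝ))
    refine squeeze_zero_norm (fun x => ?_) this
    rw [norm_mul, norm_inv, Real.norm_of_nonneg (by positivity : 0 ≤ 1 + x ^ 2), Real.norm_eq_abs]
    rcases eq_or_ne x 0 with rfl | hx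
    · simp
    · have : 0 < |x| := abs_pos.2 hx
      rw [← div_eq_mul_inv, div_le_iff₀ (by positivity), inv_mul_eq_div, le_div_iff₀ this]
      nlinarith [abs_mul_abs_self x]
  rw [cauchyIntegral, integral_of_hasDerivAt_of_tendsto hd
    (integrable_inv_one_add_sq_pow two_ne_zero)
    (m := (1 / 2) * (0 + -(Real.pi / 2))) (n := (1 / 2) * (0 + Real.pi / 2))]
  · ring
  · exact ((h0.mono_left atBot_le_cocompact).add
      (Real.tendsto_arctan_atBot.mono_right nhdsWithin_le_nhds)).const_mul _
  · exact ((h0.mono_left atTop_le_cocompact).add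
      (Real.tendsto_arctan_atTop.mono_right nhdsWithin_le_nhds)).const_mul _

lemma inv_sq_add_sq_pow {c : ℝ} (hc : 0 < c) (b z : ℝ) (n : ℕ) :
    ((c ^ 2 + (b - z) ^ 2)⁻¹) ^ n = ((c ^ 2) ^ n)⁻¹ * ((1 + ((b - z) / c) ^ 2)⁻¹) ^ n := by
  rw [← inv_pow, ← mul_pow, ← mul_inv]
  congr 2
  field_simp

lemma integrable_inv_sq_add_sq_pow {c : ℝ} (hc : 0 < c) (b : ℝ) {n : ℕ} (hn : n ≠ 0) :
    Integrable (fun z : ℝ => ((c ^ 2 + (b - z) ^ 2)⁻¹) ^ n) := by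
  simp_rw [inv_sq_add_sq_pow hc b _ n]
  exact (((integrable_inv_one_add_sq_pow hn).comp_div hc.ne').comp_sub_left b).const_mul _

lemma lintegral_inv_sq_add_sq_pow {c : ℝ} (hc : 0 < c) (b : ℝ) {n : ℕ} (hn : n ≠ 0) :
    ∫⁻ z : ℝ, ENNReal.ofReal (((c ^ 2 + (b - z) ^ 2)⁻¹) ^ n) =
      ENNReal.ofReal (c * ((c ^ 2) ^ n)⁻¹ * cauchyIntegral n) := by
  rw [← ofReal_integral_eq_lintegral_ofReal (integrable_inv_sq_add_sq_pow hc b hn)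
    (Filter.Eventually.of_forall fun q => by positivity)]
  congr 1
  simp_rw [inv_sq_add_sq_pow hc b _ n]
  rw [integral_const_mul, integral_sub_left_eq_self
    (fun z : ℝ => ((1 + (z / c) ^ 2)⁻¹) ^ n) volume b,
    Measure.integral_comp_div (fun z : ℝ => ((1 + z ^ 2)⁻¹) ^ n), abs_of_pos hc, smul_eq_mul,
    cauchyIntegral]
  ring

/-! ### The modulus of the wave and upper bounds of its even moments. -/

namespace WaveParams

/-- Distance of the observation point `x` from the particle at `q = (z, (u, v))`. -/
noncomputable def rdist (x : Fin 3 → ℝ) (q : ℝ × ℝ × ℝ) : ℝ :=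
  √((x 0 - q.2.1) ^ 2 + (x 1 - q.2.2) ^ 2 + (x 2 - q.1) ^ 2)

open Classical in
/-- The wave scattered by illuminated particles which do not contain `x`. -/
noncomputable def cutWave (w : WaveParams) (x : Fin 3 → ℝ) (q : ℝ × ℝ × ℝ) : ℂ :=
  if 0 < q.1 ∧ w.a < rdist x q then w.wave x q.2.1 q.2.2 q.1 else 0

/-- The intensity profile of the beam. -/
noncomputable def profile (w : WaveParams) (q : ℝ × ℝ × ℝ) : ℝ :=
  (1 + (q.1 / w.L) ^ 2)⁻¹ *
    Real.exp (-(2 / (w.ro ^ 2 * (1 + (q.1 / w.L) ^ 2)) * (q.2.1 ^ 2 + q.2.2 ^ 2)))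

variable {w : WaveParams} {t : ℝ} {x x' : Fin 3 → ℝ}

lemma rdist_sq (x : Fin 3 → ℝ) (q : ℝ × ℝ × ℝ) :
    rdist x q ^ 2 = (x 0 - q.2.1) ^ 2 + (x 1 - q.2.2) ^ 2 + (x 2 - q.1) ^ 2 :=
  Real.sq_sqrt (by positivity)

lemma rdist_nonneg (x : Fin 3 → ℝ) (q : ℝ × ℝ × ℝ) : 0 ≤ rdist x q := Real.sqrt_nonneg _

lemma continuous_rdist (x : Fin 3 → ℝ) : Continuous (rdist x) := by
  unfold rdist
  fun_prop

lemma profile_nonneg (w : WaveParams) (q : ℝ × ℝ × ℝ) : 0 ≤ w.profile q := by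
  rw [profile]
  positivity

lemma continuous_profile (hw : w.Regime t) : Continuous w.profile := by
  have := hw.ro_pos
  have h : ∀ q : ℝ × ℝ × ℝ, 1 + (q.1 / w.L) ^ 2 ≠ 0 := fun q => by positivity
  have h' : ∀ q : ℝ × ℝ × ℝ, w.ro ^ 2 * (1 + (q.1 / w.L) ^ 2) ≠ 0 := fun q => by positivity
  unfold profile
  fun_prop (disch := first | exact h _ | exact h' _)

lemma norm_wave_real_sq (w : WaveParams) (x : Fin 3 → ℝ) (q : ℝ × ℝ × ℝ) :
    ‖w.wave x q.2.1 q.2.2 q.1‖ ^ 2 =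
      Real.exp (2 * (w.kd * (w.Z - rdist x q - q.1))) / rdist x q ^ 2 * w.profile q := by
  have hs : sqDist x q.2.1 q.2.2 q.1 ^ (1 / 2 : ℂ) = (rdist x q : ℂ) := by
    rw [← cpow_half_ofReal (rdist_nonneg x q), rdist_sq, sqDist]
    push_cast
    rfl
  have hβ : ‖1 + Complex.I * q.1 / w.L‖ ^ 2 = 1 + (q.1 / w.L) ^ 2 := by
    rw [← Complex.normSq_eq_norm_sq]
    have : 1 + Complex.I * q.1 / w.L = ((1 : ℝ) : ℂ) + ((q.1 / w.L : ℝ) : ℂ) * Complex.I := by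
      push_cast
      ring
    rw [this, Complex.normSq_add_mul_I]
    ring
  have hβr : ((1 + Complex.I * q.1 / w.L : ℂ))⁻¹.re = (1 + (q.1 / w.L) ^ 2)⁻¹ := by
    rw [Complex.inv_re, Complex.normSq_eq_norm_sq, hβ]
    have : 1 + Complex.I * q.1 / w.L = ((1 : ℝ) : ℂ) + ((q.1 / w.L : ℝ) : ℂ) * Complex.I := by
      push_cast
      ring
    rw [this]
    simp
  have hg : ((((q.2.1 : ℂ) ^ 2 + (q.2.2 : ℂ) ^ 2) *
      (w.ro ^ 2 * (1 + Complex.I * q.1 / w.L))⁻¹)).re =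
      1 / (w.ro ^ 2 * (1 + (q.1 / w.L) ^ 2)) * (q.2.1 ^ 2 + q.2.2 ^ 2) := by
    have : ((q.2.1 : ℂ) ^ 2 + (q.2.2 : ℂ) ^ 2) * (w.ro ^ 2 * (1 + Complex.I * q.1 / w.L))⁻¹ =
        (((q.2.1 ^ 2 + q.2.2 ^ 2) * (w.ro ^ 2)⁻¹ : ℝ) : ℂ) * (1 + Complex.I * q.1 / w.L)⁻¹ := by
      rw [mul_inv]
      push_cast
      ring
    rw [this, Complex.re_ofReal_mul, hβr, one_div, mul_inv]
    ring
  rw [norm_wave, hs, hg, Complex.norm_real, Real.norm_of_nonneg (rdist_nonneg x q)]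
  simp only [Complex.ofReal_re, Complex.ofReal_im, add_zero, mul_zero, zero_add]
  rw [mul_pow, mul_pow, div_pow, inv_pow, hβ, profile, ← Real.exp_nat_mul, ← Real.exp_nat_mul,
    mul_assoc]
  push_cast
  congr 4
  ring

/-- The path from the source plane to the particle and on to `x` has length at least `x 2 ≥ Z - t
D`, so the damping, normalized by `exp (k_d Z)`, is at most `exp t` in amplitude. -/
lemma norm_cutWave_sq_le (hw : w.Regime t) (hx : w.Close t x) (q : ℝ × ℝ × ℝ) :
    ‖w.cutWave x q‖ ^ 2 ≤ Real.exp (2 * t) / rdist x q ^ 2 * w.profile q := by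
  have h0 := profile_nonneg w q
  rw [cutWave]
  split_ifs with h
  · rw [norm_wave_real_sq]
    gcongr
    have h1 : |x 2 - q.1| ≤ rdist x q := Real.abs_le_sqrt (by
      nlinarith [sq_nonneg (x 0 - q.2.1), sq_nonneg (x 1 - q.2.2)])
    have h2 := (abs_le.1 hx.two).1
    have h3 : w.Z - rdist x q - q.1 ≤ t * w.D := by linarith [le_abs_self (x 2 - q.1)]
    calc _ ≤ w.kd * (t * w.D) := mul_le_mul_of_nonneg_left h3 hw.kd_pos.le
      _ = t * (w.kd * w.D) := by ring
      _ ≤ t * 1 := mul_le_mul_of_nonneg_left (hw.kd_D.trans (by linarith [hw.t_le])) hw.t_pos.le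
      _ = t := mul_one t
  · rw [norm_zero, zero_pow two_ne_zero]
    positivity

lemma norm_cutWave_sq_le_a (hw : w.Regime t) (hx : w.Close t x) (q : ℝ × ℝ × ℝ) :
    ‖w.cutWave x q‖ ^ 2 ≤ Real.exp (2 * t) / w.a ^ 2 * w.profile q := by
  have h0 := profile_nonneg w q
  have ha := hw.a_pos
  by_cases h : 0 < q.1 ∧ w.a < rdist x q
  · refine (norm_cutWave_sq_le hw hx q).trans ?_
    have := h.2.le
    gcongr
  · rw [cutWave, if_neg h, norm_zero, zero_pow two_ne_zero]
    positivity

lemma measurable_cutWave (w : WaveParams) (x : Fin 3 → ℝ) : Measurable (w.cutWave x) := by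
  unfold cutWave
  refine Measurable.ite ?_ ?_ measurable_const
  · exact (measurableSet_lt measurable_const measurable_fst).inter
      (measurableSet_lt measurable_const (continuous_rdist x).measurable)
  · unfold wave sqDist
    fun_prop

/-- The transversal integral of the intensity profile. -/
lemma lintegral_profile_le (hw : w.Regime t) (z : ℝ) {n : ℕ} (hn : n ≠ 0) :
    ∫⁻ p : ℝ × ℝ, ENNReal.ofReal (w.profile (z, p) ^ n) ≤
      ENNReal.ofReal (Real.pi * w.ro ^ 2 / (2 * n)) := by
  have hro := hw.ro_pos
  have hn' : (0 : ℝ) < n := by exact_mod_cast Nat.pos_of_ne_zero hn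
  set s := 1 + (z / w.L) ^ 2 with hs
  have hs1 : 1 ≤ s := by rw [hs]; nlinarith [sq_nonneg (z / w.L)]
  have h1 : ∀ p : ℝ × ℝ, ENNReal.ofReal (w.profile (z, p) ^ n) = ENNReal.ofReal ((s⁻¹) ^ n) *
      ENNReal.ofReal (Real.exp (-(2 * n / (w.ro ^ 2 * s) * (p.1 ^ 2 + p.2 ^ 2)))) := by
    intro p
    rw [← ENNReal.ofReal_mul (by positivity), profile, mul_pow, ← Real.exp_nat_mul]
    congr 3
    ring
  simp_rw [h1]
  rw [lintegral_const_mul' _ _ ENNReal.ofReal_ne_top, lintegral_gaussian_prod (by positivity),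
    ← ENNReal.ofReal_mul (by positivity)]
  apply ENNReal.ofReal_le_ofReal
  -- Diffraction widens the beam area by `s` and divides the profile by `s`; one factor `s⁻¹`
  -- compensates the area exactly and the others are at most `1`.
  have h2 : (s⁻¹) ^ n ≤ s⁻¹ := pow_le_of_le_one (by positivity) (inv_le_one_of_one_le₀ hs1) hn
  calc (s⁻¹) ^ n * (Real.pi / (2 * n / (w.ro ^ 2 * s)))
      ≤ s⁻¹ * (Real.pi / (2 * n / (w.ro ^ 2 * s))) := by gcongr
    _ = _ := by field_simp

lemma lintegral_mul_profile_le (hw : w.Regime t) {f : ℝ → ENNReal} (hf : Measurable f) {n : ℕ}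
    (hn : n ≠ 0) :
    ∫⁻ q : ℝ × ℝ × ℝ, f q.1 * ENNReal.ofReal (w.profile q ^ n) ≤
      (∫⁻ z, f z) * ENNReal.ofReal (Real.pi * w.ro ^ 2 / (2 * n)) := by
  have hm : Measurable w.profile := (continuous_profile hw).measurable
  rw [Measure.volume_eq_prod, lintegral_prod _ (by fun_prop), ← lintegral_mul_const _ hf]
  refine lintegral_mono fun z => ?_
  simp only
  rw [lintegral_const_mul _ (by fun_prop)]
  gcongr
  exact lintegral_profile_le hw z hn

end WaveParams

namespace WaveParams

variable {w : WaveParams} {t μ : ℝ} {x x' : Fin 3 → ℝ}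

/-- The illuminated region near the axis of the beam and not too far in range. -/
def core (w : WaveParams) (μ : ℝ) : Set (ℝ × ℝ × ℝ) := {q | q.1 ≤ 8 * w.Z ∧ q.2 ∈ box (μ * w.D)}

lemma mem_box {d : ℝ} {p : ℝ × ℝ} : p ∈ box d ↔ |p.1| ≤ d ∧ |p.2| ≤ d := by
  simp [box, abs_le, Prod.le_def]
  tauto

lemma measurableSet_box (d : ℝ) : MeasurableSet (box d) := measurableSet_Icc.prod measurableSet_Icc

lemma measurableSet_core (w : WaveParams) (μ : ℝ) : MeasurableSet (w.core μ) :=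
  (measurableSet_le measurable_fst measurable_const).inter (measurable_snd (measurableSet_box _))

/-- The form in which the Gaussian tail hypothesis is used: it absorbs up to sixteen powers of `Z /
a` and still leaves a factor `t`. -/
lemma Regime.tail_le (hw : w.Regime t) {τ : ℝ} (hτ : t ≤ τ) {m : ℕ} (hm : m ≤ 16) :
    Real.exp (-(τ * (w.D / w.ro) ^ 2)) ≤ t * (w.a / w.Z) ^ m := by
  have ha := hw.a_pos
  have hZ := hw.Z_pos
  have hro := hw.ro_pos
  have ht := hw.t_pos
  have haZ : w.a / w.Z ≤ 1 := by
    rw [div_le_one hZ]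
    have h1 := hw.a_ro
    have h2 := hw.ro_D
    have h3 := hw.D_Z
    nlinarith [hw.t_le, hw.D_pos]
  have h1 : Real.exp (-(τ * (w.D / w.ro) ^ 2)) ≤ Real.exp (-(t * (w.D / w.ro) ^ 2)) := by gcongr
  have h2 := hw.tail
  have h3 : (w.Z / w.a) ^ 16 * (w.a / w.Z) ^ 16 = 1 := by
    rw [← mul_pow]
    field_simp
  calc _ ≤ Real.exp (-(t * (w.D / w.ro) ^ 2)) := h1
    _ = ((w.Z / w.a) ^ 16 * Real.exp (-(t * (w.D / w.ro) ^ 2))) * (w.a / w.Z) ^ 16 := by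
      linear_combination (-Real.exp (-(t * (w.D / w.ro) ^ 2))) * h3
    _ ≤ t * (w.a / w.Z) ^ 16 := by gcongr
    _ ≤ t * (w.a / w.Z) ^ m :=
      mul_le_mul_of_nonneg_left (pow_le_pow_of_le_one (by positivity) haZ hm) ht.le

lemma Regime.D_le_Z (hw : w.Regime t) : w.D ≤ w.Z := by
  nlinarith [hw.D_Z, hw.Z_pos, hw.t_le]

/-- Near the axis the offset from the camera is at least `(1 - t - μ) D`, which yields a Cauchy
profile in range. -/
lemma norm_cutWave_core_le (hw : w.Regime t) (hx : w.Close t x) (hμ : 0 < 1 - t - μ)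
    {q : ℝ × ℝ × ℝ} (hq : q ∈ w.core μ) :
    ‖w.cutWave x q‖ ^ 2 ≤ Real.exp (2 * t) *
      ((((1 - t - μ) * w.D) ^ 2 + (x 2 - q.1) ^ 2)⁻¹ * w.profile q) := by
  have hD := hw.D_pos
  have h0 := profile_nonneg w q
  refine (norm_cutWave_sq_le hw hx q).trans ?_
  rw [div_mul_eq_mul_div, mul_div_assoc, ← inv_mul_eq_div]
  have h1 : ((1 - t - μ) * w.D) ^ 2 + (x 2 - q.1) ^ 2 ≤ rdist x q ^ 2 := by
    rw [rdist_sq]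
    have h2 := (abs_le.1 hx.zero).1
    have h3 := (abs_le.1 (mem_box.1 hq.2).1).2
    have h4 : (1 - t - μ) * w.D ≤ x 0 - q.2.1 := by linarith
    have h5 : ((1 - t - μ) * w.D) ^ 2 ≤ (x 0 - q.2.1) ^ 2 :=
      pow_le_pow_left₀ (by positivity) h4 2
    nlinarith [sq_nonneg (x 1 - q.2.2)]
  gcongr

/-- Outside the core there are two cases. If `z > 8 Z`, the distance is at least `Z` and comparable
with `z - Z`. Otherwise the particle is off the axis; its distance may be as small as `a`, but half
of the Gaussian exponent provides the factor `exp (-(μ² / 2) (D / r_o)²)`, and the other half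
remains for integration. -/
lemma norm_cutWave_outer_le (hw : w.Regime t) (hx : w.Close t x) (hμ : 0 ≤ μ)
    {q : ℝ × ℝ × ℝ} (hq : q ∉ w.core μ) {n : ℕ} (hn : n ≠ 0) :
    (‖w.cutWave x q‖ ^ 2) ^ n ≤ Real.exp (2 * t) ^ n *
      (2 ^ n * ((w.Z ^ 2 + (x 2 - q.1) ^ 2)⁻¹) ^ n * w.profile q ^ n +
      (Set.Icc 0 (8 * w.Z)).indicator (fun _ => (1 : ℝ)) q.1 *
        ((w.a ^ 2)⁻¹ ^ n * Real.exp (-(μ ^ 2 / 2 * (w.D / w.ro) ^ 2))) *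
        Real.exp (-(1 / (2 * w.ro ^ 2) * (q.2.1 ^ 2 + q.2.2 ^ 2)))) := by
  have hD := hw.D_pos
  have hZ := hw.Z_pos
  have hro := hw.ro_pos
  have ha := hw.a_pos
  have h0 := profile_nonneg w q
  have hi : 0 ≤ (Set.Icc 0 (8 * w.Z)).indicator (fun _ => (1 : ℝ)) q.1 :=
    Set.indicator_nonneg (fun _ _ => zero_le_one) _
  by_cases hz : q.1 ≤ 8 * w.Z
  · by_cases hz0 : 0 < q.1
    swap
    · rw [cutWave, if_neg (fun h => hz0 h.1), norm_zero, zero_pow two_ne_zero, zero_pow hn]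
      positivity
    have h1 := pow_le_pow_left₀ (by positivity) (norm_cutWave_sq_le_a hw hx q) n
    refine h1.trans ?_
    have h2 : 0 ≤ 2 ^ n * ((w.Z ^ 2 + (x 2 - q.1) ^ 2)⁻¹) ^ n * w.profile q ^ n := by positivity
    rw [div_mul_eq_mul_div, mul_div_assoc, ← inv_mul_eq_div, mul_pow, mul_pow,
      Set.indicator_of_mem (show q.1 ∈ Set.Icc 0 (8 * w.Z) from ⟨hz0.le, hz⟩), one_mul]
    refine mul_le_mul_of_nonneg_left (le_trans ?_ (le_add_of_nonneg_left h2)) (by positivity)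
    rw [mul_assoc]
    refine mul_le_mul_of_nonneg_left ?_ (by positivity)
    have hdiv := hw.div_L ⟨hz0, hz⟩
    have hs1 : 1 ≤ 1 + (q.1 / w.L) ^ 2 := by nlinarith [sq_nonneg (q.1 / w.L)]
    have hs2 : 1 + (q.1 / w.L) ^ 2 ≤ 2 := by nlinarith
    have hp1 : w.profile q ≤ Real.exp (-(1 / w.ro ^ 2 * (q.2.1 ^ 2 + q.2.2 ^ 2))) := by
      rw [profile]
      have e1 : 1 / w.ro ^ 2 ≤ 2 / (w.ro ^ 2 * (1 + (q.1 / w.L) ^ 2)) := by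
        rw [div_le_div_iff₀ (by positivity) (by positivity)]
        nlinarith [mul_le_mul_of_nonneg_left hs2 (sq_nonneg w.ro)]
      calc _ ≤ 1 * Real.exp (-(1 / w.ro ^ 2 * (q.2.1 ^ 2 + q.2.2 ^ 2))) := by
            gcongr
            exact inv_le_one_of_one_le₀ hs1
        _ = _ := one_mul _
    have hp2 : w.profile q ^ n ≤ w.profile q := by
      refine pow_le_of_le_one h0 (hp1.trans ?_) hn
      rw [Real.exp_le_one_iff]
      have : 0 ≤ 1 / w.ro ^ 2 * (q.2.1 ^ 2 + q.2.2 ^ 2) := by positivity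
      linarith
    refine hp2.trans (hp1.trans ?_)
    rw [← Real.exp_add]
    apply Real.exp_le_exp.2
    have hb : (μ * w.D) ^ 2 ≤ q.2.1 ^ 2 + q.2.2 ^ 2 := by
      have : ¬ (|q.2.1| ≤ μ * w.D ∧ |q.2.2| ≤ μ * w.D) := fun h => hq ⟨hz, mem_box.2 h⟩
      have hμD : 0 ≤ μ * w.D := by positivity
      rw [not_and_or, not_le, not_le] at this
      rcases this with h | h
      · have := pow_le_pow_left₀ hμD h.le 2
        rw [sq_abs] at this
        nlinarith [sq_nonneg q.2.2]
      · have := pow_le_pow_left₀ hμD h.le 2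
        rw [sq_abs] at this
        nlinarith [sq_nonneg q.2.1]
    have hb' := mul_le_mul_of_nonneg_left hb (by positivity : 0 ≤ 1 / (2 * w.ro ^ 2))
    have e1 : μ ^ 2 / 2 * (w.D / w.ro) ^ 2 = 1 / (2 * w.ro ^ 2) * (μ * w.D) ^ 2 := by field_simp
    have e2 : 1 / w.ro ^ 2 * (q.2.1 ^ 2 + q.2.2 ^ 2) =
      2 * (1 / (2 * w.ro ^ 2) * (q.2.1 ^ 2 + q.2.2 ^ 2)) := by field_simp
    linarith
  · rw [not_le] at hz
    have h1 : ‖w.cutWave x q‖ ^ 2 ≤ Real.exp (2 * t) *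
        (2 * (w.Z ^ 2 + (x 2 - q.1) ^ 2)⁻¹ * w.profile q) := by
      refine (norm_cutWave_sq_le hw hx q).trans ?_
      rw [div_mul_eq_mul_div, mul_div_assoc, ← inv_mul_eq_div]
      refine mul_le_mul_of_nonneg_left (mul_le_mul_of_nonneg_right ?_ h0) (by positivity)
      rw [← div_eq_mul_inv, inv_le_comm₀, inv_div, rdist_sq]
      rotate_left
      · rw [rdist_sq]
        have h2 := (abs_le.1 hx.two).2
        have : x 2 - q.1 < 0 := by nlinarith [hw.D_le_Z, hw.t_le]
        nlinarith [sq_nonneg (x 0 - q.2.1), sq_nonneg (x 1 - q.2.2)]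
      · positivity
      have h2 := (abs_le.1 hx.two).2
      have h3 : w.Z ≤ q.1 - x 2 := by nlinarith [hw.D_le_Z, hw.t_le]
      nlinarith [sq_nonneg (x 0 - q.2.1), sq_nonneg (x 1 - q.2.2)]
    refine (pow_le_pow_left₀ (by positivity) h1 n).trans ?_
    rw [mul_pow, mul_pow, mul_pow]
    refine mul_le_mul_of_nonneg_left (le_add_of_nonneg_right (by positivity)) (by positivity)

/-- The order of magnitude of the integral of `‖cutWave‖ ^ (2 n)`. -/
noncomputable def scale (w : WaveParams) (n : ℕ) : ℝ := w.ro ^ 2 * (w.D * ((w.D ^ 2) ^ n)⁻¹)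

lemma lintegral_cutWave_core_le (hw : w.Regime t) (hx : w.Close t x) (hμ : 0 < 1 - t - μ)
    {n : ℕ} (hn : n ≠ 0) :
    ∫⁻ q in w.core μ, ENNReal.ofReal ((‖w.cutWave x q‖ ^ 2) ^ n) ≤
      ENNReal.ofReal (w.scale n * (Real.exp (2 * t) ^ n * (Real.pi * cauchyIntegral n / (2 * n) *
        ((1 - t - μ) * (((1 - t - μ) ^ 2) ^ n)⁻¹)))) := by
  have hD := hw.D_pos
  have hm : Measurable w.profile := (continuous_profile hw).measurable
  set c := (1 - t - μ) * w.D with hc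
  have hc0 : 0 < c := by positivity
  calc _ ≤ ∫⁻ q in w.core μ, ENNReal.ofReal (Real.exp (2 * t) ^ n) *
        (ENNReal.ofReal (((c ^ 2 + (x 2 - q.1) ^ 2)⁻¹) ^ n) * ENNReal.ofReal (w.profile q ^ n)) := by
        refine setLIntegral_mono' (measurableSet_core w μ) fun q hq => ?_
        rw [← ENNReal.ofReal_mul (by positivity), ← ENNReal.ofReal_mul (by positivity), ← mul_pow,
          ← mul_pow]
        exact ENNReal.ofReal_le_ofReal (pow_le_pow_left₀ (by positivity)
          (norm_cutWave_core_le hw hx hμ hq) n)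
    _ ≤ ∫⁻ q, ENNReal.ofReal (Real.exp (2 * t) ^ n) *
        (ENNReal.ofReal (((c ^ 2 + (x 2 - q.1) ^ 2)⁻¹) ^ n) * ENNReal.ofReal (w.profile q ^ n)) :=
        setLIntegral_le_lintegral _ _
    _ ≤ ENNReal.ofReal (Real.exp (2 * t) ^ n) *
        (ENNReal.ofReal (c * ((c ^ 2) ^ n)⁻¹ * cauchyIntegral n) *
          ENNReal.ofReal (Real.pi * w.ro ^ 2 / (2 * n))) := by
        rw [lintegral_const_mul' _ _ ENNReal.ofReal_ne_top, ← lintegral_inv_sq_add_sq_pow hc0 _ hn]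
        gcongr
        exact lintegral_mul_profile_le hw (by fun_prop) hn
    _ = _ := by
        rw [← ENNReal.ofReal_mul' (by positivity), ← ENNReal.ofReal_mul (by positivity)]
        congr 1
        rw [scale, hc, mul_pow, mul_pow]
        field_simp

lemma lintegral_cutWave_outer_le (hw : w.Regime t) (hx : w.Close t x) (hμ : 0 ≤ μ)
    (hμ' : 2 * t ≤ μ ^ 2) {n : ℕ} (hn : n ≠ 0) (hn' : n ≤ 8) :
    ∫⁻ q in (w.core μ)ᶜ, ENNReal.ofReal ((‖w.cutWave x q‖ ^ 2) ^ n) ≤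
      ENNReal.ofReal (w.scale n * (t * (Real.exp (2 * t) ^ n * (Real.pi *
        (2 ^ n * cauchyIntegral n / (2 * n) + 16 * t))))) := by
  have hD := hw.D_pos
  have hZ := hw.Z_pos
  have ha := hw.a_pos
  have hro := hw.ro_pos
  have ht := hw.t_pos
  have hm : Measurable w.profile := (continuous_profile hw).measurable
  have hJ : 0 ≤ cauchyIntegral n := integral_nonneg fun x => by positivity
  set T := (w.a ^ 2)⁻¹ ^ n * Real.exp (-(μ ^ 2 / 2 * (w.D / w.ro) ^ 2)) with hT
  have hT0 : 0 ≤ T := by positivity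
  -- The factor `a⁻²ⁿ` from close particles is cancelled by the Gaussian tail; `n ≤ 8` keeps `2 n`
  -- within the sixteen available powers.
  have hT1 : T ≤ t * ((w.Z ^ 2) ^ n)⁻¹ := by
    have h1 := hw.tail_le (τ := μ ^ 2 / 2) (by linarith) (m := 2 * n) (by omega)
    calc T ≤ (w.a ^ 2)⁻¹ ^ n * (t * (w.a / w.Z) ^ (2 * n)) := by rw [hT]; gcongr
      _ = _ := by
        rw [pow_mul, div_pow, div_pow, inv_pow]
        field_simp
  -- The range scale `Z` in place of `D` gives `Z^(1 - 2n) ≤ t D^(1 - 2n)`, because `D ≤ t Z` and `n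
  -- ≥ 1`.
  have hscale : w.Z * ((w.Z ^ 2) ^ n)⁻¹ ≤ t * (w.D * ((w.D ^ 2) ^ n)⁻¹) := by
    obtain ⟨m, rfl⟩ := Nat.exists_eq_succ_of_ne_zero hn
    have h1 : w.Z⁻¹ ≤ t * w.D⁻¹ := by
      rw [← div_eq_mul_inv, le_div_iff₀ hD, inv_mul_le_iff₀ hZ, mul_comm]
      exact hw.D_Z
    have h2 := hw.D_le_Z
    calc _ = w.Z⁻¹ * ((w.Z ^ 2) ^ m)⁻¹ := by rw [Nat.succ_eq_add_one, pow_succ]; field_simp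
      _ ≤ (t * w.D⁻¹) * ((w.D ^ 2) ^ m)⁻¹ := by gcongr
      _ = _ := by rw [Nat.succ_eq_add_one, pow_succ (w.D ^ 2)]; field_simp
  calc _ ≤ ∫⁻ q in (w.core μ)ᶜ, ENNReal.ofReal (Real.exp (2 * t) ^ n) *
        (ENNReal.ofReal (2 ^ n) * (ENNReal.ofReal (((w.Z ^ 2 + (x 2 - q.1) ^ 2)⁻¹) ^ n) *
          ENNReal.ofReal (w.profile q ^ n)) +
        (ENNReal.ofReal T * (Set.Icc 0 (8 * w.Z)).indicator (fun _ => (1 : ENNReal)) q.1) *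
        ENNReal.ofReal (Real.exp (-(1 / (2 * w.ro ^ 2) * (q.2.1 ^ 2 + q.2.2 ^ 2))))) := by
        refine setLIntegral_mono' (measurableSet_core w μ).compl fun q hq => ?_
        refine (ENNReal.ofReal_le_ofReal (norm_cutWave_outer_le hw hx hμ hq hn)).trans_eq ?_
        have h0 := profile_nonneg w q
        have hi : 0 ≤ (Set.Icc 0 (8 * w.Z)).indicator (fun _ => (1 : ℝ)) q.1 :=
          Set.indicator_nonneg (fun _ _ => zero_le_one) _
        have hi' : (Set.Icc 0 (8 * w.Z)).indicator (fun _ => (1 : ENNReal)) q.1 =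
            ENNReal.ofReal ((Set.Icc 0 (8 * w.Z)).indicator (fun _ => (1 : ℝ)) q.1) := by
          by_cases h : q.1 ∈ Set.Icc 0 (8 * w.Z) <;> simp [h]
        rw [← hT, hi', ← ENNReal.ofReal_mul (by positivity), ← ENNReal.ofReal_mul (by positivity),
          ← ENNReal.ofReal_mul (by positivity), ← ENNReal.ofReal_mul (by positivity),
          ← ENNReal.ofReal_add (by positivity) (by positivity),
          ← ENNReal.ofReal_mul (by positivity)]
        congr 1
        ring
    _ ≤ ∫⁻ q, ENNReal.ofReal (Real.exp (2 * t) ^ n) *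
        (ENNReal.ofReal (2 ^ n) * (ENNReal.ofReal (((w.Z ^ 2 + (x 2 - q.1) ^ 2)⁻¹) ^ n) *
          ENNReal.ofReal (w.profile q ^ n)) +
        (ENNReal.ofReal T * (Set.Icc 0 (8 * w.Z)).indicator (fun _ => (1 : ENNReal)) q.1) *
        ENNReal.ofReal (Real.exp (-(1 / (2 * w.ro ^ 2) * (q.2.1 ^ 2 + q.2.2 ^ 2))))) :=
        setLIntegral_le_lintegral _ _
    _ ≤ ENNReal.ofReal (Real.exp (2 * t) ^ n) * (ENNReal.ofReal (2 ^ n) *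
        (ENNReal.ofReal (w.Z * ((w.Z ^ 2) ^ n)⁻¹ * cauchyIntegral n) *
          ENNReal.ofReal (Real.pi * w.ro ^ 2 / (2 * n))) +
        ENNReal.ofReal T * ENNReal.ofReal (8 * w.Z) *
          ENNReal.ofReal (Real.pi / (1 / (2 * w.ro ^ 2)))) := by
        rw [lintegral_const_mul' _ _ ENNReal.ofReal_ne_top, lintegral_add_left (by fun_prop),
          lintegral_const_mul' _ _ ENNReal.ofReal_ne_top, ← lintegral_inv_sq_add_sq_pow hZ (x 2) hn,
          ← lintegral_gaussian_prod (by positivity)]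
        gcongr
        · exact lintegral_mul_profile_le hw (by fun_prop) hn
        · rw [Measure.volume_eq_prod, lintegral_prod_mul
            (f := fun z => ENNReal.ofReal T *
              (Set.Icc 0 (8 * w.Z)).indicator (fun _ => (1 : ENNReal)) z)
            (g := fun p : ℝ × ℝ =>
              ENNReal.ofReal (Real.exp (-(1 / (2 * w.ro ^ 2) * (p.1 ^ 2 + p.2 ^ 2)))))
            ((measurable_const.mul (measurable_const.indicator measurableSet_Icc)).aemeasurable)
            (by fun_prop), lintegral_const_mul' _ _ ENNReal.ofReal_ne_top]
          rw [lintegral_indicator_const measurableSet_Icc, Real.volume_Icc, sub_zero, one_mul]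
    _ = ENNReal.ofReal (Real.exp (2 * t) ^ n * (2 ^ n *
        (w.Z * ((w.Z ^ 2) ^ n)⁻¹ * cauchyIntegral n * (Real.pi * w.ro ^ 2 / (2 * n))) +
        T * (8 * w.Z) * (Real.pi / (1 / (2 * w.ro ^ 2))))) := by
        rw [← ENNReal.ofReal_mul (by positivity), ← ENNReal.ofReal_mul (by positivity),
          ← ENNReal.ofReal_mul (by positivity), ← ENNReal.ofReal_mul (by positivity),
          ← ENNReal.ofReal_add (by positivity) (by positivity),
          ← ENNReal.ofReal_mul (by positivity)]
    _ ≤ _ := by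
        apply ENNReal.ofReal_le_ofReal
        calc _ ≤ Real.exp (2 * t) ^ n * (2 ^ n *
              (w.Z * ((w.Z ^ 2) ^ n)⁻¹ * cauchyIntegral n * (Real.pi * w.ro ^ 2 / (2 * n))) +
              t * ((w.Z ^ 2) ^ n)⁻¹ * (8 * w.Z) * (Real.pi / (1 / (2 * w.ro ^ 2)))) := by gcongr
          _ = (w.Z * ((w.Z ^ 2) ^ n)⁻¹) * (w.ro ^ 2 * (Real.exp (2 * t) ^ n * (Real.pi *
              (2 ^ n * cauchyIntegral n / (2 * n) + 16 * t)))) := by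
              field_simp
              ring
          _ ≤ (t * (w.D * ((w.D ^ 2) ^ n)⁻¹)) * (w.ro ^ 2 * (Real.exp (2 * t) ^ n * (Real.pi *
              (2 ^ n * cauchyIntegral n / (2 * n) + 16 * t)))) := by gcongr
          _ = _ := by rw [scale]; ring

/-- The relative upper bound of the integral of `‖cutWave‖ ^ (2 n)`. -/
noncomputable def upperConst (n : ℕ) (t : ℝ) : ℝ :=
  Real.exp (2 * t) ^ n * (Real.pi * cauchyIntegral n / (2 * n) *
    ((1 - t - √(2 * t)) * (((1 - t - √(2 * t)) ^ 2) ^ n)⁻¹)) +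
  t * (Real.exp (2 * t) ^ n * (Real.pi * (2 ^ n * cauchyIntegral n / (2 * n) + 16 * t)))

lemma tendsto_upperConst {n : ℕ} :
    Filter.Tendsto (upperConst n) (nhds 0) (nhds (Real.pi * cauchyIntegral n / (2 * n))) := by
  have : ContinuousAt (upperConst n) 0 := by
    unfold upperConst
    have h : (((1 - (0 : ℝ) - √(2 * 0)) ^ 2) ^ n) ≠ 0 := by simp
    fun_prop (disch := exact h)
  have h2 : upperConst n 0 = Real.pi * cauchyIntegral n / (2 * n) := by simp [upperConst]
  rw [← h2]
  exact this

lemma lintegral_cutWave_le (hw : w.Regime t) (hx : w.Close t x) {n : ℕ} (hn : n ≠ 0)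
    (hn' : n ≤ 8) :
    ∫⁻ q, ENNReal.ofReal ((‖w.cutWave x q‖ ^ 2) ^ n) ≤
      ENNReal.ofReal (w.scale n * upperConst n t) := by
  have ht := hw.t_pos
  have hD := hw.D_pos
  have hJ : 0 ≤ cauchyIntegral n := integral_nonneg fun x => by positivity
  have h2 : √(2 * t) ^ 2 = 2 * t := Real.sq_sqrt (by positivity)
  have h3 : 0 < 1 - t - √(2 * t) := by
    have : √(2 * t) ≤ 1 / 2 := Real.sqrt_le_iff.2 ⟨by norm_num, by linarith [hw.t_le]⟩
    linarith [hw.t_le]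
  -- The choice `μ = √(2 t)` tends to `0`, so the core constant is sharp in the limit, while `μ² / 2
  -- = t` is exactly the exponent of the tail hypothesis.
  rw [← lintegral_add_compl _ (measurableSet_core w (√(2 * t)))]
  refine (add_le_add (lintegral_cutWave_core_le hw hx h3 hn)
    (lintegral_cutWave_outer_le hw hx (Real.sqrt_nonneg _) h2.ge hn hn')).trans_eq ?_
  have h4 : 0 ≤ w.scale n := by rw [scale]; positivity
  rw [← ENNReal.ofReal_add (by positivity) (by positivity), ← mul_add, upperConst]

end WaveParams

/-! ### Lower bounds of the even moments. -/

lemma setIntegral_Icc_inv_sq_add_sq_pow {c : ℝ} (hc : 0 < c) (b : ℝ) {N : ℝ} (hN : 0 ≤ N) (n : ℕ) :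
    ∫ z in Set.Icc (b - N * c) (b + N * c), ((c ^ 2 + (b - z) ^ 2)⁻¹) ^ n =
      c * ((c ^ 2) ^ n)⁻¹ * ∫ x in (-N)..N, ((1 + x ^ 2)⁻¹) ^ n := by
  have hNc : 0 ≤ N * c := by positivity
  rw [integral_Icc_eq_integral_Ioc, ← intervalIntegral.integral_of_le (by linarith)]
  simp_rw [inv_sq_add_sq_pow hc b _ n]
  rw [intervalIntegral.integral_const_mul,
    intervalIntegral.integral_comp_sub_left (fun z => ((1 + (z / c) ^ 2)⁻¹) ^ n) b,
    intervalIntegral.integral_comp_div (fun z => ((1 + z ^ 2)⁻¹) ^ n) hc.ne']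
  have e1 : (b - (b + N * c)) / c = -N := by field_simp; ring
  have e2 : (b - (b - N * c)) / c = N := by field_simp; ring
  rw [e1, e2, smul_eq_mul]
  ring

lemma setIntegral_Icc_gaussian {r : ℝ} (hr : 0 < r) {T d : ℝ} (hT : 0 ≤ T) (hd : T * r ≤ d)
    {b : ℝ} (hb : 0 < b) :
    r * (∫ x in (-T)..T, Real.exp (-b * x ^ 2)) ≤
      ∫ u in Set.Icc (-d) d, Real.exp (-(b / r ^ 2) * u ^ 2) := by
  have hTr : 0 ≤ T * r := by positivity
  have h1 : ∫ u in Set.Icc (-(T * r)) (T * r), Real.exp (-(b / r ^ 2) * u ^ 2) =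
      r * (∫ x in (-T)..T, Real.exp (-b * x ^ 2)) := by
    rw [integral_Icc_eq_integral_Ioc, ← intervalIntegral.integral_of_le (by linarith)]
    have := intervalIntegral.integral_comp_div (a := -(T * r)) (b := T * r)
      (fun x => Real.exp (-b * x ^ 2)) hr.ne'
    have e1 : -(T * r) / r = -T := by field_simp
    have e2 : T * r / r = T := by field_simp
    rw [e1, e2, smul_eq_mul] at this
    rw [← this]
    congr 1
    ext u
    congr 1
    field_simp
  rw [← h1]
  refine setIntegral_mono_set (integrable_exp_neg_mul_sq (by positivity)).integrableOn
    (Filter.Eventually.of_forall fun u => (Real.exp_pos _).le) ?_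
  exact (Set.Icc_subset_Icc (by linarith) hd).eventuallyLE

namespace WaveParams

variable {w : WaveParams} {t μ : ℝ} {x x' : Fin 3 → ℝ}

lemma rdist_core (hw : w.Regime t) (hx : w.Close t x) {N : ℝ} (hN : 0 ≤ N)
    (hNt : N * t ≤ 1 / 2) (hμ : t ≤ μ) (hμ' : μ ≤ 1 / 100) {q : ℝ × ℝ × ℝ}
    (hz : q.1 ∈ Set.Icc (w.Z - N * w.D) (w.Z + N * w.D)) (hp : q.2 ∈ box (μ * w.D)) :
    rdist x q ^ 2 ≤ (1 + 10 * μ) * (w.D ^ 2 + (w.Z - q.1) ^ 2) ∧ rdist x q ≤ (N + 2) * w.D ∧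
      w.D / 2 ≤ rdist x q := by
  have hD := hw.D_pos
  have ht := hw.t_pos
  obtain ⟨hz1, hz2⟩ := hz
  obtain ⟨hu, hv⟩ := mem_box.1 hp
  rw [abs_le] at hu hv
  obtain ⟨h0, h0'⟩ := abs_le.1 hx.zero
  obtain ⟨h1, h1'⟩ := abs_le.1 hx.one
  obtain ⟨h2, h2'⟩ := abs_le.1 hx.two
  have hμ0 : 0 < μ := ht.trans_le hμ
  have htD : t * w.D ≤ μ * w.D := by gcongr
  have hμD : μ * w.D ≤ 1 / 100 * w.D := by gcongr
  have e0 : (x 0 - q.2.1) ^ 2 ≤ ((1 + 2 * μ) * w.D) ^ 2 := sq_le_sq' (by linarith) (by linarith)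
  have e1 : (x 1 - q.2.2) ^ 2 ≤ (2 * μ * w.D) ^ 2 := sq_le_sq' (by linarith) (by linarith)
  have e2 : (x 2 - w.Z) ^ 2 ≤ (t * w.D) ^ 2 := sq_le_sq' (by linarith) (by linarith)
  rw [rdist_sq]
  refine ⟨?_, ?_, ?_⟩
  -- Young's inequality with weight `t`, since `|x 2 - Z| ≤ t D`.
  · have e3 : (x 2 - q.1) ^ 2 ≤ (1 + t) * (w.Z - q.1) ^ 2 + (t + t ^ 2) * w.D ^ 2 := by
      have : 0 ≤ (t * (w.Z - q.1) - (x 2 - w.Z)) ^ 2 := sq_nonneg _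
      have h5 : t * (x 2 - q.1) ^ 2 ≤ t * ((1 + t) * (w.Z - q.1) ^ 2 + (t + t ^ 2) * w.D ^ 2) := by
        have := mul_le_mul_of_nonneg_left e2 (by positivity : 0 ≤ 1 + t)
        linarith
      exact le_of_mul_le_mul_left h5 ht
    have e4 : (1 + t) * (w.Z - q.1) ^ 2 ≤ (1 + 10 * μ) * (w.Z - q.1) ^ 2 := by
      gcongr
      linarith
    have e5 : (1 + 2 * μ) ^ 2 + (2 * μ) ^ 2 + (t + t ^ 2) ≤ 1 + 10 * μ := by nlinarith
    linarith [mul_le_mul_of_nonneg_right e5 (sq_nonneg w.D)]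
  · apply le_of_sq_le_sq _ (by positivity)
    rw [rdist_sq]
    have e3 : (x 2 - q.1) ^ 2 ≤ ((N + t) * w.D) ^ 2 := sq_le_sq' (by linarith) (by linarith)
    have e5 : (1 + 2 * μ) ^ 2 + (2 * μ) ^ 2 + (N + t) ^ 2 ≤ (N + 2) ^ 2 := by nlinarith
    linarith [mul_le_mul_of_nonneg_right e5 (sq_nonneg w.D)]
  · apply le_of_sq_le_sq _ (rdist_nonneg x q)
    rw [rdist_sq]
    have e3 : (w.D / 2) ^ 2 ≤ (x 0 - q.2.1) ^ 2 := pow_le_pow_left₀ (by positivity) (by linarith) 2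
    linarith [sq_nonneg (x 1 - q.2.2), sq_nonneg (x 2 - q.1)]

lemma norm_cutWave_sq_ge (hw : w.Regime t) (hx : w.Close t x) {N : ℝ} (hN : 0 ≤ N)
    (hNt : N * t ≤ 1 / 2) (hμ : t ≤ μ) (hμ' : μ ≤ 1 / 100) {q : ℝ × ℝ × ℝ}
    (hz : q.1 ∈ Set.Icc (w.Z - N * w.D) (w.Z + N * w.D)) (hp : q.2 ∈ box (μ * w.D)) :
    Real.exp (-(2 * (2 * N + 2) * t)) * ((1 + 10 * μ) * (1 + 4 * t ^ 2))⁻¹ *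
      ((w.D ^ 2 + (w.Z - q.1) ^ 2)⁻¹ * Real.exp (-(2 / w.ro ^ 2 * (q.2.1 ^ 2 + q.2.2 ^ 2)))) ≤
      ‖w.cutWave x q‖ ^ 2 := by
  obtain ⟨hr2, hr, hr'⟩ := rdist_core hw hx hN hNt hμ hμ' hz hp
  have hD := hw.D_pos
  have hZ := hw.Z_pos
  have hro := hw.ro_pos
  have ht := hw.t_pos
  have hL := hw.L_pos
  have hkd := hw.kd_pos
  have ht4 := hw.t_le
  obtain ⟨hz1, hz2⟩ := hz
  have hμ0 : 0 < μ := ht.trans_le hμ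
  have hND : N * w.D ≤ w.Z / 2 := by
    calc N * w.D ≤ N * (t * w.Z) := mul_le_mul_of_nonneg_left hw.D_Z hN
      _ = (N * t) * w.Z := by ring
      _ ≤ 1 / 2 * w.Z := by gcongr
      _ = _ := by ring
  have hra : w.a < rdist x q := by
    have e1 : w.a ≤ w.D / 100 := by
      have := hw.a_ro
      have := hw.ro_D
      nlinarith
    linarith
  have hz0 : 0 < q.1 := by linarith
  have hr0 : 0 < rdist x q := hw.a_pos.trans hra
  rw [cutWave, if_pos ⟨hz0, hra⟩, norm_wave_real_sq, profile]
  have hs : (q.1 / w.L) ^ 2 ≤ 4 * t ^ 2 := by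
    have e1 : q.1 / w.L ≤ 2 * t := by
      rw [div_le_iff₀ hL]
      linarith [hw.Z_L]
    calc (q.1 / w.L) ^ 2 ≤ (2 * t) ^ 2 := by gcongr
      _ = _ := by ring
  have hexp : -(2 * (2 * N + 2) * t) ≤ 2 * (w.kd * (w.Z - rdist x q - q.1)) := by
    have e1 : -((2 * N + 2) * w.D) ≤ w.Z - rdist x q - q.1 := by linarith
    have e2 := mul_le_mul_of_nonneg_left e1 hkd.le
    have e3 : (2 * N + 2) * (w.kd * w.D) ≤ (2 * N + 2) * t :=
      mul_le_mul_of_nonneg_left hw.kd_D (by positivity)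
    linarith
  calc _ = Real.exp (-(2 * (2 * N + 2) * t)) / ((1 + 10 * μ) * (w.D ^ 2 + (w.Z - q.1) ^ 2)) *
        ((1 + 4 * t ^ 2)⁻¹ * Real.exp (-(2 / w.ro ^ 2 * (q.2.1 ^ 2 + q.2.2 ^ 2)))) := by
        field_simp
    _ ≤ _ := by
        gcongr
        have : w.ro ^ 2 * 1 ≤ w.ro ^ 2 * (1 + (q.1 / w.L) ^ 2) := by
          gcongr
          nlinarith [sq_nonneg (q.1 / w.L)]
        linarith

/-- The integral is restricted to ranges within `N D` of the camera and to cross-ranges within `√t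
D`. For fixed large `N` the truncated Cauchy and Gaussian integrals almost reach their limits, and
there the wave has its leading form up to a factor that tends to `1` with `t`. The exponents `i`,
`j` cover one wave and the product of two. -/
lemma exists_lintegral_cutWave_ge {i j n : ℕ} (hij : i + j = n) (hn : n ≠ 0) {c : ℝ}
    (hc : c < Real.pi * cauchyIntegral n / (2 * n)) :
    ∃ t₀ > 0, ∀ (w : WaveParams) (t : ℝ) (x x' : Fin 3 → ℝ), w.Regime t → t ≤ t₀ →
      w.Close t x → w.Close t x' →
      ENNReal.ofReal (w.scale n * c) ≤
        ∫⁻ q, ENNReal.ofReal ((‖w.cutWave x q‖ ^ 2) ^ i * (‖w.cutWave x' q‖ ^ 2) ^ j) := by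
  have hn' : (0 : ℝ) < n := by exact_mod_cast Nat.pos_of_ne_zero hn
  have hlim : Filter.Tendsto (fun N : ℝ => (∫ x in (-N)..N, ((1 + x ^ 2)⁻¹) ^ n) *
      (∫ x in (-N)..N, Real.exp (-(2 * n) * x ^ 2)) ^ 2) Filter.atTop
      (nhds (cauchyIntegral n * (√(Real.pi / (2 * n))) ^ 2)) := by
    have h1 := intervalIntegral_tendsto_integral (integrable_inv_one_add_sq_pow hn)
      Filter.tendsto_neg_atTop_atBot Filter.tendsto_id
    have h2 := intervalIntegral_tendsto_integral
      (integrable_exp_neg_mul_sq (by positivity : (0 : ℝ) < 2 * n))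
      Filter.tendsto_neg_atTop_atBot Filter.tendsto_id
    rw [integral_gaussian] at h2
    exact h1.mul (h2.pow 2)
  have e : cauchyIntegral n * (√(Real.pi / (2 * n))) ^ 2 =
      Real.pi * cauchyIntegral n / (2 * n) := by
    rw [Real.sq_sqrt (by positivity)]
    ring
  rw [e] at hlim
  obtain ⟨N, hN, hN0⟩ := ((hlim.eventually (lt_mem_nhds hc)).and
    (Filter.eventually_ge_atTop (1 : ℝ))).exists
  set A := ∫ x in (-N)..N, ((1 + x ^ 2)⁻¹) ^ n with hA
  set B := ∫ x in (-N)..N, Real.exp (-(2 * n) * x ^ 2) with hB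
  set κ : ℝ → ℝ := fun t => Real.exp (-(2 * (2 * N + 2) * t)) *
    ((1 + 10 * √t) * (1 + 4 * t ^ 2))⁻¹ with hκ
  have hκc : ContinuousAt (fun t => κ t ^ n * (A * B ^ 2)) 0 := by
    have h : (1 + 10 * √(0 : ℝ)) * (1 + 4 * 0 ^ 2) ≠ 0 := by simp
    rw [hκ]
    fun_prop (disch := exact h)
  have hκ0 : c < κ 0 ^ n * (A * B ^ 2) := by simpa [hκ] using hN
  obtain ⟨r, hr, hr'⟩ := Metric.eventually_nhds_iff.1 (hκc.eventually (lt_mem_nhds hκ0))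
  -- The second bound gives `N √t ≤ 1 / 2`, hence `N r_o ≤ N t D ≤ √t D`: the box contains the
  -- Gaussian truncated at `N r_o`.
  refine ⟨min (r / 2) (1 / (4 * N ^ 2)), by positivity, fun w t x x' hw ht hx hx' => ?_⟩
  have ht0 := hw.t_pos
  have ht4 := hw.t_le
  have hD := hw.D_pos
  have hro := hw.ro_pos
  have htr : c < κ t ^ n * (A * B ^ 2) := by
    apply hr'
    rw [Real.dist_eq, sub_zero, abs_of_pos ht0]
    linarith [ht.trans (min_le_left _ _)]
  have htN : t * (4 * N ^ 2) ≤ 1 := by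
    rw [← le_div_iff₀ (by positivity)]
    exact ht.trans (min_le_right _ _)
  have hs2 : √t ^ 2 = t := Real.sq_sqrt ht0.le
  have hs0 : 0 < √t := Real.sqrt_pos.2 ht0
  have hs1 : √t ≤ 1 / 100 := Real.sqrt_le_iff.2 ⟨by norm_num, by linarith⟩
  have hsN : N * √t ≤ 1 / 2 := by
    apply le_of_sq_le_sq _ (by norm_num)
    nlinarith
  have hNt : N * t ≤ 1 / 2 := by nlinarith
  have hNr : N * w.ro ≤ √t * w.D := by
    calc N * w.ro ≤ N * (t * w.D) := mul_le_mul_of_nonneg_left hw.ro_D (by linarith)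
      _ = (N * √t) * √t * w.D := by rw [mul_assoc N, ← sq, hs2]; ring
      _ ≤ 1 / 2 * √t * w.D := by gcongr
      _ ≤ _ := by nlinarith [mul_pos hs0 hD]
  have hκt : 0 ≤ κ t := by rw [hκ]; positivity
  set R := Set.Icc (w.Z - N * w.D) (w.Z + N * w.D) ×ˢ box (√t * w.D) with hR
  have hRm : MeasurableSet R := measurableSet_Icc.prod (measurableSet_box _)
  have hint : Integrable (fun q : ℝ × ℝ × ℝ => ((w.D ^ 2 + (w.Z - q.1) ^ 2)⁻¹) ^ n *
      (Real.exp (-((2 * n) / w.ro ^ 2) * q.2.1 ^ 2) *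
        Real.exp (-((2 * n) / w.ro ^ 2) * q.2.2 ^ 2))) :=
    (integrable_inv_sq_add_sq_pow hD w.Z hn).mul_prod
      ((integrable_exp_neg_mul_sq (by positivity)).mul_prod
        (integrable_exp_neg_mul_sq (by positivity)))
  have hval : w.scale n * (A * B ^ 2) ≤ ∫ q in R, ((w.D ^ 2 + (w.Z - q.1) ^ 2)⁻¹) ^ n *
      (Real.exp (-((2 * n) / w.ro ^ 2) * q.2.1 ^ 2) *
        Real.exp (-((2 * n) / w.ro ^ 2) * q.2.2 ^ 2)) := by
    rw [hR, box, Measure.volume_eq_prod, setIntegral_prod_mul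
      (fun z => ((w.D ^ 2 + (w.Z - z) ^ 2)⁻¹) ^ n) (fun p : ℝ × ℝ =>
        (Real.exp (-((2 * n) / w.ro ^ 2) * p.1 ^ 2) * Real.exp (-((2 * n) / w.ro ^ 2) * p.2 ^ 2))),
      Measure.volume_eq_prod, setIntegral_prod_mul
      (fun u => Real.exp (-((2 * n) / w.ro ^ 2) * u ^ 2))
      (fun u => Real.exp (-((2 * n) / w.ro ^ 2) * u ^ 2)),
      setIntegral_Icc_inv_sq_add_sq_pow hD _ (by linarith)]
    have h1 := setIntegral_Icc_gaussian hro (T := N) (by linarith) hNr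
      (by positivity : (0 : ℝ) < 2 * n)
    have hA0 : 0 ≤ A := intervalIntegral.integral_nonneg (by linarith) fun x _ => by positivity
    have hB0 : 0 ≤ B := intervalIntegral.integral_nonneg (by linarith) fun x _ =>
      (Real.exp_pos _).le
    rw [← hB] at h1
    rw [← hA, scale]
    calc _ = w.D * ((w.D ^ 2) ^ n)⁻¹ * A * ((w.ro * B) * (w.ro * B)) := by ring
      _ ≤ _ := by gcongr
  have hs : 0 ≤ w.scale n := by rw [scale]; positivity
  calc ENNReal.ofReal (w.scale n * c) ≤ ENNReal.ofReal (κ t ^ n * ∫ q in R,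
        ((w.D ^ 2 + (w.Z - q.1) ^ 2)⁻¹) ^ n *
        (Real.exp (-((2 * n) / w.ro ^ 2) * q.2.1 ^ 2) *
        Real.exp (-((2 * n) / w.ro ^ 2) * q.2.2 ^ 2))) := by
        apply ENNReal.ofReal_le_ofReal
        calc w.scale n * c ≤ w.scale n * (κ t ^ n * (A * B ^ 2)) := by gcongr
          _ = κ t ^ n * (w.scale n * (A * B ^ 2)) := by ring
          _ ≤ _ := by gcongr
    _ = ∫⁻ q in R, ENNReal.ofReal (κ t ^ n * (((w.D ^ 2 + (w.Z - q.1) ^ 2)⁻¹) ^ n *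
        (Real.exp (-((2 * n) / w.ro ^ 2) * q.2.1 ^ 2) *
        Real.exp (-((2 * n) / w.ro ^ 2) * q.2.2 ^ 2)))) := by
        rw [← integral_const_mul, ofReal_integral_eq_lintegral_ofReal
          (hint.integrableOn.const_mul _) (Filter.Eventually.of_forall fun q => by positivity)]
    _ ≤ ∫⁻ q in R, ENNReal.ofReal ((‖w.cutWave x q‖ ^ 2) ^ i * (‖w.cutWave x' q‖ ^ 2) ^ j) := by
        refine setLIntegral_mono' hRm fun q hq => ENNReal.ofReal_le_ofReal ?_
        have hts : t ≤ √t := by nlinarith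
        have h1 := norm_cutWave_sq_ge hw hx (by linarith : (0 : ℝ) ≤ N) hNt hts hs1 hq.1 hq.2
        have h2 := norm_cutWave_sq_ge hw hx' (by linarith : (0 : ℝ) ≤ N) hNt hts hs1 hq.1 hq.2
        refine le_trans (le_of_eq ?_) (mul_le_mul (pow_le_pow_left₀ (by positivity) h1 i)
          (pow_le_pow_left₀ (by positivity) h2 j) (by positivity) (by positivity))
        have e1 : Real.exp (-((2 * n) / w.ro ^ 2) * q.2.1 ^ 2) *
            Real.exp (-((2 * n) / w.ro ^ 2) * q.2.2 ^ 2) =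
            Real.exp (-(2 / w.ro ^ 2 * (q.2.1 ^ 2 + q.2.2 ^ 2))) ^ n := by
          rw [← Real.exp_nat_mul, ← Real.exp_add]
          congr 1
          ring
        rw [← pow_add, hij, e1, ← mul_pow, ← mul_pow]
    _ ≤ _ := setLIntegral_le_lintegral _ _

end WaveParams

/-- Shifting the integral over a half-line in a half-strip. -/
lemma integral_Ioi_eq_of_halfStrip {F : ℂ → ℂ} {θ M : ℝ} (hθ : 0 ≤ θ)
    (hF : ∀ s φ : ℝ, 0 ≤ s → 0 ≤ φ → φ ≤ θ → DifferentiableAt ℂ F (s + φ * Complex.I))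
    (hM : ∀ s φ : ℝ, 0 ≤ s → 0 ≤ φ → φ ≤ θ → ‖F (s + φ * Complex.I)‖ ≤ M * Real.exp (-s)) :
    ∫ s in Set.Ioi (0 : ℝ), F s = (∫ s in Set.Ioi (0 : ℝ), F (s + θ * Complex.I)) +
      Complex.I * ∫ φ in (0 : ℝ)..θ, F (φ * Complex.I) := by
  have hint : ∀ φ : ℝ, 0 ≤ φ → φ ≤ θ →
      IntegrableOn (fun s : ℝ => F (s + φ * Complex.I)) (Set.Ioi 0) := by
    intro φ h1 h2
    refine Integrable.mono' ((exp_neg_integrableOn_Ioi 0 one_pos).const_mul M) ?_ ?_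
    · refine ContinuousOn.aestronglyMeasurable (fun s hs => ?_) measurableSet_Ioi
      have h := (hF s φ (le_of_lt hs) h1 h2).continuousAt
      exact (ContinuousAt.comp (f := fun s : ℝ => (s + φ * Complex.I : ℂ)) h
        (by fun_prop)).continuousWithinAt
    · refine (ae_restrict_mem measurableSet_Ioi).mono fun s hs => ?_
      simpa using hM s φ (le_of_lt hs) h1 h2
  have hrect : ∀ R : ℝ, 0 ≤ R → (∫ s in (0 : ℝ)..R, F s) -
      (∫ s in (0 : ℝ)..R, F (s + θ * Complex.I)) =
      Complex.I * (∫ φ in (0 : ℝ)..θ, F (φ * Complex.I)) -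
      Complex.I * ∫ φ in (0 : ℝ)..θ, F (R + φ * Complex.I) := by
    intro R hR
    have := Complex.integral_boundary_rect_eq_zero_of_differentiableOn F 0 (R + θ * Complex.I) (by
      intro ζ hζ
      obtain ⟨h1, h2⟩ := hζ
      simp only [Complex.zero_re, Complex.add_re, Complex.ofReal_re, Complex.mul_re, Complex.I_re,
        Complex.ofReal_im, Complex.I_im, Complex.zero_im, Complex.add_im, Complex.mul_im, mul_zero,
        mul_one, sub_zero, add_zero, zero_add, Set.mem_preimage] at h1 h2
      rw [Set.uIcc_of_le hR] at h1
      rw [Set.uIcc_of_le hθ] at h2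
      have := hF ζ.re ζ.im h1.1 h2.1 h2.2
      rw [Complex.re_add_im] at this
      exact this.differentiableWithinAt)
    simp only [Complex.zero_re, Complex.add_re, Complex.ofReal_re, Complex.mul_re, Complex.I_re,
      Complex.ofReal_im, Complex.I_im, Complex.zero_im, Complex.add_im, Complex.mul_im, mul_zero,
      mul_one, sub_zero, add_zero, zero_add, Complex.ofReal_zero, zero_mul, smul_eq_mul] at this
    linear_combination this
  have hright : Filter.Tendsto (fun R : ℝ => ∫ φ in (0 : ℝ)..θ, F (R + φ * Complex.I)) Filter.atTop
      (nhds 0) := by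
    have h1 : Filter.Tendsto (fun R : ℝ => M * Real.exp (-R) * |θ - 0|) Filter.atTop (nhds 0) := by
      have := (Real.tendsto_exp_neg_atTop_nhds_zero.const_mul M).mul_const |θ - 0|
      simpa using this
    refine squeeze_zero_norm' ?_ h1
    filter_upwards [Filter.eventually_ge_atTop 0] with R hR
    refine intervalIntegral.norm_integral_le_of_norm_le_const fun φ hφ => ?_
    rw [Set.uIoc_of_le hθ] at hφ
    exact hM R φ hR hφ.1.le hφ.2
  have e0 := hint 0 le_rfl hθ
  simp only [Complex.ofReal_zero, zero_mul, add_zero] at e0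
  have l1 := intervalIntegral_tendsto_integral_Ioi 0 e0 Filter.tendsto_id
  have l2 := intervalIntegral_tendsto_integral_Ioi 0 (hint θ hθ le_rfl) Filter.tendsto_id
  have l3 := l1.sub l2
  have l4 : Filter.Tendsto (fun R : ℝ => Complex.I * (∫ φ in (0 : ℝ)..θ, F (φ * Complex.I)) -
      Complex.I * ∫ φ in (0 : ℝ)..θ, F (R + φ * Complex.I)) Filter.atTop
      (nhds (Complex.I * (∫ φ in (0 : ℝ)..θ, F (φ * Complex.I)) - Complex.I * 0)) :=
    tendsto_const_nhds.sub (hright.const_mul _)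
  have := tendsto_nhds_unique (l3.congr' (by
    filter_upwards [Filter.eventually_ge_atTop 0] with R hR
    exact hrect R hR)) l4
  rw [mul_zero, sub_zero] at this
  rw [← this]
  ring

/-! ### Rotated rays beyond the camera. -/

namespace WaveParams

variable {w : WaveParams} {t : ℝ} {x x' : Fin 3 → ℝ}

lemma sector_cos_sin {φ : ℝ} (h0 : 0 ≤ φ) (h1 : φ ≤ Real.pi / 6) :
    Sector (Real.cos φ) (Real.sin φ) := by
  have hπ := Real.pi_pos
  refine ⟨by rw [add_comm]; exact Real.sin_sq_add_cos_sq φ,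
    Real.cos_nonneg_of_mem_Icc ⟨by linarith, by linarith⟩,
    Real.sin_nonneg_of_nonneg_of_le_pi h0 (by linarith), ?_⟩
  rw [← Real.cos_two_mul', ← Real.cos_pi_div_three]
  exact Real.cos_le_cos_of_nonneg_of_le_pi (by linarith) (by linarith) (by linarith)

lemma sqDist_ray_re (x : Fin 3 → ℝ) (r c s u v z : ℝ) :
    (sqDist x ((r * (c + s * Complex.I) : ℂ) * u) ((r * (c + s * Complex.I) : ℂ) * v)
      ((r * (c + s * Complex.I) : ℂ) * z)).re =
    (x 0 ^ 2 + x 1 ^ 2 + x 2 ^ 2) - 2 * r * c * (x 0 * u + x 1 * v + x 2 * z)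
      + r ^ 2 * (c ^ 2 - s ^ 2) * (u ^ 2 + v ^ 2 + z ^ 2) := by
  simp only [sqDist, sq, Complex.add_re, Complex.sub_re, Complex.sub_im, Complex.add_im,
    Complex.ofReal_re, Complex.ofReal_im, Complex.mul_re, Complex.mul_im, Complex.I_re,
    Complex.I_im]
  ring

lemma sqDist_ray_im (x : Fin 3 → ℝ) (r c s u v z : ℝ) :
    (sqDist x ((r * (c + s * Complex.I) : ℂ) * u) ((r * (c + s * Complex.I) : ℂ) * v)
      ((r * (c + s * Complex.I) : ℂ) * z)).im =
    2 * r * s * (r * c * (u ^ 2 + v ^ 2 + z ^ 2) - (x 0 * u + x 1 * v + x 2 * z)) := by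
  simp only [sqDist, sq, Complex.add_re, Complex.sub_re, Complex.sub_im, Complex.add_im,
    Complex.ofReal_re, Complex.ofReal_im, Complex.mul_re, Complex.mul_im, Complex.I_re,
    Complex.I_im]
  ring

/-- The particle is at least about eight times as far from the origin as the camera, so
Cauchy–Schwarz gives a constant close to `1 / 8`. -/
lemma Close.inner_le (hw : w.Regime t) (hx : w.Close t x) (u v : ℝ) :
    x 0 * u + x 1 * v + x 2 * (8 * w.Z) ≤ 13 / 100 * (u ^ 2 + v ^ 2 + (8 * w.Z) ^ 2) := by
  have hD := hw.D_pos
  have hZ := hw.Z_pos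
  have ht := hw.t_pos
  have ht4 := hw.t_le
  obtain ⟨h0, h0'⟩ := abs_le.1 hx.zero
  obtain ⟨h1, h1'⟩ := abs_le.1 hx.one
  obtain ⟨h2, h2'⟩ := abs_le.1 hx.two
  have hDZ : w.D ≤ 1 / 10000 * w.Z := hw.D_Z.trans (by gcongr)
  have htD : t * w.D ≤ 1 / 10000 * w.D := by gcongr
  have e0 : x 0 ^ 2 ≤ (w.Z / 100) ^ 2 := sq_le_sq' (by linarith) (by linarith)
  have e1 : x 1 ^ 2 ≤ (w.Z / 100) ^ 2 := sq_le_sq' (by linarith) (by linarith)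
  have e2 : x 2 ^ 2 ≤ (w.Z * (101 / 100)) ^ 2 := sq_le_sq' (by linarith) (by linarith)
  -- The squares give `14 x·y ≤ 49 |x|² + |y|²`; the weight `7` is close to the optimal `|y| / |x| ≈
  -- 8` and suffices.
  linarith [sq_nonneg (7 * x 0 - u), sq_nonneg (7 * x 1 - v), sq_nonneg (7 * x 2 - 8 * w.Z),
    sq_nonneg u, sq_nonneg v, sq_nonneg w.Z]

/-- For `y = (u, v, 8 Z)`, the real part is at least `r² |y|² (1 / 2 - 2 · 13 / 100)` and `(2 / 5)²
< 0.24`. The imaginary part is nonnegative since `r c |y|²` exceeds `x·y`. -/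
lemma sqDist_ray_bounds (hw : w.Regime t) (hx : w.Close t x) {r c s : ℝ} (hE : Sector c s)
    (hr : 1 ≤ r) (u v : ℝ) :
    (2 / 5 * (r * (8 * w.Z))) ^ 2 ≤ (sqDist x ((r * (c + s * Complex.I) : ℂ) * u)
      ((r * (c + s * Complex.I) : ℂ) * v)
      ((r * (c + s * Complex.I) : ℂ) * ((8 * w.Z : ℝ) : ℂ))).re ∧
    0 ≤ (sqDist x ((r * (c + s * Complex.I) : ℂ) * u) ((r * (c + s * Complex.I) : ℂ) * v)
      ((r * (c + s * Complex.I) : ℂ) * ((8 * w.Z : ℝ) : ℂ))).im := by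
  have hZ := hw.Z_pos
  have hi := hx.inner_le hw u v
  have hc := hE.c_ge
  have hc1 := hE.c_le
  have hs := hE.s_nonneg
  rw [sqDist_ray_re, sqDist_ray_im]
  set P := u ^ 2 + v ^ 2 + (8 * w.Z) ^ 2 with hP
  set y := x 0 * u + x 1 * v + x 2 * (8 * w.Z)
  have hP0 : 0 ≤ P := by positivity
  constructor
  · have e1 : r * c * y ≤ r * c * (13 / 100 * P) := by gcongr
    have e2 : r * c * (13 / 100 * P) ≤ r * r * (13 / 100 * P) := by
      gcongr
      linarith
    have e3 : r ^ 2 * (1 / 2) * P ≤ r ^ 2 * (c ^ 2 - s ^ 2) * P := by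
      have := hE.opening
      gcongr
    have e4 : r ^ 2 * (8 * w.Z) ^ 2 ≤ r ^ 2 * P := by
      gcongr
      linarith [sq_nonneg u, sq_nonneg v]
    nlinarith [sq_nonneg (x 0), sq_nonneg (x 1), sq_nonneg (x 2), sq_nonneg (r * (8 * w.Z))]
  · have e1 : 43 / 50 * P ≤ r * c * P := by
      gcongr
      nlinarith
    have : 0 ≤ r * c * P - y := by linarith
    positivity

/-- The decay comes from `exp (i k z)` with `Im z = 8 r s Z`, while the distance factor does not
grow because its imaginary part is nonnegative. The damping decays in `r` and provides integrability
along the ray even for `s = 0`. -/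
lemma norm_wave_ray_le (hw : w.Regime t) (hx : w.Close t x) {r c s : ℝ} (hE : Sector c s)
    (hr : 1 ≤ r) (u v : ℝ) :
    ‖w.wave x ((r * (c + s * Complex.I) : ℂ) * u) ((r * (c + s * Complex.I) : ℂ) * v)
      ((r * (c + s * Complex.I) : ℂ) * ((8 * w.Z : ℝ) : ℂ))‖ ≤
    5 / (r * (8 * w.Z)) * Real.exp (-(w.kd * w.Z * r)) * Real.exp (-(w.k * (r * s * (8 * w.Z)))) *
      Real.exp (-(1 / (4 * w.ro ^ 2) * (u ^ 2 + v ^ 2))) := by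
  have hZ := hw.Z_pos
  obtain ⟨h1, h2⟩ := sqDist_ray_bounds hw hx hE hr u v
  set Q := sqDist x ((r * (c + s * Complex.I) : ℂ) * u) ((r * (c + s * Complex.I) : ℂ) * v)
      ((r * (c + s * Complex.I) : ℂ) * ((8 * w.Z : ℝ) : ℂ)) with hQdef
  have hm : 0 < 2 / 5 * (r * (8 * w.Z)) := by positivity
  have hQ : 0 < Q.re := lt_of_lt_of_le (by positivity) h1
  have hqre := le_cpow_half_re hQ h1
  have hqim : 0 ≤ (Q ^ (1 / 2 : ℂ)).im := by
    have e := cpow_half_two_mul_re_mul_im (Q := Q)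
    by_contra! h
    have := mul_neg_of_pos_of_neg (hm.trans_le hqre) h
    linarith
  have hzim : ((r * (c + s * Complex.I) : ℂ) * ((8 * w.Z : ℝ) : ℂ)).im = r * s * (8 * w.Z) := by
    simp
  have hzre : ((r * (c + s * Complex.I) : ℂ) * ((8 * w.Z : ℝ) : ℂ)).re = r * c * (8 * w.Z) := by
    simp
  have hdiv := hw.div_L (z := 8 * w.Z) ⟨by linarith, le_rfl⟩
  have hg := gauss_exponent_re_ge w hE hr hdiv.1 hdiv.2 u v
  have hβ := norm_beta_ge w (r := r) (z := 8 * w.Z) hE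
  rw [beta] at hβ
  refine (norm_wave_le w hw.k_pos.le (m := 2 / 5 * (r * (8 * w.Z))) (s := r * s * (8 * w.Z))
    (A := -(w.kd * w.Z * r)) (B := 1 / 2) hm h1 (by rw [hzim]; linarith) ?_ (by norm_num) hβ
    hg).trans_eq ?_
  · rw [hzre]
    have e1 : 0 ≤ r * c * (8 * w.Z) := by have := hE.c_nonneg; positivity
    have e2 : w.Z ≤ r * w.Z := le_mul_of_one_le_left hZ.le hr
    have e3 : w.Z - (Q ^ (1 / 2 : ℂ)).re - r * c * (8 * w.Z) ≤ -(w.Z * r) := by linarith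
    have := mul_le_mul_of_nonneg_left e3 hw.kd_pos.le
    linarith
  · have e1 : -w.k * (r * s * (8 * w.Z)) - (u ^ 2 + v ^ 2) / (4 * w.ro ^ 2) =
        -(w.k * (r * s * (8 * w.Z))) + -(1 / (4 * w.ro ^ 2) * (u ^ 2 + v ^ 2)) := by ring
    rw [e1, Real.exp_add]
    field_simp

/-- The wave in logarithmic coordinates along the ray through `(p, 8 Z)`. -/
noncomputable def rayWave (w : WaveParams) (x : Fin 3 → ℝ) (p : ℝ × ℝ) (ω : ℂ) : ℂ :=
  ((8 * w.Z : ℝ) : ℂ) * Complex.exp ω ^ 3 *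
    w.wave x (Complex.exp ω * p.1) (Complex.exp ω * p.2) (Complex.exp ω * ((8 * w.Z : ℝ) : ℂ))

lemma exp_strip (s φ : ℝ) : Complex.exp (s + φ * Complex.I) =
    (Real.exp s : ℂ) * (Real.cos φ + Real.sin φ * Complex.I) := by
  rw [Complex.exp_add, Complex.exp_mul_I]
  push_cast
  rfl

lemma differentiableAt_rayWave (hw : w.Regime t) (hx : w.Close t x) (p : ℝ × ℝ) {s φ : ℝ}
    (hs : 0 ≤ s) (h0 : 0 ≤ φ) (h1 : φ ≤ Real.pi / 6) :
    DifferentiableAt ℂ (w.rayWave x p) (s + φ * Complex.I) := by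
  have hE := sector_cos_sin h0 h1
  have hr : 1 ≤ Real.exp s := Real.one_le_exp hs
  have hZ := hw.Z_pos
  obtain ⟨hQ, -⟩ := sqDist_ray_bounds hw hx hE hr p.1 p.2
  have hβ := norm_beta_ge w (r := Real.exp s) (z := 8 * w.Z) hE
  unfold rayWave
  refine DifferentiableAt.mul (by fun_prop) ?_
  refine differentiableAt_wave_comp (f := fun ω => Complex.exp ω * p.1)
    (g := fun ω => Complex.exp ω * p.2) (h := fun ω => Complex.exp ω * ((8 * w.Z : ℝ) : ℂ))
    (by fun_prop) (by fun_prop) (by fun_prop) ?_ ?_ hw.ro_pos.ne'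
  · rw [exp_strip]
    exact lt_of_lt_of_le (by positivity) hQ
  · rw [exp_strip]
    intro h
    rw [beta, h, norm_zero] at hβ
    norm_num at hβ

lemma norm_rayWave_le (hw : w.Regime t) (hx : w.Close t x) (p : ℝ × ℝ) {s φ : ℝ}
    (hs : 0 ≤ s) (h0 : 0 ≤ φ) (h1 : φ ≤ Real.pi / 6) :
    ‖w.rayWave x p (s + φ * Complex.I)‖ ≤ 5 * Real.exp s ^ 2 *
      Real.exp (-(w.kd * w.Z * Real.exp s)) *
      Real.exp (-(w.k * (Real.exp s * Real.sin φ * (8 * w.Z)))) *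
      Real.exp (-(1 / (4 * w.ro ^ 2) * (p.1 ^ 2 + p.2 ^ 2))) := by
  have hE := sector_cos_sin h0 h1
  have hr : 1 ≤ Real.exp s := Real.one_le_exp hs
  have hZ := hw.Z_pos
  have hn : ‖Complex.exp (s + φ * Complex.I)‖ = Real.exp s := by
    rw [Complex.norm_exp]
    simp
  rw [rayWave, norm_mul, norm_mul, norm_pow, hn, Complex.norm_real,
    Real.norm_of_nonneg (by positivity), exp_strip]
  refine (mul_le_mul_of_nonneg_left (norm_wave_ray_le hw hx hE hr p.1 p.2)
    (by positivity)).trans_eq ?_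
  field_simp

/-- From `exp s ≥ 1 + s`; the condition `m ≥ 3` is what `2 s - m s ≤ -s` requires. -/
lemma exp_sq_mul_exp_neg_le {m s : ℝ} (hm : 3 ≤ m) (hs : 0 ≤ s) :
    Real.exp s ^ 2 * Real.exp (-(m * Real.exp s)) ≤ Real.exp (-m) * Real.exp (-s) := by
  rw [← Real.exp_nat_mul, ← Real.exp_add, ← Real.exp_add]
  apply Real.exp_le_exp.2
  have := Real.add_one_le_exp s
  push_cast
  nlinarith

lemma exists_exp_sq_mul_exp_neg_le {c : ℝ} (hc : 0 < c) :
    ∃ M, 0 ≤ M ∧ ∀ s : ℝ, 0 ≤ s →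
      Real.exp s ^ 2 * Real.exp (-(c * Real.exp s)) ≤ M * Real.exp (-s) := by
  refine ⟨6 / c ^ 3, by positivity, fun s hs => ?_⟩
  have h := Real.pow_div_factorial_le_exp (c * Real.exp s) (by positivity) 3
  have e : ((Nat.factorial 3 : ℕ) : ℝ) = 6 := by norm_num [Nat.factorial]
  rw [e, div_le_iff₀ (by norm_num), mul_pow] at h
  rw [Real.exp_neg, Real.exp_neg, ← div_eq_mul_inv, ← div_eq_mul_inv, div_div,
    div_le_div_iff₀ (Real.exp_pos _) (by positivity)]
  calc _ = c ^ 3 * Real.exp s ^ 3 := by ring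
    _ ≤ _ := h
    _ = _ := by ring

/-- A domination for Fubini's theorem and the contour shift only: `M` depends on `k_d Z` but never
enters the final bounds. -/
lemma exists_norm_rayWave_le (hw : w.Regime t) (hx : w.Close t x) :
    ∃ M, 0 ≤ M ∧ ∀ (p : ℝ × ℝ) (s φ : ℝ), 0 ≤ s → 0 ≤ φ → φ ≤ Real.pi / 6 →
      ‖w.rayWave x p (s + φ * Complex.I)‖ ≤
        M * Real.exp (-(1 / (4 * w.ro ^ 2) * (p.1 ^ 2 + p.2 ^ 2))) * Real.exp (-s) := by
  have hZ := hw.Z_pos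
  have hkd := hw.kd_pos
  have hk := hw.k_pos
  obtain ⟨M, hM, h⟩ := exists_exp_sq_mul_exp_neg_le (mul_pos hkd hZ)
  refine ⟨5 * M, by positivity, fun p s φ hs h0 h1 => (norm_rayWave_le hw hx p hs h0 h1).trans ?_⟩
  have hE := sector_cos_sin h0 h1
  have e : Real.exp (-(w.k * (Real.exp s * Real.sin φ * (8 * w.Z)))) ≤ 1 := by
    rw [Real.exp_le_one_iff]
    have := hE.s_nonneg
    have : 0 ≤ w.k * (Real.exp s * Real.sin φ * (8 * w.Z)) := by positivity
    linarith
  set g := Real.exp (-(1 / (4 * w.ro ^ 2) * (p.1 ^ 2 + p.2 ^ 2)))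
  have hg : 0 ≤ g := (Real.exp_pos _).le
  have h2 := h s hs
  set e2 := Real.exp (-(w.kd * w.Z * Real.exp s))
  calc _ ≤ 5 * Real.exp s ^ 2 * e2 * 1 * g := by gcongr
    _ = 5 * (Real.exp s ^ 2 * e2) * g := by ring
    _ ≤ 5 * (M * Real.exp (-s)) * g := by gcongr
    _ = _ := by ring

/-- The exponentially small quantity that bounds the mean of the wave. -/
noncomputable def gaussTail (w : WaveParams) : ℝ := Real.exp (-(1 / 32 * (w.D / w.ro) ^ 2))

lemma Regime.exp_neg_kZ_le (hw : w.Regime t) : Real.exp (-(w.k * w.Z)) ≤ w.gaussTail := by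
  rw [gaussTail]
  apply Real.exp_le_exp.2
  have h := hw.div_ro_sq_le
  have hD := hw.D_pos
  have hZ := hw.Z_pos
  have hk := hw.k_pos
  have h1 : w.k * w.D ^ 2 / (2 * w.Z) ≤ w.k * w.Z := by
    rw [div_le_iff₀ (by positivity)]
    have := hw.D_le_Z
    have : w.D ^ 2 ≤ w.Z ^ 2 := by gcongr
    nlinarith [mul_le_mul_of_nonneg_left this hk.le, mul_pos hk (pow_pos hZ 2)]
  have h2 : 0 ≤ w.D ^ 2 / w.ro ^ 2 := by positivity
  rw [div_pow]
  linarith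

/-- At `φ = π / 6` the oscillation has become the decay `exp (-4 k Z exp s)`, which absorbs the
Jacobian uniformly in the damping. -/
lemma norm_rayWave_top_le (hw : w.Regime t) (hx : w.Close t x) (p : ℝ × ℝ) {s : ℝ} (hs : 0 ≤ s) :
    ‖w.rayWave x p (s + ((Real.pi / 6 : ℝ) : ℂ) * Complex.I)‖ ≤
      5 * w.gaussTail * Real.exp (-(1 / (4 * w.ro ^ 2) * (p.1 ^ 2 + p.2 ^ 2))) * Real.exp (-s) := by
  have hZ := hw.Z_pos
  have hkd := hw.kd_pos
  have hk := hw.k_pos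
  have hkZ : 3 ≤ w.k * w.Z := by
    have h := hw.div_ro_sq_le
    have hD := hw.D_pos
    have hro := hw.ro_pos
    have h1 : w.k * w.D ^ 2 / (2 * w.Z) ≤ w.k * w.Z := by
      rw [div_le_iff₀ (by positivity)]
      have := hw.D_le_Z
      have : w.D ^ 2 ≤ w.Z ^ 2 := by gcongr
      nlinarith [mul_le_mul_of_nonneg_left this hk.le, mul_pos hk (pow_pos hZ 2)]
    have h2 : 1 ≤ w.D ^ 2 / w.ro ^ 2 := by
      rw [one_le_div (by positivity)]
      have : w.ro ≤ w.D := by nlinarith [hw.ro_D, hw.t_le]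
      gcongr
    linarith
  refine (norm_rayWave_le hw hx p hs (by positivity) le_rfl).trans ?_
  rw [Real.sin_pi_div_six]
  have e : Real.exp (-(w.kd * w.Z * Real.exp s)) ≤ 1 := by
    rw [Real.exp_le_one_iff]
    have : 0 ≤ w.kd * w.Z * Real.exp s := by positivity
    linarith
  have e3 : -(w.k * (Real.exp s * (1 / 2) * (8 * w.Z))) ≤ -(w.k * w.Z * Real.exp s) := by
    have : 0 ≤ w.k * w.Z * Real.exp s := by positivity
    linarith
  have e4 := exp_sq_mul_exp_neg_le hkZ hs
  have e5 := hw.exp_neg_kZ_le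
  set g := Real.exp (-(1 / (4 * w.ro ^ 2) * (p.1 ^ 2 + p.2 ^ 2)))
  have hg : 0 ≤ g := (Real.exp_pos _).le
  calc _ ≤ 5 * Real.exp s ^ 2 * 1 * Real.exp (-(w.k * w.Z * Real.exp s)) * g := by gcongr
    _ = 5 * (Real.exp s ^ 2 * Real.exp (-(w.k * w.Z * Real.exp s))) * g := by ring
    _ ≤ 5 * (Real.exp (-(w.k * w.Z)) * Real.exp (-s)) * g := by gcongr
    _ ≤ 5 * (w.gaussTail * Real.exp (-s)) * g := by gcongr
    _ = _ := by ring

end WaveParams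

lemma exp_neg_mul_abs_le {c : ℝ} (hc : 0 < c) (x : ℝ) :
    Real.exp (-(c * |x|)) ≤ (1 + 2 / c ^ 2) * (1 + x ^ 2)⁻¹ := by
  have h := Real.pow_div_factorial_le_exp (c * |x|) (by positivity) 2
  have h1 : 1 ≤ Real.exp (c * |x|) := Real.one_le_exp (by positivity)
  have e : ((Nat.factorial 2 : ℕ) : ℝ) = 2 := by norm_num
  rw [e, div_le_iff₀ (by norm_num), mul_pow, sq_abs] at h
  rw [Real.exp_neg, ← div_eq_mul_inv, le_div_iff₀ (by positivity), inv_mul_le_iff₀ (Real.exp_pos _)]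
  have h2 : x ^ 2 ≤ 2 / c ^ 2 * Real.exp (c * |x|) := by
    rw [div_mul_eq_mul_div, le_div_iff₀ (by positivity)]
    linarith
  linarith

/-! ### Integrability, and the contribution of far ranges to the mean. -/

namespace WaveParams

variable {w : WaveParams} {t : ℝ} {x x' : Fin 3 → ℝ}

lemma profile_le_one (w : WaveParams) (q : ℝ × ℝ × ℝ) : w.profile q ≤ 1 := by
  rw [profile]
  refine mul_le_one₀ (inv_le_one_of_one_le₀ (by nlinarith [sq_nonneg (q.1 / w.L)]))
    (Real.exp_pos _).le (Real.exp_le_one_iff.2 ?_)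
  have : 0 ≤ 2 / (w.ro ^ 2 * (1 + (q.1 / w.L) ^ 2)) * (q.2.1 ^ 2 + q.2.2 ^ 2) := by positivity
  linarith

lemma norm_cutWave_le_exp (ha : 0 < w.a) (hkd : 0 ≤ w.kd) (x : Fin 3 → ℝ) (q : ℝ × ℝ × ℝ) :
    ‖w.cutWave x q‖ ≤ Real.exp (w.kd * w.Z) / w.a * Real.exp (-(w.kd * rdist x q)) := by
  rw [cutWave]
  split_ifs with h
  · apply le_of_sq_le_sq _ (by positivity)
    rw [norm_wave_real_sq]
    have h1 := profile_le_one w q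
    have hr := ha.trans h.2
    have h0 := profile_nonneg w q
    have h2 : Real.exp (2 * (w.kd * (w.Z - rdist x q - q.1))) ≤
        Real.exp (2 * (w.kd * (w.Z - rdist x q))) := by
      have := mul_nonneg hkd h.1.le
      apply Real.exp_le_exp.2
      linarith
    have h3 : w.a ^ 2 ≤ rdist x q ^ 2 := pow_le_pow_left₀ ha.le h.2.le 2
    calc _ ≤ Real.exp (2 * (w.kd * (w.Z - rdist x q))) / w.a ^ 2 * 1 := by
          gcongr
      _ = _ := by
          rw [mul_one, mul_pow, div_pow, ← Real.exp_nat_mul, ← Real.exp_nat_mul,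
            div_mul_eq_mul_div, ← Real.exp_add]
          congr 2
          push_cast
          ring
  · rw [norm_zero]
    positivity

/-- The distance dominates each coordinate difference, so a third of the exponent is given to each
coordinate and the integrand is dominated by a product. -/
lemma integrable_exp_neg_rdist {c : ℝ} (hc : 0 < c) (x : Fin 3 → ℝ) :
    Integrable (fun q => Real.exp (-(c * rdist x q))) := by
  have hi : ∀ b : ℝ, Integrable (fun z : ℝ => (1 + (b - z) ^ 2)⁻¹) := fun b =>
    integrable_inv_one_add_sq.comp_sub_left b
  have hp := ((hi (x 2)).mul_prod ((hi (x 0)).mul_prod (hi (x 1)))).const_mul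
    ((1 + 2 / (c / 3) ^ 2) ^ 3)
  have hcont := continuous_rdist x
  refine hp.mono' (by fun_prop) (Filter.Eventually.of_forall fun q => ?_)
  rw [Real.norm_of_nonneg (Real.exp_pos _).le]
  have h0 : |x 0 - q.2.1| ≤ rdist x q := Real.abs_le_sqrt (by
    nlinarith [sq_nonneg (x 1 - q.2.2), sq_nonneg (x 2 - q.1)])
  have h1 : |x 1 - q.2.2| ≤ rdist x q := Real.abs_le_sqrt (by
    nlinarith [sq_nonneg (x 0 - q.2.1), sq_nonneg (x 2 - q.1)])
  have h2 : |x 2 - q.1| ≤ rdist x q := Real.abs_le_sqrt (by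
    nlinarith [sq_nonneg (x 0 - q.2.1), sq_nonneg (x 1 - q.2.2)])
  have hc3 : 0 < c / 3 := by positivity
  calc _ ≤ Real.exp (-(c / 3 * |x 2 - q.1|)) * (Real.exp (-(c / 3 * |x 0 - q.2.1|)) *
        Real.exp (-(c / 3 * |x 1 - q.2.2|))) := by
        rw [← Real.exp_add, ← Real.exp_add]
        apply Real.exp_le_exp.2
        nlinarith
    _ ≤ ((1 + 2 / (c / 3) ^ 2) * (1 + (x 2 - q.1) ^ 2)⁻¹) *
        (((1 + 2 / (c / 3) ^ 2) * (1 + (x 0 - q.2.1) ^ 2)⁻¹) *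
          ((1 + 2 / (c / 3) ^ 2) * (1 + (x 1 - q.2.2) ^ 2)⁻¹)) := by
        gcongr <;> exact exp_neg_mul_abs_le hc3 _
    _ = _ := by ring

lemma integrable_cutWave (ha : 0 < w.a) (hkd : 0 < w.kd) (x : Fin 3 → ℝ) :
    Integrable (w.cutWave x) :=
  ((integrable_exp_neg_rdist hkd x).const_mul _).mono'
    (measurable_cutWave w x).aestronglyMeasurable
    (Filter.Eventually.of_forall fun q => norm_cutWave_le_exp ha hkd.le x q)

lemma cutWave_far (hw : w.Regime t) (hx : w.Close t x) {q : ℝ × ℝ × ℝ} (hq : 8 * w.Z < q.1) :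
    w.cutWave x q = w.wave x q.2.1 q.2.2 q.1 := by
  have hD := hw.D_pos
  have hZ := hw.Z_pos
  have h2 := (abs_le.1 hx.two).2
  have hDZ := hw.D_le_Z
  have ht4 := hw.t_le
  have hra : w.a < rdist x q := by
    have h3 : |x 2 - q.1| ≤ rdist x q := Real.abs_le_sqrt (by
      nlinarith [sq_nonneg (x 0 - q.2.1), sq_nonneg (x 1 - q.2.2)])
    have h4 := neg_abs_le (x 2 - q.1)
    have := hw.a_ro
    have := hw.ro_D
    have := hw.ro_pos
    nlinarith
  rw [cutWave, if_pos ⟨by linarith, hra⟩]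

lemma measurable_rayWave (w : WaveParams) (x : Fin 3 → ℝ) :
    Measurable (fun p : (ℝ × ℝ) × ℂ => w.rayWave x p.1 p.2) := by
  unfold rayWave wave sqDist
  fun_prop

/-- Change of variables `(z, p) = exp s · (8 Z, p')`. Beyond `8 Z` the wave has no cut-off, so it
may be continued analytically. -/
lemma integral_cutWave_far_eq (hw : w.Regime t) (hx : w.Close t x) :
    ∫ q in Set.Ioi (8 * w.Z) ×ˢ Set.univ, w.cutWave x q =
      ∫ s in Set.Ioi (0 : ℝ), ∫ p : ℝ × ℝ, w.rayWave x p s := by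
  have hZ := hw.Z_pos
  have h8 : 0 < 8 * w.Z := by positivity
  rw [Measure.volume_eq_prod, setIntegral_prod _
    (integrable_cutWave hw.a_pos hw.kd_pos x).integrableOn]
  have himg : (fun s => 8 * w.Z * Real.exp s) '' Set.Ioi 0 = Set.Ioi (8 * w.Z) := by
    ext z
    simp only [Set.mem_image, Set.mem_Ioi]
    constructor
    · rintro ⟨s, hs, rfl⟩
      have := Real.one_lt_exp_iff.2 hs
      nlinarith
    · intro hz
      have h1 : 1 < z / (8 * w.Z) := (one_lt_div h8).2 hz
      refine ⟨Real.log (z / (8 * w.Z)), Real.log_pos h1, ?_⟩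
      rw [Real.exp_log (by linarith)]
      field_simp
  rw [← himg, integral_image_eq_integral_abs_deriv_smul measurableSet_Ioi
    (f' := fun s => 8 * w.Z * Real.exp s)
    (fun s _ => ((Real.hasDerivAt_exp s).const_mul _).hasDerivWithinAt)
    (fun s _ s' _ h => Real.exp_injective (mul_left_cancel₀ h8.ne' h))]
  refine setIntegral_congr_fun measurableSet_Ioi fun s hs => ?_
  have hs1 : 8 * w.Z < 8 * w.Z * Real.exp s := by
    have := Real.one_lt_exp_iff.2 (Set.mem_Ioi.1 hs)
    nlinarith
  simp only [Measure.restrict_univ]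
  have h1 : ∀ p : ℝ × ℝ, w.cutWave x (8 * w.Z * Real.exp s, p) =
      w.wave x p.1 p.2 ((8 * w.Z * Real.exp s : ℝ) : ℂ) := fun p =>
    cutWave_far hw hx (q := (8 * w.Z * Real.exp s, p)) hs1
  simp_rw [h1]
  -- One factor `exp s` is the Jacobian in range, and the other two compensate the dilation of the
  -- cross-range plane.
  have h2 : ∀ p : ℝ × ℝ, w.rayWave x p s = (((8 * w.Z) * Real.exp s ^ 3 : ℝ) : ℂ) *
      (fun p : ℝ × ℝ => w.wave x p.1 p.2 ((8 * w.Z * Real.exp s : ℝ) : ℂ)) (Real.exp s • p) := by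
    intro p
    simp only [rayWave, Prod.smul_fst, Prod.smul_snd, smul_eq_mul]
    push_cast
    rw [mul_comm (Complex.exp s) (8 * w.Z)]
  rw [integral_congr_ae (Filter.Eventually.of_forall h2), integral_const_mul,
    Measure.integral_comp_smul volume
      (fun p : ℝ × ℝ => w.wave x p.1 p.2 ((8 * w.Z * Real.exp s : ℝ) : ℂ)) (Real.exp s)]
  have hf : Module.finrank ℝ (ℝ × ℝ) = 2 := by simp
  have hes := Real.exp_pos s
  rw [hf, abs_of_pos (by positivity), abs_of_pos (by positivity), Complex.real_smul,
    Complex.real_smul, ← mul_assoc, ← Complex.ofReal_mul]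
  congr 2
  field_simp

/-- For each `p` the ray integral is moved to the top edge of the half-strip of height `π / 6`,
where it is exponentially small. After Fubini the left edge is an integral over `φ` of cross-range
integrals bounded by `K`, over a length less than `1`. -/
lemma norm_integral_far_le (hw : w.Regime t) (hx : w.Close t x) {K : ℝ} (hK : 0 ≤ K)
    (hleft : ∀ φ : ℝ, 0 ≤ φ → φ ≤ Real.pi / 6 →
      ‖∫ p : ℝ × ℝ, w.rayWave x p (φ * Complex.I)‖ ≤ K) :
    ‖∫ q in Set.Ioi (8 * w.Z) ×ˢ Set.univ, w.cutWave x q‖ ≤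
      20 * Real.pi * w.ro ^ 2 * w.gaussTail + K := by
  have hro := hw.ro_pos
  obtain ⟨M, hM0, hM⟩ := exists_norm_rayWave_le hw hx
  have hπ := Real.pi_pos
  have hπ4 := Real.pi_le_four
  set g : ℝ × ℝ → ℝ := fun p => Real.exp (-(1 / (4 * w.ro ^ 2) * (p.1 ^ 2 + p.2 ^ 2))) with hg
  have hgi : Integrable g := integrable_gaussian_prod (by positivity)
  have hgv : ∫ p, g p = 4 * Real.pi * w.ro ^ 2 := by
    rw [hg, integral_gaussian_prod (by positivity)]
    field_simp
  have hmeas := measurable_rayWave w x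
  have hrow : ∀ φ : ℝ, 0 ≤ φ → φ ≤ Real.pi / 6 →
      Integrable (fun q : (ℝ × ℝ) × ℝ => w.rayWave x q.1 (q.2 + φ * Complex.I))
        ((volume : Measure (ℝ × ℝ)).prod ((volume : Measure ℝ).restrict (Set.Ioi 0))) := by
    intro φ h0 h1
    have hi : IntegrableOn (fun s : ℝ => Real.exp (-s)) (Set.Ioi 0) :=
      (exp_neg_integrableOn_Ioi 0 one_pos).congr (Filter.Eventually.of_forall fun s => by simp)
    have hb : Integrable (fun q : (ℝ × ℝ) × ℝ => (M * g q.1) * Real.exp (-q.2))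
        ((volume : Measure (ℝ × ℝ)).prod ((volume : Measure ℝ).restrict (Set.Ioi 0))) :=
      (hgi.const_mul M).mul_prod hi
    refine hb.mono' ?_ ?_
    · exact (hmeas.comp (measurable_fst.prodMk ((Complex.measurable_ofReal.comp
        measurable_snd).add_const _))).aestronglyMeasurable
    · have h2 : (volume : Measure (ℝ × ℝ)).prod ((volume : Measure ℝ).restrict (Set.Ioi 0)) =
          ((volume : Measure (ℝ × ℝ)).prod (volume : Measure ℝ)).restrict
            (Set.univ ×ˢ Set.Ioi 0) := by
        rw [← Measure.prod_restrict, Measure.restrict_univ]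
      rw [h2]
      refine (ae_restrict_mem (MeasurableSet.univ.prod measurableSet_Ioi)).mono fun q hq => ?_
      exact hM q.1 q.2 φ (le_of_lt hq.2) h0 h1
  have hcol : Integrable (fun q : (ℝ × ℝ) × ℝ => w.rayWave x q.1 (q.2 * Complex.I))
        ((volume : Measure (ℝ × ℝ)).prod
          ((volume : Measure ℝ).restrict (Set.Ioc 0 (Real.pi / 6)))) := by
    have hb : Integrable (fun q : (ℝ × ℝ) × ℝ => (M * g q.1) * 1)
        ((volume : Measure (ℝ × ℝ)).prod
          ((volume : Measure ℝ).restrict (Set.Ioc 0 (Real.pi / 6)))) :=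
      (hgi.const_mul M).mul_prod (integrable_const (1 : ℝ))
    refine hb.mono' ?_ ?_
    · exact (hmeas.comp (measurable_fst.prodMk ((Complex.measurable_ofReal.comp
        measurable_snd).mul_const _))).aestronglyMeasurable
    · have h2 : (volume : Measure (ℝ × ℝ)).prod
          ((volume : Measure ℝ).restrict (Set.Ioc 0 (Real.pi / 6))) =
          ((volume : Measure (ℝ × ℝ)).prod (volume : Measure ℝ)).restrict
            (Set.univ ×ˢ Set.Ioc 0 (Real.pi / 6)) := by
        rw [← Measure.prod_restrict, Measure.restrict_univ]
      rw [h2]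
      refine (ae_restrict_mem (MeasurableSet.univ.prod measurableSet_Ioc)).mono fun q hq => ?_
      have := hM q.1 0 q.2 le_rfl hq.2.1.le hq.2.2
      rwa [neg_zero, Real.exp_zero, Complex.ofReal_zero, zero_add] at this
  have hray : ∀ p : ℝ × ℝ, ∫ s in Set.Ioi (0 : ℝ), w.rayWave x p s =
      (∫ s in Set.Ioi (0 : ℝ), w.rayWave x p (s + ((Real.pi / 6 : ℝ) : ℂ) * Complex.I)) +
      Complex.I * ∫ φ in Set.Ioc (0 : ℝ) (Real.pi / 6), w.rayWave x p (φ * Complex.I) := by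
    intro p
    rw [integral_Ioi_eq_of_halfStrip (F := w.rayWave x p) (θ := Real.pi / 6) (M := M * g p)
      (by positivity) (fun s φ hs h0 h1 => differentiableAt_rayWave hw hx p hs h0 h1)
      (fun s φ hs h0 h1 => hM p s φ hs h0 h1), intervalIntegral.integral_of_le (by positivity)]
  have hswap : ∫ s in Set.Ioi (0 : ℝ), ∫ p : ℝ × ℝ, w.rayWave x p s =
      ∫ p : ℝ × ℝ, ∫ s in Set.Ioi (0 : ℝ), w.rayWave x p s := by
    rw [integral_integral_swap]
    have := (hrow 0 le_rfl (by positivity)).swap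
    refine this.congr (Filter.Eventually.of_forall fun q => ?_)
    simp [Function.uncurry]
  rw [integral_cutWave_far_eq hw hx, hswap]
  simp_rw [hray]
  rw [integral_add (hrow _ (by positivity) le_rfl).integral_prod_left
    (hcol.integral_prod_left.const_mul _), integral_const_mul]
  refine (norm_add_le _ _).trans (add_le_add ?_ ?_)
  · have h1 : ∀ p : ℝ × ℝ,
        ‖∫ s in Set.Ioi (0 : ℝ), w.rayWave x p (s + ((Real.pi / 6 : ℝ) : ℂ) * Complex.I)‖ ≤
        5 * w.gaussTail * g p := by
      intro p
      have hi : IntegrableOn (fun s : ℝ => Real.exp (-s)) (Set.Ioi 0) :=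
        (exp_neg_integrableOn_Ioi 0 one_pos).congr
          (Filter.Eventually.of_forall fun s => by simp)
      refine (norm_integral_le_of_norm_le (hi.const_mul (5 * w.gaussTail * g p)) ?_).trans_eq ?_
      · refine (ae_restrict_mem measurableSet_Ioi).mono fun s hs => ?_
        exact norm_rayWave_top_le hw hx p (le_of_lt hs)
      · rw [integral_const_mul, integral_exp_neg_Ioi_zero, mul_one]
    refine (norm_integral_le_of_norm_le (hgi.const_mul _)
      (Filter.Eventually.of_forall h1)).trans_eq ?_
    rw [integral_const_mul, hgv]
    ring
  · rw [norm_mul, Complex.norm_I, one_mul, integral_integral_swap hcol,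
      ← intervalIntegral.integral_of_le (by positivity)]
    refine (intervalIntegral.norm_integral_le_of_norm_le_const (C := K) fun φ hφ => ?_).trans ?_
    · rw [Set.uIoc_of_le (by positivity)] at hφ
      exact hleft φ hφ.1.le hφ.2
    · rw [sub_zero, abs_of_pos (by positivity)]
      nlinarith

end WaveParams

/-! ### The mean of the wave. -/

namespace WaveParams

variable {w : WaveParams} {t : ℝ} {x x' : Fin 3 → ℝ}

lemma sq_le_of_notMem_box {d : ℝ} (hd : 0 ≤ d) {p : ℝ × ℝ} (hp : p ∉ box d) :
    d ^ 2 ≤ p.1 ^ 2 + p.2 ^ 2 := by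
  rw [mem_box, not_and_or, not_le, not_le] at hp
  rcases hp with h | h
  · have := pow_le_pow_left₀ hd h.le 2
    rw [sq_abs] at this
    nlinarith [sq_nonneg p.2]
  · have := pow_le_pow_left₀ hd h.le 2
    rw [sq_abs] at this
    nlinarith [sq_nonneg p.1]

/-- Half of the weakest exponent, `1 / (8 r_o²)`, is spent on `|p| ≥ D / 2`; this is the origin of
the constant `1 / 32` in `gaussTail`. -/
lemma gaussian_le_of_notMem_box (hw : w.Regime t) {b : ℝ} (hb : 1 / 4 ≤ b) {p : ℝ × ℝ}
    (hp : p ∉ box (w.D / 2)) :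
    Real.exp (-(b / w.ro ^ 2 * (p.1 ^ 2 + p.2 ^ 2))) ≤
      w.gaussTail * Real.exp (-(1 / (8 * w.ro ^ 2) * (p.1 ^ 2 + p.2 ^ 2))) := by
  have hD := hw.D_pos
  have hro := hw.ro_pos
  have h := sq_le_of_notMem_box (by positivity) hp
  rw [gaussTail, ← Real.exp_add]
  apply Real.exp_le_exp.2
  have h1 := mul_le_mul_of_nonneg_left h (by positivity : 0 ≤ 1 / (8 * w.ro ^ 2))
  have e1 : 1 / 32 * (w.D / w.ro) ^ 2 = 1 / (8 * w.ro ^ 2) * (w.D / 2) ^ 2 := by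
    field_simp
    norm_num
  have e2 : 1 / 4 / w.ro ^ 2 * (p.1 ^ 2 + p.2 ^ 2) ≤ b / w.ro ^ 2 * (p.1 ^ 2 + p.2 ^ 2) := by
    gcongr
  have e3 : 1 / 4 / w.ro ^ 2 * (p.1 ^ 2 + p.2 ^ 2) =
      2 * (1 / (8 * w.ro ^ 2) * (p.1 ^ 2 + p.2 ^ 2)) := by
    field_simp
    ring
  linarith

lemma integrable_and_integral_gaussian_eighth (hw : w.Regime t) :
    Integrable (fun p : ℝ × ℝ => Real.exp (-(1 / (8 * w.ro ^ 2) * (p.1 ^ 2 + p.2 ^ 2)))) ∧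
    ∫ p : ℝ × ℝ, Real.exp (-(1 / (8 * w.ro ^ 2) * (p.1 ^ 2 + p.2 ^ 2))) =
      8 * Real.pi * w.ro ^ 2 := by
  have hro := hw.ro_pos
  refine ⟨integrable_gaussian_prod (by positivity), ?_⟩
  rw [integral_gaussian_prod (by positivity)]
  field_simp

lemma Regime.edgeBound_le (hw : w.Regime t) : w.edgeBound ≤ 24 / w.D * w.gaussTail := by
  have hD := hw.D_pos
  have hro := hw.ro_pos
  rw [edgeBound, gaussTail]
  gcongr
  rw [div_pow, ← div_div]
  have : 0 ≤ w.D ^ 2 / w.ro ^ 2 := by positivity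
  have e : w.D ^ 2 / 20 / w.ro ^ 2 = 1 / 20 * (w.D ^ 2 / w.ro ^ 2) := by ring
  rw [e]
  linarith

lemma gaussTail_nonneg (w : WaveParams) : 0 ≤ w.gaussTail := (Real.exp_pos _).le

/-- On the rotated plane through range `8 Z`, the cross-range shift handles the box, and the
Gaussian decay handles its complement. -/
lemma norm_integral_rayWave_left_le (hw : w.Regime t) (hx : w.Close t x) {φ : ℝ} (h0 : 0 ≤ φ)
    (h1 : φ ≤ Real.pi / 6) :
    ‖∫ p : ℝ × ℝ, w.rayWave x p (φ * Complex.I)‖ ≤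
      (384 * w.Z * w.D + 40 * Real.pi * w.ro ^ 2) * w.gaussTail := by
  have hD := hw.D_pos
  have hZ := hw.Z_pos
  have hro := hw.ro_pos
  have hE := sector_cos_sin h0 h1
  have hT := gaussTail_nonneg w
  obtain ⟨hgi, hgv⟩ := integrable_and_integral_gaussian_eighth hw
  have hb : ∀ p : ℝ × ℝ, ‖w.rayWave x p (φ * Complex.I)‖ ≤
      5 * Real.exp (-(1 / 4 / w.ro ^ 2 * (p.1 ^ 2 + p.2 ^ 2))) := by
    intro p
    have h := norm_rayWave_le hw hx p le_rfl h0 h1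
    rw [Complex.ofReal_zero, zero_add, Real.exp_zero] at h
    refine h.trans ?_
    have e1 : Real.exp (-(w.kd * w.Z * 1)) ≤ 1 := by
      rw [Real.exp_le_one_iff]
      have := mul_pos hw.kd_pos hZ
      linarith
    have e2 : Real.exp (-(w.k * (1 * Real.sin φ * (8 * w.Z)))) ≤ 1 := by
      rw [Real.exp_le_one_iff]
      have := hw.k_pos
      have := hE.s_nonneg
      have : 0 ≤ w.k * (1 * Real.sin φ * (8 * w.Z)) := by positivity
      linarith
    rw [div_div]
    calc _ ≤ 5 * 1 ^ 2 * 1 * 1 * Real.exp (-(1 / (4 * w.ro ^ 2) * (p.1 ^ 2 + p.2 ^ 2))) := by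
          gcongr
      _ = _ := by ring
  have hint : Integrable (fun p : ℝ × ℝ => w.rayWave x p (φ * Complex.I)) :=
    ((integrable_gaussian_prod (b := 1 / 4 / w.ro ^ 2) (by positivity)).const_mul 5).mono'
      ((measurable_rayWave w x).comp (measurable_id.prodMk measurable_const)).aestronglyMeasurable
      (Filter.Eventually.of_forall hb)
  rw [← integral_add_compl (measurableSet_box (w.D / 2)) hint]
  have hbox : ‖∫ p in box (w.D / 2), w.rayWave x p (φ * Complex.I)‖ ≤
      384 * w.Z * w.D * w.gaussTail := by
    have e : ∀ p : ℝ × ℝ, w.rayWave x p (φ * Complex.I) =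
        (((8 * w.Z : ℝ) : ℂ) * Complex.exp (φ * Complex.I) ^ 3) *
        w.wave x ((Real.cos φ + Real.sin φ * Complex.I) * p.1)
          ((Real.cos φ + Real.sin φ * Complex.I) * p.2)
          ((Real.cos φ + Real.sin φ * Complex.I) * ((8 * w.Z : ℝ) : ℂ)) := by
      intro p
      have := exp_strip 0 φ
      rw [Complex.ofReal_zero, zero_add, Real.exp_zero, Complex.ofReal_one, one_mul] at this
      rw [rayWave, this]
    simp_rw [e]
    rw [integral_const_mul, norm_mul, norm_mul, norm_pow, Complex.norm_exp_ofReal_mul_I, one_pow,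
      mul_one, Complex.norm_real, Real.norm_of_nonneg (by positivity)]
    calc _ ≤ 8 * w.Z * (2 * w.D ^ 2 * w.edgeBound) := by
          gcongr
          exact norm_integral_wave_box_le hw hx ⟨hE, Or.inr rfl⟩
      _ ≤ 8 * w.Z * (2 * w.D ^ 2 * (24 / w.D * w.gaussTail)) := by
          gcongr
          exact hw.edgeBound_le
      _ = _ := by field_simp; ring
  have hout : ‖∫ p in (box (w.D / 2))ᶜ, w.rayWave x p (φ * Complex.I)‖ ≤
      40 * Real.pi * w.ro ^ 2 * w.gaussTail := by
    calc _ ≤ ∫ p in (box (w.D / 2))ᶜ, 5 * w.gaussTail *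
          Real.exp (-(1 / (8 * w.ro ^ 2) * (p.1 ^ 2 + p.2 ^ 2))) := by
          refine norm_integral_le_of_norm_le (hgi.integrableOn.const_mul _)
            ((ae_restrict_mem (measurableSet_box _).compl).mono fun p hp => ?_)
          rw [mul_assoc]
          exact (hb p).trans (mul_le_mul_of_nonneg_left
            (gaussian_le_of_notMem_box hw le_rfl hp) (by norm_num))
      _ ≤ ∫ p : ℝ × ℝ, 5 * w.gaussTail *
          Real.exp (-(1 / (8 * w.ro ^ 2) * (p.1 ^ 2 + p.2 ^ 2))) :=
          setIntegral_le_integral (hgi.const_mul _)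
            (Filter.Eventually.of_forall fun p => by positivity)
      _ = _ := by
          rw [integral_const_mul, hgv]
          ring
  refine (norm_add_le _ _).trans ((add_le_add hbox hout).trans_eq (by ring))

lemma cutWave_box (hw : w.Regime t) (hx : w.Close t x) {q : ℝ × ℝ × ℝ} (hz : 0 < q.1)
    (hq : q.2 ∈ box (w.D / 2)) : w.cutWave x q = w.wave x q.2.1 q.2.2 q.1 := by
  have hD := hw.D_pos
  have h0 := (abs_le.1 hx.zero).1
  have h1 := (abs_le.1 (mem_box.1 hq).1).2
  have h3 : |x 0 - q.2.1| ≤ rdist x q := Real.abs_le_sqrt (by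
    nlinarith [sq_nonneg (x 1 - q.2.2), sq_nonneg (x 2 - q.1)])
  have h4 := le_abs_self (x 0 - q.2.1)
  have h5 : w.a ≤ w.D / 10000 := by
    have := hw.a_ro
    have := hw.ro_D
    have := hw.ro_pos
    have := hw.t_le
    have := hw.t_pos
    nlinarith
  have h6 : t * w.D ≤ 1 / 10000 * w.D := mul_le_mul_of_nonneg_right hw.t_le hD.le
  rw [cutWave, if_pos ⟨hz, by linarith⟩]

lemma norm_integral_cutWave_box_le (hw : w.Regime t) (hx : w.Close t x) {z : ℝ}
    (hz : z ≤ 8 * w.Z) :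
    ‖∫ p in box (w.D / 2), w.cutWave x (z, p)‖ ≤ (Set.Icc 0 (8 * w.Z)).indicator
      (fun _ => 2 * w.D ^ 2 * w.edgeBound) z := by
  by_cases h : 0 < z
  · rw [setIntegral_congr_fun (measurableSet_box _)
      (fun p hp => cutWave_box hw hx (q := (z, p)) h hp),
      Set.indicator_of_mem (show z ∈ Set.Icc 0 (8 * w.Z) from ⟨h.le, hz⟩)]
    have hE : w.Admissible 1 0 z := ⟨⟨by norm_num, by norm_num, le_rfl, by norm_num⟩,
      Or.inl ⟨rfl, h, hz⟩⟩
    simpa using norm_integral_wave_box_le hw hx hE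
  · have e : ∀ p : ℝ × ℝ, w.cutWave x (z, p) = 0 := fun p => if_neg fun h' => h h'.1
    simp_rw [e]
    rw [integral_zero, norm_zero]
    exact Set.indicator_nonneg (fun _ _ => by
      have := hw.edgeBound_nonneg
      positivity) _

lemma core_eq_prod (w : WaveParams) : w.core (1 / 2) = Set.Iic (8 * w.Z) ×ˢ box (w.D / 2) := by
  ext q
  simp only [core, Set.mem_ofPred_eq, Set.mem_prod, Set.mem_Iic]
  rw [one_div_mul_eq_div]

lemma norm_integral_cutWave_core_le (hw : w.Regime t) (hx : w.Close t x) :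
    ‖∫ q in w.core (1 / 2), w.cutWave x q‖ ≤ 8 * w.Z * (2 * w.D ^ 2 * w.edgeBound) := by
  have hZ := hw.Z_pos
  rw [core_eq_prod, Measure.volume_eq_prod, setIntegral_prod _
    (integrable_cutWave hw.a_pos hw.kd_pos x).integrableOn]
  have hi : Integrable ((Set.Icc 0 (8 * w.Z)).indicator
      (fun _ => 2 * w.D ^ 2 * w.edgeBound)) := by
    rw [integrable_indicator_iff measurableSet_Icc]
    exact integrableOn_const measure_Icc_lt_top.ne
  calc _ ≤ ∫ z in Set.Iic (8 * w.Z), (Set.Icc 0 (8 * w.Z)).indicator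
        (fun _ => 2 * w.D ^ 2 * w.edgeBound) z :=
        norm_integral_le_of_norm_le hi.integrableOn
          ((ae_restrict_mem measurableSet_Iic).mono fun z hz =>
            norm_integral_cutWave_box_le hw hx hz)
    _ ≤ ∫ z, (Set.Icc 0 (8 * w.Z)).indicator (fun _ => 2 * w.D ^ 2 * w.edgeBound) z :=
        setIntegral_le_integral hi (Filter.Eventually.of_forall fun z =>
          Set.indicator_nonneg (fun _ _ => by
            have := hw.edgeBound_nonneg
            positivity) _)
    _ = _ := by
        rw [integral_indicator measurableSet_Icc, setIntegral_const]
        simp [hZ.le]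

lemma norm_cutWave_near_le (hw : w.Regime t) (hx : w.Close t x) {q : ℝ × ℝ × ℝ}
    (hz : q.1 ≤ 8 * w.Z) (hq : q.2 ∉ box (w.D / 2)) :
    ‖w.cutWave x q‖ ≤ (Set.Icc 0 (8 * w.Z)).indicator (fun _ => 2 / w.a * w.gaussTail) q.1 *
      Real.exp (-(1 / (8 * w.ro ^ 2) * (q.2.1 ^ 2 + q.2.2 ^ 2))) := by
  have ha := hw.a_pos
  have hro := hw.ro_pos
  have hT := gaussTail_nonneg w
  by_cases h : 0 < q.1
  · rw [Set.indicator_of_mem (show q.1 ∈ Set.Icc 0 (8 * w.Z) from ⟨h.le, hz⟩), mul_assoc]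
    refine le_trans ?_ (mul_le_mul_of_nonneg_left
      (gaussian_le_of_notMem_box hw (b := 1 / 2) (by norm_num) hq) (by positivity))
    apply le_of_sq_le_sq _ (by positivity)
    refine (norm_cutWave_sq_le_a hw hx q).trans ?_
    have hdiv := hw.div_L ⟨h, hz⟩
    have hs1 : 1 ≤ 1 + (q.1 / w.L) ^ 2 := by nlinarith [sq_nonneg (q.1 / w.L)]
    have hs2 : 1 + (q.1 / w.L) ^ 2 ≤ 2 := by nlinarith
    have hp1 : w.profile q ≤ Real.exp (-(1 / 2 / w.ro ^ 2 * (q.2.1 ^ 2 + q.2.2 ^ 2))) ^ 2 := by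
      rw [profile, ← Real.exp_nat_mul]
      have e1 : 1 / w.ro ^ 2 ≤ 2 / (w.ro ^ 2 * (1 + (q.1 / w.L) ^ 2)) := by
        rw [div_le_div_iff₀ (by positivity) (by positivity)]
        nlinarith [mul_le_mul_of_nonneg_left hs2 (sq_nonneg w.ro)]
      calc _ ≤ 1 * Real.exp (-(1 / w.ro ^ 2 * (q.2.1 ^ 2 + q.2.2 ^ 2))) := by
            gcongr
            exact inv_le_one_of_one_le₀ hs1
        _ = _ := by
            rw [one_mul]
            congr 1
            push_cast
            ring
    have het : Real.exp (2 * t) ≤ 2 ^ 2 := by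
      have h1 : Real.exp (2 * t) ≤ Real.exp 1 := Real.exp_le_exp.2 (by linarith [hw.t_le])
      have := Real.exp_one_lt_d9
      linarith
    rw [mul_pow, div_pow]
    have := profile_nonneg w q
    gcongr
  · rw [cutWave, if_neg (fun h' => h h'.1), norm_zero]
    exact mul_nonneg (Set.indicator_nonneg (fun _ _ => by positivity) _) (Real.exp_pos _).le

lemma norm_integral_cutWave_near_le (hw : w.Regime t) (hx : w.Close t x) :
    ‖∫ q in Set.Iic (8 * w.Z) ×ˢ (box (w.D / 2))ᶜ, w.cutWave x q‖ ≤
      128 * Real.pi * w.Z * w.ro ^ 2 / w.a * w.gaussTail := by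
  have hZ := hw.Z_pos
  have ha := hw.a_pos
  have hT := gaussTail_nonneg w
  obtain ⟨hgi, hgv⟩ := integrable_and_integral_gaussian_eighth hw
  have hi : Integrable ((Set.Icc 0 (8 * w.Z)).indicator
      (fun _ => 2 / w.a * w.gaussTail)) := by
    rw [integrable_indicator_iff measurableSet_Icc]
    exact integrableOn_const measure_Icc_lt_top.ne
  have hp := hi.mul_prod hgi
  calc _ ≤ ∫ q in Set.Iic (8 * w.Z) ×ˢ (box (w.D / 2))ᶜ,
        (Set.Icc 0 (8 * w.Z)).indicator (fun _ => 2 / w.a * w.gaussTail) q.1 *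
        Real.exp (-(1 / (8 * w.ro ^ 2) * (q.2.1 ^ 2 + q.2.2 ^ 2))) :=
        norm_integral_le_of_norm_le hp.integrableOn
          ((ae_restrict_mem (measurableSet_Iic.prod (measurableSet_box _).compl)).mono
            fun q hq => norm_cutWave_near_le hw hx hq.1 hq.2)
    _ ≤ ∫ q : ℝ × ℝ × ℝ,
        (Set.Icc 0 (8 * w.Z)).indicator (fun _ => 2 / w.a * w.gaussTail) q.1 *
        Real.exp (-(1 / (8 * w.ro ^ 2) * (q.2.1 ^ 2 + q.2.2 ^ 2))) :=
        setIntegral_le_integral hp (Filter.Eventually.of_forall fun q =>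
          mul_nonneg (Set.indicator_nonneg (fun _ _ => by positivity) _) (Real.exp_pos _).le)
    _ = _ := by
        rw [Measure.volume_eq_prod, integral_prod_mul
          (f := (Set.Icc 0 (8 * w.Z)).indicator (fun _ => 2 / w.a * w.gaussTail))
          (g := fun p : ℝ × ℝ => Real.exp (-(1 / (8 * w.ro ^ 2) * (p.1 ^ 2 + p.2 ^ 2)))), hgv,
          integral_indicator measurableSet_Icc, setIntegral_const]
        simp only [Real.volume_real_Icc, sub_zero, smul_eq_mul]
        rw [max_eq_left (by positivity)]
        ring

/-- The mean of the wave is exponentially small. -/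
lemma norm_integral_cutWave_le (hw : w.Regime t) (hx : w.Close t x) :
    ‖∫ q, w.cutWave x q‖ ≤ 2000 * t * w.a ^ 3 / w.D := by
  have hZ := hw.Z_pos
  have ha := hw.a_pos
  have hD := hw.D_pos
  have hro := hw.ro_pos
  have ht := hw.t_pos
  have hT := gaussTail_nonneg w
  have hDZ := hw.D_le_Z
  have hroD : w.ro ≤ w.D := by nlinarith [hw.ro_D, hw.t_le]
  have haro : w.a ≤ w.ro := by nlinarith [hw.a_ro, hw.t_le]
  have haZ : w.a ≤ w.Z := haro.trans (hroD.trans hDZ)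
  have hint := integrable_cutWave hw.a_pos hw.kd_pos x
  have hπ := Real.pi_le_four
  have hπ0 := Real.pi_pos
  -- Three regions: far ranges (rotation of rays), the box around the axis (cross-range shift), and
  -- the off-axis part at ranges up to `8 Z` (absolute bound by the Gaussian tail).
  have hsplit : ∫ q, w.cutWave x q = (∫ q in Set.Ioi (8 * w.Z) ×ˢ Set.univ, w.cutWave x q) +
      ((∫ q in w.core (1 / 2), w.cutWave x q) +
        ∫ q in Set.Iic (8 * w.Z) ×ˢ (box (w.D / 2))ᶜ, w.cutWave x q) := by
    rw [← integral_add_compl (measurableSet_Ioi.prod MeasurableSet.univ) hint, core_eq_prod]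
    congr 1
    rw [← setIntegral_union ?_ (measurableSet_Iic.prod (measurableSet_box _).compl)
      hint.integrableOn hint.integrableOn]
    · congr 2
      ext q
      simp only [Set.mem_compl_iff, Set.mem_prod, Set.mem_Ioi, Set.mem_univ, and_true, not_lt,
        Set.mem_union, Set.mem_Iic]
      tauto
    · rw [Set.disjoint_left]
      rintro q ⟨_, h⟩ ⟨_, h'⟩
      exact h' h
  have h1 := norm_integral_far_le hw hx (K := (384 * w.Z * w.D + 40 * Real.pi * w.ro ^ 2) *
    w.gaussTail) (by positivity) fun φ h0 h1 => norm_integral_rayWave_left_le hw hx h0 h1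
  have h2 := norm_integral_cutWave_core_le hw hx
  have h3 := norm_integral_cutWave_near_le hw hx
  have h2' : 8 * w.Z * (2 * w.D ^ 2 * w.edgeBound) ≤ 384 * w.Z * w.D * w.gaussTail := by
    calc _ ≤ 8 * w.Z * (2 * w.D ^ 2 * (24 / w.D * w.gaussTail)) := by
          gcongr
          exact hw.edgeBound_le
      _ = _ := by field_simp; ring
  have hU : ‖∫ q, w.cutWave x q‖ ≤ 2000 * (w.Z ^ 3 / w.a) * w.gaussTail := by
    rw [hsplit]
    refine (norm_add_le _ _).trans ((add_le_add h1 ((norm_add_le _ _).trans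
      (add_le_add (h2.trans h2') h3))).trans ?_)
    have hZ3 : w.Z ^ 2 ≤ w.Z ^ 3 / w.a := by
      rw [le_div_iff₀ ha, pow_succ w.Z 2]
      gcongr
    have e1 : w.ro ^ 2 ≤ w.Z ^ 3 / w.a := by
      refine le_trans ?_ hZ3
      have := hroD.trans hDZ
      gcongr
    have e2 : w.Z * w.D ≤ w.Z ^ 3 / w.a := by
      refine le_trans ?_ hZ3
      rw [sq]
      gcongr
    have e3 : w.Z * w.ro ^ 2 / w.a ≤ w.Z ^ 3 / w.a := by
      have := hroD.trans hDZ
      calc w.Z * w.ro ^ 2 / w.a ≤ w.Z * w.Z ^ 2 / w.a := by gcongr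
        _ = _ := by ring
    have hV : 0 ≤ w.Z ^ 3 / w.a := by positivity
    set V := w.Z ^ 3 / w.a
    have e4 : Real.pi * w.ro ^ 2 ≤ 4 * V := by gcongr
    have e5 : Real.pi * (w.Z * w.ro ^ 2 / w.a) ≤ 4 * V := by gcongr
    have e6 : 20 * (Real.pi * w.ro ^ 2) + (384 * (w.Z * w.D) + 40 * (Real.pi * w.ro ^ 2)) +
        (384 * (w.Z * w.D) + 128 * (Real.pi * (w.Z * w.ro ^ 2 / w.a))) ≤ 2000 * V := by linarith
    refine le_trans (le_of_eq ?_) (mul_le_mul_of_nonneg_right e6 hT)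
    ring
  -- Four powers of `a / Z` turn `Z³ / a` into `a³ / Z`; the factor `a³` later compensates the
  -- particle density through `ρ a³ ≤ 1`.
  have htail := hw.tail_le (τ := 1 / 32) (by linarith [hw.t_le]) (m := 4) (by norm_num)
  rw [← gaussTail] at htail
  calc _ ≤ 2000 * (w.Z ^ 3 / w.a) * w.gaussTail := hU
    _ ≤ 2000 * (w.Z ^ 3 / w.a) * (t * (w.a / w.Z) ^ 4) := by gcongr
    _ = 2000 * t * w.a ^ 3 / w.Z := by field_simp
    _ ≤ _ := by gcongr

end WaveParams

/-! ### Assembly of the moment estimates. -/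

namespace BddInt

variable {E : Type*} [MeasurableSpace E] {ν : Measure E} {f g : E → ℂ}

lemma integrable_norm_pow_mul (hf : BddInt ν f) (hg : BddInt ν g) (i j : ℕ) (hi : i ≠ 0) :
    Integrable (fun x => ‖f x‖ ^ i * ‖g x‖ ^ j) ν := by
  obtain ⟨A, hA⟩ := hf.bdd
  obtain ⟨B, hB⟩ := hg.bdd
  obtain ⟨m, rfl⟩ := Nat.exists_eq_succ_of_ne_zero hi
  have h := hf.int.norm.mul_bdd (g := fun x => ‖f x‖ ^ m * ‖g x‖ ^ j) (c := A ^ m * B ^ j)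
    ((hf.meas.norm.pow_const m).mul (hg.meas.norm.pow_const j)).aestronglyMeasurable
    (Filter.Eventually.of_forall fun x => by
      rw [Real.norm_of_nonneg (by positivity)]
      have hA0 := (norm_nonneg _).trans (hA x)
      have hB0 := (norm_nonneg _).trans (hB x)
      exact mul_le_mul (pow_le_pow_left₀ (norm_nonneg _) (hA x) m)
        (pow_le_pow_left₀ (norm_nonneg _) (hB x) j) (by positivity) (by positivity))
  refine h.congr (Filter.Eventually.of_forall fun x => ?_)
  simp only [Nat.succ_eq_add_one]
  ring

lemma integrable_norm_pow (hf : BddInt ν f) (i : ℕ) (hi : i ≠ 0) :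
    Integrable (fun x => ‖f x‖ ^ i) ν := by
  simpa using hf.integrable_norm_pow_mul hf i 0 hi

end BddInt

/-- Estimates of the integrals of two functions that determine the first four moments of the
corresponding sums over a Poisson process. -/
structure MomentEstimates {E : Type*} [MeasurableSpace E] (ν : Measure E) (f g : E → ℂ)
    (ε A b D N : ℝ) : Prop where
  sq_left : |(∫ x, ‖f x‖ ^ 2 ∂ν) - Real.pi ^ 2 / 2 * b| ≤ ε * b
  sq_right : |(∫ x, ‖g x‖ ^ 2 ∂ν) - Real.pi ^ 2 / 2 * b| ≤ ε * b
  sq_mul_sq : |(∫ x, ‖f x‖ ^ 2 * ‖g x‖ ^ 2 ∂ν) - Real.pi ^ 2 / 8 * (b ^ 2 / N)| ≤ ε * (b ^ 2 / N)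
  mul : ‖∫ x, f x * g x ∂ν‖ ≤ ε * b
  left : ‖∫ x, f x ∂ν‖ ≤ ε * (A / D)
  right : ‖∫ x, g x ∂ν‖ ≤ ε * (A / D)
  sq_mul : ∫ x, ‖f x‖ ^ 2 * ‖g x‖ ∂ν ≤ 10 * (A / D * b)
  mul_sq : ∫ x, ‖f x‖ * ‖g x‖ ^ 2 ∂ν ≤ 10 * (A / D * b)

namespace WaveParams

variable {w : WaveParams} {t : ℝ} {x x' : Fin 3 → ℝ}

lemma bddInt_cutWave (ha : 0 < w.a) (hkd : 0 < w.kd) (x : Fin 3 → ℝ) :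
    BddInt volume (w.cutWave x) where
  meas := measurable_cutWave w x
  bdd := ⟨Real.exp (w.kd * w.Z) / w.a, fun q => by
    refine (norm_cutWave_le_exp ha hkd.le x q).trans (mul_le_of_le_one_right (by positivity) ?_)
    rw [Real.exp_le_one_iff]
    have := mul_nonneg hkd.le (rdist_nonneg x q)
    linarith⟩
  int := integrable_cutWave ha hkd x

lemma integral_norm_cutWave_sq_outer_le (hw : w.Regime t) (hx : w.Close t x) :
    ∫ q in (w.core (1 / 2))ᶜ, ‖w.cutWave x q‖ ^ 2 ≤ 80 * t * (w.ro ^ 2 / w.D) := by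
  have hD := hw.D_pos
  have hro := hw.ro_pos
  have ht := hw.t_pos
  have h := lintegral_cutWave_outer_le hw hx (μ := 1 / 2) (by norm_num)
    (by linarith [hw.t_le]) one_ne_zero (by norm_num)
  simp only [pow_one] at h
  have hi := ((bddInt_cutWave hw.a_pos hw.kd_pos x).integrable_norm_pow 2
    two_ne_zero).integrableOn (s := (w.core (1 / 2))ᶜ)
  rw [← ofReal_integral_eq_lintegral_ofReal hi (Filter.Eventually.of_forall fun q => by positivity),
    cauchyIntegral_one, scale, pow_one] at h
  have hπ := Real.pi_pos
  rw [ENNReal.ofReal_le_ofReal_iff (by positivity)] at h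
  refine h.trans ?_
  have het : Real.exp (2 * t) ≤ 2 := by
    have h1 : Real.exp (2 * t) ≤ Real.exp (1 / 2) := Real.exp_le_exp.2 (by linarith [hw.t_le])
    have h2 : Real.exp (1 / 2) ^ 2 = Real.exp 1 := by
      rw [← Real.exp_nat_mul]
      norm_num
    have := Real.exp_one_lt_d9
    nlinarith [Real.exp_pos (1 / 2)]
  have hπ4 := Real.pi_le_four
  have e1 : Real.pi * (2 * Real.pi / (2 * ((1 : ℕ) : ℝ)) + 16 * t) ≤ 4 * 10 := by
    have h4 : 2 * Real.pi / (2 * ((1 : ℕ) : ℝ)) + 16 * t ≤ 10 := by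
      push_cast
      linarith [hw.t_le]
    have : 0 ≤ 2 * Real.pi / (2 * ((1 : ℕ) : ℝ)) + 16 * t := by positivity
    exact mul_le_mul hπ4 h4 this (by norm_num)
  calc _ ≤ w.ro ^ 2 * (w.D * (w.D ^ 2)⁻¹) * (t * (2 * (4 * 10))) := by gcongr
    _ = _ := by
      field_simp
      ring

lemma integral_norm_cutWave_pow_le (hw : w.Regime t) (hx : w.Close t x) {n : ℕ} (hn : n ≠ 0)
    (hn' : n ≤ 8) :
    ∫ q, ‖w.cutWave x q‖ ^ (2 * n) ≤ max 0 (w.scale n * upperConst n t) := by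
  have h := lintegral_cutWave_le hw hx hn hn'
  simp_rw [← pow_mul] at h
  rw [← ofReal_integral_eq_lintegral_ofReal
    ((bddInt_cutWave hw.a_pos hw.kd_pos x).integrable_norm_pow _ (by omega))
    (Filter.Eventually.of_forall fun q => by positivity), ENNReal.ofReal_le_ofReal_iff'] at h
  rcases h with h | h
  · exact h.trans (le_max_right _ _)
  · exact h.trans (le_max_left _ _)

lemma integral_cutWave_mul_eq (hw : w.Regime t) :
    ∫ q, w.cutWave x q * w.cutWave x' q =
      (∫ q in w.core (1 / 2), w.cutWave x q * w.cutWave x' q) +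
        ∫ q in (w.core (1 / 2))ᶜ, w.cutWave x q * w.cutWave x' q :=
  (integral_add_compl (measurableSet_core w _)
    ((bddInt_cutWave hw.a_pos hw.kd_pos x).mul_right
      (bddInt_cutWave hw.a_pos hw.kd_pos x').toBddMeas).int).symm

lemma norm_integral_cutWave_mul_box_le (hw : w.Regime t) (hx : w.Close t x) (hx' : w.Close t x')
    {z : ℝ} (hz : z ≤ 8 * w.Z) :
    ‖∫ p in box (w.D / 2), w.cutWave x (z, p) * w.cutWave x' (z, p)‖ ≤
      (Set.Icc 0 (8 * w.Z)).indicator (fun _ => 2 * w.D ^ 2 * w.edgeBound ^ 2) z := by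
  by_cases h : 0 < z
  · have e : ∀ p ∈ box (w.D / 2), w.cutWave x (z, p) * w.cutWave x' (z, p) =
        w.wave x p.1 p.2 z * w.wave x' p.1 p.2 z := fun p hp => by
      rw [cutWave_box hw hx (q := (z, p)) h hp, cutWave_box hw hx' (q := (z, p)) h hp]
    rw [setIntegral_congr_fun (measurableSet_box _) e,
      Set.indicator_of_mem (show z ∈ Set.Icc 0 (8 * w.Z) from ⟨h.le, hz⟩)]
    have hE : w.Admissible 1 0 z := ⟨⟨by norm_num, by norm_num, le_rfl, by norm_num⟩,
      Or.inl ⟨rfl, h, hz⟩⟩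
    simpa using norm_integral_wave_mul_wave_box_le hw hx hx' hE
  · have e : ∀ p : ℝ × ℝ, w.cutWave x (z, p) * w.cutWave x' (z, p) = 0 := fun p => by
      rw [cutWave, if_neg (fun h' => h h'.1), zero_mul]
    simp_rw [e]
    rw [integral_zero, norm_zero]
    exact Set.indicator_nonneg (fun _ _ => by positivity) _

lemma norm_integral_cutWave_mul_core_le (hw : w.Regime t) (hx : w.Close t x)
    (hx' : w.Close t x') :
    ‖∫ q in w.core (1 / 2), w.cutWave x q * w.cutWave x' q‖ ≤
      8 * w.Z * (2 * w.D ^ 2 * w.edgeBound ^ 2) := by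
  have hZ := hw.Z_pos
  rw [core_eq_prod, Measure.volume_eq_prod, setIntegral_prod
    (fun q => w.cutWave x q * w.cutWave x' q) ((bddInt_cutWave hw.a_pos hw.kd_pos x).mul_right
      (bddInt_cutWave hw.a_pos hw.kd_pos x').toBddMeas).int.integrableOn]
  have hi : Integrable ((Set.Icc 0 (8 * w.Z)).indicator
      (fun _ => 2 * w.D ^ 2 * w.edgeBound ^ 2)) := by
    rw [integrable_indicator_iff measurableSet_Icc]
    exact integrableOn_const measure_Icc_lt_top.ne
  calc _ ≤ ∫ z in Set.Iic (8 * w.Z), (Set.Icc 0 (8 * w.Z)).indicator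
        (fun _ => 2 * w.D ^ 2 * w.edgeBound ^ 2) z :=
        norm_integral_le_of_norm_le hi.integrableOn
          ((ae_restrict_mem measurableSet_Iic).mono fun z hz =>
            norm_integral_cutWave_mul_box_le hw hx hx' hz)
    _ ≤ ∫ z, (Set.Icc 0 (8 * w.Z)).indicator (fun _ => 2 * w.D ^ 2 * w.edgeBound ^ 2) z :=
        setIntegral_le_integral hi (Filter.Eventually.of_forall fun z =>
          Set.indicator_nonneg (fun _ _ => by positivity) _)
    _ = _ := by
        rw [integral_indicator measurableSet_Icc, setIntegral_const]
        simp [hZ.le]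

/-- The integral of the product of two waves, without conjugation, is small. -/
lemma norm_integral_cutWave_mul_le (hw : w.Regime t) (hx : w.Close t x) (hx' : w.Close t x') :
    ‖∫ q, w.cutWave x q * w.cutWave x' q‖ ≤ 10000 * t * (w.ro ^ 2 / w.D) := by
  have hZ := hw.Z_pos
  have ha := hw.a_pos
  have hD := hw.D_pos
  have hro := hw.ro_pos
  have ht := hw.t_pos
  have hT := gaussTail_nonneg w
  have hDZ := hw.D_le_Z
  have haro : w.a ≤ w.ro := by nlinarith [hw.a_ro, hw.t_le]
  have hf := bddInt_cutWave hw.a_pos hw.kd_pos x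
  have hg := bddInt_cutWave hw.a_pos hw.kd_pos x'
  have h1 : ‖∫ q in w.core (1 / 2), w.cutWave x q * w.cutWave x' q‖ ≤
      9216 * t * (w.ro ^ 2 / w.D) := by
    refine (norm_integral_cutWave_mul_core_le hw hx hx').trans ?_
    have htail := hw.tail_le (τ := 1 / 32) (by linarith [hw.t_le]) (m := 2) (by norm_num)
    rw [← gaussTail] at htail
    have hT1 : w.gaussTail ≤ 1 := by
      rw [gaussTail, Real.exp_le_one_iff]
      have : 0 ≤ 1 / 32 * (w.D / w.ro) ^ 2 := by positivity
      linarith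
    -- Both waves are small on the shifted contour, but one Gaussian tail is enough here.
    have hT2 : w.gaussTail ^ 2 ≤ t * (w.a / w.Z) ^ 2 := by nlinarith
    have he0 := hw.edgeBound_nonneg
    calc _ ≤ 8 * w.Z * (2 * w.D ^ 2 * (24 / w.D * w.gaussTail) ^ 2) := by
          gcongr
          exact hw.edgeBound_le
      _ = 9216 * w.Z * w.gaussTail ^ 2 := by field_simp; ring
      _ ≤ 9216 * w.Z * (t * (w.a / w.Z) ^ 2) := by gcongr
      _ = 9216 * t * (w.a ^ 2 / w.Z) := by field_simp
      _ ≤ _ := by gcongr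
  have h2 : ‖∫ q in (w.core (1 / 2))ᶜ, w.cutWave x q * w.cutWave x' q‖ ≤
      80 * t * (w.ro ^ 2 / w.D) := by
    have hif := (hf.integrable_norm_pow 2 two_ne_zero).integrableOn (s := (w.core (1 / 2))ᶜ)
    have hig := (hg.integrable_norm_pow 2 two_ne_zero).integrableOn (s := (w.core (1 / 2))ᶜ)
    -- Outside the core no oscillation is needed: `|f g| ≤ (|f|² + |g|²) / 2`, and each energy there
    -- is of relative size `t`, even at far ranges.
    refine (norm_integral_le_of_norm_le ((hif.add hig).const_mul (1 / 2))
      (Filter.Eventually.of_forall fun q => ?_)).trans ?_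
    · rw [norm_mul, Pi.add_apply]
      nlinarith [sq_nonneg (‖w.cutWave x q‖ - ‖w.cutWave x' q‖)]
    · rw [integral_const_mul, integral_add' hif hig]
      have e1 := integral_norm_cutWave_sq_outer_le hw hx
      have e2 := integral_norm_cutWave_sq_outer_le hw hx'
      linarith
  rw [integral_cutWave_mul_eq hw]
  refine (norm_add_le _ _).trans ((add_le_add h1 h2).trans ?_)
  have : 0 ≤ t * (w.ro ^ 2 / w.D) := by positivity
  linarith

lemma exists_integral_cutWave_ge {i j n : ℕ} (hij : i + j = n) (hi : i ≠ 0) {c : ℝ}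
    (hc : c < Real.pi * cauchyIntegral n / (2 * n)) :
    ∃ t₀ > 0, ∀ (w : WaveParams) (t : ℝ) (x x' : Fin 3 → ℝ), w.Regime t → t ≤ t₀ →
      w.Close t x → w.Close t x' →
      w.scale n * c ≤ ∫ q, ‖w.cutWave x q‖ ^ (2 * i) * ‖w.cutWave x' q‖ ^ (2 * j) := by
  obtain ⟨t₀, h0, h⟩ := exists_lintegral_cutWave_ge hij (by omega) hc
  refine ⟨t₀, h0, fun w t x x' hw ht hx hx' => ?_⟩
  have h1 := h w t x x' hw ht hx hx'
  simp_rw [← pow_mul] at h1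
  rw [← ofReal_integral_eq_lintegral_ofReal
    ((bddInt_cutWave hw.a_pos hw.kd_pos x).integrable_norm_pow_mul
      (bddInt_cutWave hw.a_pos hw.kd_pos x') _ _ (by omega))
    (Filter.Eventually.of_forall fun q => by positivity),
    ENNReal.ofReal_le_ofReal_iff (integral_nonneg fun q => by positivity)] at h1
  exact h1

lemma exists_integral_cutWave_le {n : ℕ} (hn : n ≠ 0) (hn' : n ≤ 8) {c : ℝ} (hc0 : 0 < c)
    (hc : Real.pi * cauchyIntegral n / (2 * n) < c) :
    ∃ t₀ > 0, ∀ (w : WaveParams) (t : ℝ) (x : Fin 3 → ℝ), w.Regime t → t ≤ t₀ →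
      w.Close t x → ∫ q, ‖w.cutWave x q‖ ^ (2 * n) ≤ w.scale n * c := by
  obtain ⟨r, hr, h⟩ := Metric.eventually_nhds_iff.1
    ((tendsto_upperConst (n := n)).eventually (gt_mem_nhds hc))
  refine ⟨r / 2, by positivity, fun w t x hw ht hx => ?_⟩
  have ht0 := hw.t_pos
  have hD := hw.D_pos
  have h1 : upperConst n t < c := by
    apply h
    rw [Real.dist_eq, sub_zero, abs_of_pos ht0]
    linarith
  have hs : 0 ≤ w.scale n := by rw [scale]; positivity
  refine (integral_norm_cutWave_pow_le hw hx hn hn').trans (max_le (by positivity) ?_)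
  exact mul_le_mul_of_nonneg_left h1.le hs

/-- The asymptotic values of the moments of the wave. -/
lemma exists_momentEstimates {ε : ℝ} (hε : 0 < ε) :
    ∃ t₀ > 0, ∀ (w : WaveParams) (t : ℝ) (x x' : Fin 3 → ℝ), w.Regime t → t ≤ t₀ →
      w.Close t x → w.Close t x' →
      |(∫ q, ‖w.cutWave x q‖ ^ 2) - Real.pi ^ 2 / 2 * (w.ro ^ 2 / w.D)| ≤ ε * (w.ro ^ 2 / w.D) ∧
      |(∫ q, ‖w.cutWave x q‖ ^ 2 * ‖w.cutWave x' q‖ ^ 2) -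
        Real.pi ^ 2 / 8 * (w.ro ^ 2 / w.D ^ 3)| ≤ ε * (w.ro ^ 2 / w.D ^ 3) ∧
      ‖∫ q, w.cutWave x q * w.cutWave x' q‖ ≤ ε * (w.ro ^ 2 / w.D) ∧
      ‖∫ q, w.cutWave x q‖ ≤ ε * (w.a ^ 3 / w.D) ∧
      ∫ q, ‖w.cutWave x q‖ ^ 2 * ‖w.cutWave x' q‖ ≤ 10 * (w.ro ^ 2 / w.D ^ 2) := by
  set ε' := min ε 1 with hε'
  have hε0 : 0 < ε' := lt_min hε one_pos
  have c1 : Real.pi * cauchyIntegral 1 / (2 * ((1 : ℕ) : ℝ)) = Real.pi ^ 2 / 2 := by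
    rw [cauchyIntegral_one]
    push_cast
    ring
  have c2 : Real.pi * cauchyIntegral 2 / (2 * ((2 : ℕ) : ℝ)) = Real.pi ^ 2 / 8 := by
    rw [cauchyIntegral_two]
    push_cast
    ring
  have hπ := Real.pi_pos
  obtain ⟨t1, p1, h1⟩ := exists_integral_cutWave_ge (i := 1) (j := 0) (n := 1) rfl one_ne_zero
    (c := Real.pi ^ 2 / 2 - ε') (by rw [c1]; linarith)
  obtain ⟨t2, p2, h2⟩ := exists_integral_cutWave_ge (i := 1) (j := 1) (n := 2) rfl one_ne_zero
    (c := Real.pi ^ 2 / 8 - ε') (by rw [c2]; linarith)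
  obtain ⟨t3, p3, h3⟩ := exists_integral_cutWave_le (n := 1) one_ne_zero (by norm_num)
    (c := Real.pi ^ 2 / 2 + ε') (by positivity) (by rw [c1]; linarith)
  obtain ⟨t4, p4, h4⟩ := exists_integral_cutWave_le (n := 2) two_ne_zero (by norm_num)
    (c := Real.pi ^ 2 / 8 + ε') (by positivity) (by rw [c2]; linarith)
  refine ⟨min (min t1 t2) (min (min t3 t4) (ε / 10000)), by positivity,
    fun w t x x' hw ht hx hx' => ?_⟩
  simp only [le_min_iff] at ht
  obtain ⟨⟨ht1, ht2⟩, ⟨ht3, ht4⟩, ht5⟩ := ht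
  have hD := hw.D_pos
  have hro := hw.ro_pos
  have ha := hw.a_pos
  have hf := bddInt_cutWave hw.a_pos hw.kd_pos x
  have hg := bddInt_cutWave hw.a_pos hw.kd_pos x'
  have s1 : w.scale 1 = w.ro ^ 2 / w.D := by
    rw [scale]
    field_simp
  have s2 : w.scale 2 = w.ro ^ 2 / w.D ^ 3 := by
    rw [scale]
    field_simp
  have hεε : ε' ≤ ε := min_le_left _ _
  have hε1 : ε' ≤ 1 := min_le_right _ _
  set b := w.ro ^ 2 / w.D with hb
  have hb0 : 0 < b := by positivity
  set d := w.ro ^ 2 / w.D ^ 3 with hd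
  have hd0 : 0 < d := by positivity
  have a1 := h1 w t x x' hw ht1 hx hx'
  have a2 := h2 w t x x' hw ht2 hx hx'
  have a3 := h3 w t x hw ht3 hx
  have a4 := h4 w t x hw ht4 hx
  have a4' := h4 w t x' hw ht4 hx'
  simp only [mul_one, mul_zero, pow_zero] at a1 a2 a3
  rw [s1] at a1 a3
  rw [s2] at a2 a4 a4'
  norm_num at a4 a4'
  have hif := hf.integrable_norm_pow 4 (by norm_num)
  have hig := hg.integrable_norm_pow 4 (by norm_num)
  have hfg := hf.integrable_norm_pow_mul hg 2 2 two_ne_zero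
  have hfg1 := hf.integrable_norm_pow_mul hg 2 1 two_ne_zero
  simp only [pow_one] at hfg1
  have hff := hf.integrable_norm_pow 2 two_ne_zero
  -- The upper bound follows from the individual fourth powers by `2 |f|²|g|² ≤ |f|⁴ + |g|⁴`, since
  -- both have the same asymptotic value.
  have a5 : ∫ q, ‖w.cutWave x q‖ ^ 2 * ‖w.cutWave x' q‖ ^ 2 ≤ d * (Real.pi ^ 2 / 8 + ε') := by
    calc _ ≤ ∫ q, (1 / 2 * ‖w.cutWave x q‖ ^ 4 + 1 / 2 * ‖w.cutWave x' q‖ ^ 4) := by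
          refine integral_mono hfg ((hif.const_mul _).add (hig.const_mul _)) fun q => ?_
          simp only
          nlinarith [sq_nonneg (‖w.cutWave x q‖ ^ 2 - ‖w.cutWave x' q‖ ^ 2)]
      _ = 1 / 2 * (∫ q, ‖w.cutWave x q‖ ^ 4) + 1 / 2 * ∫ q, ‖w.cutWave x' q‖ ^ 4 := by
          rw [integral_add (hif.const_mul _) (hig.const_mul _), integral_const_mul,
            integral_const_mul]
      _ ≤ _ := by linarith
  -- Odd moments are interpolated: `|g| ≤ 1 / (2 D) + D |g|² / 2`, where `1 / D` is the typical size
  -- of the wave.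
  have a6 : ∫ q, ‖w.cutWave x q‖ ^ 2 * ‖w.cutWave x' q‖ ≤ 10 * (w.ro ^ 2 / w.D ^ 2) := by
    calc _ ≤ ∫ q, (1 / (2 * w.D) * ‖w.cutWave x q‖ ^ 2 +
          w.D / 2 * (‖w.cutWave x q‖ ^ 2 * ‖w.cutWave x' q‖ ^ 2)) := by
          refine integral_mono hfg1 ((hff.const_mul _).add (hfg.const_mul _)) fun q => ?_
          simp only
          have : ‖w.cutWave x' q‖ ≤ 1 / (2 * w.D) + w.D / 2 * ‖w.cutWave x' q‖ ^ 2 := by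
            have e : 1 / (2 * w.D) + w.D / 2 * ‖w.cutWave x' q‖ ^ 2 - ‖w.cutWave x' q‖ =
                (w.D * ‖w.cutWave x' q‖ - 1) ^ 2 / (2 * w.D) := by
              field_simp
              ring
            have : 0 ≤ (w.D * ‖w.cutWave x' q‖ - 1) ^ 2 / (2 * w.D) := by positivity
            linarith
          nlinarith [mul_le_mul_of_nonneg_left this (sq_nonneg ‖w.cutWave x q‖)]
      _ = 1 / (2 * w.D) * (∫ q, ‖w.cutWave x q‖ ^ 2) +
          w.D / 2 * ∫ q, ‖w.cutWave x q‖ ^ 2 * ‖w.cutWave x' q‖ ^ 2 := by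
          rw [integral_add (hff.const_mul _) (hfg.const_mul _), integral_const_mul,
            integral_const_mul]
      _ ≤ 1 / (2 * w.D) * (b * (Real.pi ^ 2 / 2 + ε')) +
          w.D / 2 * (d * (Real.pi ^ 2 / 8 + ε')) := by gcongr
      _ = ((Real.pi ^ 2 / 2 + ε') / 2 + (Real.pi ^ 2 / 8 + ε') / 2) * (w.ro ^ 2 / w.D ^ 2) := by
          rw [hb, hd]
          field_simp
      _ ≤ _ := by
          gcongr
          have := Real.pi_le_four
          nlinarith
  have m1 : ε' * b ≤ ε * b := by gcongr
  have m2 : ε' * d ≤ ε * d := by gcongr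
  refine ⟨abs_le.2 ⟨by linarith, by linarith⟩, abs_le.2 ⟨by linarith, by linarith⟩, ?_, ?_, a6⟩
  · refine (norm_integral_cutWave_mul_le hw hx hx').trans ?_
    gcongr
    linarith
  · refine (norm_integral_cutWave_le hw hx).trans ?_
    rw [mul_div_assoc]
    gcongr
    linarith [hw.t_pos]

end WaveParams

/-! ### Coordinates adapted to the position of the camera -/

/-- Coordinates of a point after the rotation around the axis of the beam by the unit vector
`(c, s)`. -/
def rotCoord (c s : ℝ) (y : Space3) : Fin 3 → ℝ :=
  ![c * y 0 + s * y 1, -s * y 0 + c * y 1, y 2]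

/-- The coordinates `(z, (u, v))` of a point. -/
def beamCoord (c s : ℝ) (y : Space3) : ℝ × ℝ × ℝ :=
  (y 2, (c * y 0 + s * y 1, -s * y 0 + c * y 1))

/-- A rotation of determinant `1` about the axis, followed by a reordering of the coordinates that
puts the range first. -/
lemma measurePreserving_beamCoord {c s : ℝ} (h : c ^ 2 + s ^ 2 = 1) :
    MeasurePreserving (beamCoord c s) := by
  set M : Matrix (Fin 3) (Fin 3) ℝ := !![c, s, 0; -s, c, 0; 0, 0, 1] with hM
  have hdet : M.det = 1 := by
    rw [hM, Matrix.det_fin_three]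
    simp
    linarith
  have h1 : MeasurePreserving (Matrix.toLin' M) (volume : Measure (Fin 3 → ℝ)) volume := by
    refine ⟨(LinearMap.continuous_of_finiteDimensional _).measurable, ?_⟩
    rw [Real.map_matrix_volume_pi_eq_smul_volume_pi (by rw [hdet]; exact one_ne_zero), hdet]
    simp
  have h0 := EuclideanSpace.volume_preserving_symm_measurableEquiv_toLp (Fin 3)
  have h2 := volume_preserving_piFinSuccAbove (fun _ : Fin 3 => ℝ) 2
  have h3 := (MeasurePreserving.id (volume : Measure ℝ)).prod (volume_preserving_finTwoArrow ℝ)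
  have := h3.comp (h2.comp (h1.comp h0))
  convert this using 1
  ext y
  · simp [beamCoord, hM, Matrix.vecHead, Matrix.vecTail]
  · simp [beamCoord, hM, Matrix.vecHead, Matrix.vecTail]
    rfl
  · simp [beamCoord, hM, Matrix.vecHead, Matrix.vecTail]
    rfl
  · exact Measure.volume_eq_prod _ _

lemma norm_crossRange_sq (y : Space3) : ‖crossRange y‖ ^ 2 = y 0 ^ 2 + y 1 ^ 2 := by
  rw [crossRange, EuclideanSpace.real_norm_sq_eq]
  simp [Fin.sum_univ_two]

lemma rdist_rotCoord {c s : ℝ} (h : c ^ 2 + s ^ 2 = 1) (x y : Space3) :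
    WaveParams.rdist (rotCoord c s x) (beamCoord c s y) = dist x y := by
  rw [WaveParams.rdist, EuclideanSpace.dist_eq, Fin.sum_univ_three]
  congr 1
  simp only [rotCoord, beamCoord, Real.dist_eq, sq_abs, Matrix.cons_val_zero, Matrix.cons_val_one,
    Matrix.cons_val]
  linear_combination ((x 0 - y 0) ^ 2 + (x 1 - y 1) ^ 2) * h

namespace BeamParams

/-- The parameters of the wave scattered to the camera centred at `X`. -/
noncomputable def waveParams (p : BeamParams) (X : Space3) : WaveParams where
  k := p.k
  kd := p.kd
  a := p.a
  ro := p.ro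
  D := ‖crossRange X‖
  Z := rangeCoord X

/-- The amplitude of the wave. -/
noncomputable def amplitude (p : BeamParams) (X : Space3) : ℝ :=
  p.k ^ 2 * p.eta / (4 * Real.pi) * Real.exp (-(p.kd * rangeCoord X))

/-- The beam depends only on the range and on the modulus of the cross-range vector, so it is
invariant under rotations about its axis, as are distances. The factor `exp (-k_d Z)` is moved into
the amplitude, which makes the remaining wave of order `1 / D` near the camera. -/
lemma particleField_eq {p : BeamParams} (hk : p.k ≠ 0) (hro : p.ro ≠ 0) {c s : ℝ}
    (h : c ^ 2 + s ^ 2 = 1) (X x y : Space3) :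
    p.particleField x y = (p.amplitude X : ℂ) *
      (p.waveParams X).cutWave (rotCoord c s x) (beamCoord c s y) := by
  have hz : (beamCoord c s y).1 = rangeCoord y := rfl
  rw [particleField, WaveParams.cutWave, rdist_rotCoord h, hz, Set.indicator_apply]
  simp only [Set.mem_ofPred_eq]
  have ha : (p.waveParams X).a = p.a := rfl
  rw [ha]
  split_ifs with hy
  · have hQ : WaveParams.sqDist (rotCoord c s x) (beamCoord c s y).2.1 (beamCoord c s y).2.2
        (rangeCoord y) ^ (1 / 2 : ℂ) = dist x y := by
      rw [← cpow_half_ofReal dist_nonneg, ← rdist_rotCoord h, WaveParams.rdist_sq,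
        WaveParams.sqDist, hz]
      push_cast
      rfl
    have hL : (p.waveParams X).L = p.k * p.ro ^ 2 / 2 := rfl
    have hk' : (p.k : ℂ) ≠ 0 := by exact_mod_cast hk
    have hro' : (p.ro : ℂ) ≠ 0 := by exact_mod_cast hro
    have hβ : 1 + 2 * Complex.I * rangeCoord y / (p.k * p.ro ^ 2) =
        1 + Complex.I * rangeCoord y / ((p.waveParams X).L : ℝ) := by
      rw [hL]
      push_cast
      field_simp
    have hR : p.beamRadius (rangeCoord y) ^ 2 =
        p.ro ^ 2 * (1 + Complex.I * rangeCoord y / ((p.waveParams X).L : ℝ)) := by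
      rw [beamRadius, mul_pow, cpow_half_sq, hβ]
    have hg : ((beamCoord c s y).2.1 : ℂ) ^ 2 + ((beamCoord c s y).2.2 : ℂ) ^ 2 =
        (‖crossRange y‖ : ℂ) ^ 2 := by
      have : (beamCoord c s y).2.1 ^ 2 + (beamCoord c s y).2.2 ^ 2 = ‖crossRange y‖ ^ 2 := by
        rw [norm_crossRange_sq]
        simp only [beamCoord]
        linear_combination (y 0 ^ 2 + y 1 ^ 2) * h
      exact_mod_cast this
    rw [WaveParams.wave, hQ, hg, green, beam, hR, amplitude]
    have e1 : (p.waveParams X).k = p.k := rfl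
    have e2 : (p.waveParams X).kd = p.kd := rfl
    have e3 : (p.waveParams X).Z = rangeCoord X := rfl
    have e4 : (p.waveParams X).ro = p.ro := rfl
    rw [e1, e2, e3, e4]
    set β := 1 + Complex.I * rangeCoord y / ((p.waveParams X).L : ℝ)
    set G := (‖crossRange y‖ : ℂ) ^ 2
    have hexp : Complex.exp ((Complex.I * p.k - p.kd) * (dist x y : ℂ)) *
        Complex.exp (-G / (p.ro ^ 2 * β) + Complex.I * p.k * rangeCoord y - p.kd * rangeCoord y) =
        Complex.exp (-(p.kd * rangeCoord X)) *
        Complex.exp ((Complex.I * p.k - p.kd) * ((dist x y : ℂ) + rangeCoord y) +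
          p.kd * rangeCoord X) * Complex.exp (-(G * (p.ro ^ 2 * β)⁻¹)) := by
      rw [← Complex.exp_add, ← Complex.exp_add, ← Complex.exp_add]
      congr 1
      ring
    have hfac : (p.ro : ℂ) ^ 2 / (p.ro ^ 2 * β) = β⁻¹ := by
      rw [div_mul_eq_div_div, div_self (pow_ne_zero 2 hro'), one_div]
    rw [hfac]
    push_cast
    calc _ = (p.k : ℂ) ^ 2 * p.eta * (1 / (4 * Real.pi * (dist x y : ℂ))) * β⁻¹ *
          (Complex.exp ((Complex.I * p.k - p.kd) * (dist x y : ℂ)) *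
          Complex.exp (-G / (p.ro ^ 2 * β) + Complex.I * p.k * rangeCoord y -
            p.kd * rangeCoord y)) := by ring
      _ = _ := by
          rw [hexp]
          simp only [div_eq_mul_inv, mul_inv]
          ring
  · rw [mul_zero]

end BeamParams

namespace BeamParams

variable {p : BeamParams} {c s : ℝ}

lemma rho_nonneg (hl : 0 < p.ℓ) : 0 ≤ p.rho := by
  rw [rho]
  positivity

lemma integral_comp_beamCoord {G : Type*} [NormedAddCommGroup G] [NormedSpace ℝ G]
    (hl : 0 < p.ℓ) (h : c ^ 2 + s ^ 2 = 1) {F : ℝ × ℝ × ℝ → G}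
    (hF : AEStronglyMeasurable F volume) :
    ∫ y, F (beamCoord c s y) ∂(ENNReal.ofReal p.rho • (volume : Measure Space3)) =
      p.rho • ∫ q, F q := by
  have hT := measurePreserving_beamCoord h
  rw [integral_smul_measure, ENNReal.toReal_ofReal (rho_nonneg hl)]
  conv_rhs => rw [← hT.map_eq]
  rw [integral_map hT.measurable.aemeasurable (by rwa [hT.map_eq])]

lemma bddInt_particleField (hp : 0 < p.k ∧ 0 < p.kd ∧ 0 < p.a ∧ 0 < p.ro) (x : Space3) :
    BddInt (ENNReal.ofReal p.rho • (volume : Measure Space3)) (p.particleField x) := by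
  obtain ⟨hk, hkd, ha, hro⟩ := hp
  have h10 : (1 : ℝ) ^ 2 + 0 ^ 2 = 1 := by norm_num
  have hT := measurePreserving_beamCoord h10
  have hh := WaveParams.bddInt_cutWave (w := p.waveParams 0) ha hkd (rotCoord 1 0 x)
  have he : p.particleField x = (p.amplitude 0 : ℂ) •
      ((p.waveParams 0).cutWave (rotCoord 1 0 x) ∘ beamCoord 1 0) := by
    ext y
    rw [particleField_eq hk.ne' hro.ne' h10 0 x y]
    rfl
  rw [he]
  refine BddInt.smul _ ⟨⟨hh.meas.comp hT.measurable, ?_⟩, ?_⟩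
  · obtain ⟨B, hB⟩ := hh.bdd
    exact ⟨B, fun y => hB _⟩
  · exact ((hT.integrable_comp hh.meas.aestronglyMeasurable).2 hh.int).smul_measure
      ENNReal.ofReal_ne_top

lemma integral_norm_pow_mul_particleField (hp : 0 < p.k ∧ 0 < p.kd ∧ 0 < p.a ∧ 0 < p.ro)
    (hl : 0 < p.ℓ) (h : c ^ 2 + s ^ 2 = 1) (X x x' : Space3) (i j : ℕ) :
    ∫ y, ‖p.particleField x y‖ ^ i * ‖p.particleField x' y‖ ^ j
      ∂(ENNReal.ofReal p.rho • (volume : Measure Space3)) =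
    p.rho * |p.amplitude X| ^ (i + j) *
      ∫ q, ‖(p.waveParams X).cutWave (rotCoord c s x) q‖ ^ i *
        ‖(p.waveParams X).cutWave (rotCoord c s x') q‖ ^ j := by
  obtain ⟨hk, hkd, ha, hro⟩ := hp
  have hm := WaveParams.measurable_cutWave (p.waveParams X)
  have he : ∀ y, ‖p.particleField x y‖ ^ i * ‖p.particleField x' y‖ ^ j =
      |p.amplitude X| ^ (i + j) * (fun q => ‖(p.waveParams X).cutWave (rotCoord c s x) q‖ ^ i *
        ‖(p.waveParams X).cutWave (rotCoord c s x') q‖ ^ j) (beamCoord c s y) := by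
    intro y
    rw [particleField_eq hk.ne' hro.ne' h X x y, particleField_eq hk.ne' hro.ne' h X x' y,
      norm_mul, norm_mul, Complex.norm_real, Real.norm_eq_abs, pow_add]
    ring
  rw [integral_congr_ae (Filter.Eventually.of_forall he), integral_const_mul,
    integral_comp_beamCoord hl h (F := fun q => ‖(p.waveParams X).cutWave (rotCoord c s x) q‖ ^ i *
        ‖(p.waveParams X).cutWave (rotCoord c s x') q‖ ^ j)
      (((hm _).norm.pow_const i).mul ((hm _).norm.pow_const j)).aestronglyMeasurable, smul_eq_mul]
  ring

lemma integral_particleField (hp : 0 < p.k ∧ 0 < p.kd ∧ 0 < p.a ∧ 0 < p.ro)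
    (hl : 0 < p.ℓ) (h : c ^ 2 + s ^ 2 = 1) (X x : Space3) :
    ‖∫ y, p.particleField x y ∂(ENNReal.ofReal p.rho • (volume : Measure Space3))‖ =
    p.rho * |p.amplitude X| * ‖∫ q, (p.waveParams X).cutWave (rotCoord c s x) q‖ := by
  obtain ⟨hk, hkd, ha, hro⟩ := hp
  have hm := WaveParams.measurable_cutWave (p.waveParams X)
  rw [integral_congr_ae (Filter.Eventually.of_forall (particleField_eq hk.ne' hro.ne' h X x)),
    integral_const_mul, integral_comp_beamCoord hl h (hm _).aestronglyMeasurable, norm_mul,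
    norm_smul, Complex.norm_real, Real.norm_eq_abs, Real.norm_of_nonneg (rho_nonneg hl)]
  ring

lemma integral_mul_particleField (hp : 0 < p.k ∧ 0 < p.kd ∧ 0 < p.a ∧ 0 < p.ro)
    (hl : 0 < p.ℓ) (h : c ^ 2 + s ^ 2 = 1) (X x x' : Space3) :
    ‖∫ y, p.particleField x y * p.particleField x' y
      ∂(ENNReal.ofReal p.rho • (volume : Measure Space3))‖ =
    p.rho * |p.amplitude X| ^ 2 * ‖∫ q, (p.waveParams X).cutWave (rotCoord c s x) q *
      (p.waveParams X).cutWave (rotCoord c s x') q‖ := by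
  obtain ⟨hk, hkd, ha, hro⟩ := hp
  have hm := WaveParams.measurable_cutWave (p.waveParams X)
  have he : ∀ y, p.particleField x y * p.particleField x' y = (p.amplitude X : ℂ) ^ 2 *
      (fun q => (p.waveParams X).cutWave (rotCoord c s x) q *
        (p.waveParams X).cutWave (rotCoord c s x') q) (beamCoord c s y) := by
    intro y
    rw [particleField_eq hk.ne' hro.ne' h X x y, particleField_eq hk.ne' hro.ne' h X x' y]
    ring
  rw [integral_congr_ae (Filter.Eventually.of_forall he), integral_const_mul,
    integral_comp_beamCoord hl h (F := fun q => (p.waveParams X).cutWave (rotCoord c s x) q *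
      (p.waveParams X).cutWave (rotCoord c s x') q) ((hm _).mul (hm _)).aestronglyMeasurable, norm_mul,
    norm_smul, norm_pow, Complex.norm_real, Real.norm_eq_abs, Real.norm_of_nonneg (rho_nonneg hl)]
  ring

/-- The scale of the mean intensity. -/
noncomputable def intensityScale (p : BeamParams) (X : Space3) : ℝ :=
  p.rho * p.amplitude X ^ 2 * (p.ro ^ 2 / ‖crossRange X‖)

/-- Every integral scales by `ρ` times a power of the amplitude equal to the number of factors; this
determines `b` and `N` in the estimates. -/
lemma exists_momentEstimates_particleField {ε : ℝ} (hε : 0 < ε) :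
    ∃ t₀ > 0, ∀ (p : BeamParams) (t : ℝ) (X x x' : Space3) (c s : ℝ), c ^ 2 + s ^ 2 = 1 →
      0 < p.ℓ → p.a ≤ p.ℓ → (p.waveParams X).Regime t → t ≤ t₀ →
      (p.waveParams X).Close t (rotCoord c s x) → (p.waveParams X).Close t (rotCoord c s x') →
      MomentEstimates (ENNReal.ofReal p.rho • (volume : Measure Space3)) (p.particleField x)
        (p.particleField x') ε |p.amplitude X| (p.intensityScale X) ‖crossRange X‖
        (p.rho * p.ro ^ 2 * ‖crossRange X‖) := by
  obtain ⟨t₀, h0, h⟩ := WaveParams.exists_momentEstimates hε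
  refine ⟨t₀, h0, fun p t X x x' c s hcs hl hal hw ht hx hx' => ?_⟩
  have hp : 0 < p.k ∧ 0 < p.kd ∧ 0 < p.a ∧ 0 < p.ro :=
    ⟨hw.k_pos, hw.kd_pos, hw.a_pos, hw.ro_pos⟩
  have hD : 0 < ‖crossRange X‖ := hw.D_pos
  have hro : 0 < p.ro := hp.2.2.2
  have ha : 0 < p.a := hp.2.2.1
  have hρ : 0 < p.rho := by rw [rho]; positivity
  -- The mean carries one factor `ρ` but is to be compared with `A / D`, which has none; the factor
  -- `a³` in the bound of the mean supplies the balance.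
  have hρa : p.rho * p.a ^ 3 ≤ 1 := by
    rw [rho, one_div, inv_mul_le_iff₀ (by positivity), mul_one]
    gcongr
  obtain ⟨a1, a2, a3, a4, a5⟩ := h _ t _ _ hw ht hx hx'
  obtain ⟨b1, -, -, b4, b5⟩ := h _ t _ _ hw ht hx' hx
  have r1 : (p.waveParams X).ro = p.ro := rfl
  have r2 : (p.waveParams X).D = ‖crossRange X‖ := rfl
  have r3 : (p.waveParams X).a = p.a := rfl
  rw [r1, r2] at a1 a2 a3 a5 b1 b5
  rw [r2, r3] at a4 b4
  set D := ‖crossRange X‖ with hDdef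
  have hA : 0 ≤ |p.amplitude X| := abs_nonneg _
  have hA2 : p.amplitude X ^ 2 = |p.amplitude X| ^ 2 := (sq_abs _).symm
  have hb : p.intensityScale X = p.rho * |p.amplitude X| ^ 2 * (p.ro ^ 2 / D) := by
    rw [intensityScale, hA2]
  have hbN : p.intensityScale X ^ 2 / (p.rho * p.ro ^ 2 * D) =
      p.rho * |p.amplitude X| ^ 4 * (p.ro ^ 2 / D ^ 3) := by
    rw [hb]
    field_simp
  have i2 := integral_norm_pow_mul_particleField hp hl hcs X x x' 2 0
  have i2' := integral_norm_pow_mul_particleField hp hl hcs X x' x 2 0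
  have i4 := integral_norm_pow_mul_particleField hp hl hcs X x x' 2 2
  have i3 := integral_norm_pow_mul_particleField hp hl hcs X x x' 2 1
  have i3' := integral_norm_pow_mul_particleField hp hl hcs X x' x 2 1
  simp only [pow_zero, mul_one, pow_one, add_zero] at i2 i2' i3 i3'
  set A := |p.amplitude X|
  have key : ∀ (m C e u v : ℝ), 0 ≤ m → |u - C * v| ≤ e * v →
      |m * u - C * (m * v)| ≤ e * (m * v) := by
    intro m C e u v hm h
    have : m * u - C * (m * v) = m * (u - C * v) := by ring
    rw [this, abs_mul, abs_of_nonneg hm]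
    calc m * |u - C * v| ≤ m * (e * v) := by gcongr
      _ = _ := by ring
  have mean : ∀ u : ℝ, u ≤ ε * (p.a ^ 3 / D) → p.rho * A * u ≤ ε * (A / D) := by
    intro u hu
    calc p.rho * A * u ≤ p.rho * A * (ε * (p.a ^ 3 / D)) := by gcongr
      _ = (p.rho * p.a ^ 3) * (ε * (A / D)) := by ring
      _ ≤ 1 * (ε * (A / D)) := by gcongr
      _ = _ := one_mul _
  have hAb : A / D * p.intensityScale X = p.rho * A ^ 3 * (p.ro ^ 2 / D ^ 2) := by
    rw [hb]
    field_simp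
  refine ⟨?_, ?_, ?_, ?_, ?_, ?_, ?_, ?_⟩
  · rw [i2, hb]
    exact key _ _ _ _ _ (by positivity) a1
  · rw [i2', hb]
    exact key _ _ _ _ _ (by positivity) b1
  · rw [i4, hbN]
    exact key _ _ _ _ _ (by positivity) a2
  · rw [integral_mul_particleField hp hl hcs X x x', hb]
    calc _ ≤ p.rho * A ^ 2 * (ε * (p.ro ^ 2 / D)) := by gcongr
      _ = _ := by ring
  · rw [integral_particleField hp hl hcs X x]
    exact mean _ a4
  · rw [integral_particleField hp hl hcs X x']
    exact mean _ b4
  · rw [i3, hAb]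
    calc _ ≤ p.rho * A ^ (2 + 1) * (10 * (p.ro ^ 2 / D ^ 2)) := by gcongr
      _ = _ := by ring
  · have e : ∀ y, ‖p.particleField x y‖ * ‖p.particleField x' y‖ ^ 2 =
        ‖p.particleField x' y‖ ^ 2 * ‖p.particleField x y‖ := fun y => mul_comm _ _
    simp_rw [e]
    rw [i3', hAb]
    calc _ ≤ p.rho * A ^ (2 + 1) * (10 * (p.ro ^ 2 / D ^ 2)) := by gcongr
      _ = _ := by ring

end BeamParams

lemma sq_rotCoord_le {c s : ℝ} (h : c ^ 2 + s ^ 2 = 1) (x : Space3) (i : Fin 3) :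
    |rotCoord c s x i| ≤ ‖x‖ := by
  apply abs_le_of_sq_le_sq _ (norm_nonneg x)
  rw [EuclideanSpace.real_norm_sq_eq, Fin.sum_univ_three]
  have e : (c * x 0 + s * x 1) ^ 2 + (-s * x 0 + c * x 1) ^ 2 = x 0 ^ 2 + x 1 ^ 2 := by
    linear_combination (x 0 ^ 2 + x 1 ^ 2) * h
  fin_cases i <;> simp only [rotCoord, Fin.zero_eta, Fin.mk_one, Fin.reduceFinMk,
    Matrix.cons_val_zero, Matrix.cons_val_one, Matrix.cons_val]
  · nlinarith [sq_nonneg (-s * x 0 + c * x 1), sq_nonneg (x 2)]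
  · nlinarith [sq_nonneg (c * x 0 + s * x 1), sq_nonneg (x 2)]
  · nlinarith [sq_nonneg (x 0), sq_nonneg (x 1)]

/-! ### From the physical scaling regime to the position of the camera. -/

namespace BeamParams

/-- The rotation aligned with the cross-range vector of `X` maps `X` to `(D, 0, Z)` and does not
increase any coordinate of the offset beyond its norm. -/
lemma close_rotCoord {p : BeamParams} {X x : Space3} {t : ℝ} (hD : 0 < ‖crossRange X‖)
    (hx : ‖x‖ ≤ t * ‖crossRange X‖) :
    (p.waveParams X).Close t
      (rotCoord (X 0 / ‖crossRange X‖) (X 1 / ‖crossRange X‖) (X + x)) := by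
  have hcs : (X 0 / ‖crossRange X‖) ^ 2 + (X 1 / ‖crossRange X‖) ^ 2 = 1 := by
    rw [div_pow, div_pow, ← add_div, ← norm_crossRange_sq, div_self (by positivity)]
  have hX := norm_crossRange_sq X
  have hi := sq_rotCoord_le hcs x
  have h0 := (hi 0).trans hx
  have h1 := (hi 1).trans hx
  have h2 := (hi 2).trans hx
  have e1 : (p.waveParams X).D = ‖crossRange X‖ := rfl
  have e2 : (p.waveParams X).Z = X 2 := rfl
  set D := ‖crossRange X‖
  have d0 : X 0 / D * X 0 + X 1 / D * X 1 = D := by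
    field_simp
    linarith
  have d1 : -(X 1 / D) * X 0 + X 0 / D * X 1 = 0 := by ring
  constructor
  · have e : rotCoord (X 0 / D) (X 1 / D) (X + x) 0 - D = rotCoord (X 0 / D) (X 1 / D) x 0 := by
      change X 0 / D * (X 0 + x 0) + X 1 / D * (X 1 + x 1) - D = X 0 / D * x 0 + X 1 / D * x 1
      linear_combination d0
    rwa [e1, e]
  · have e : rotCoord (X 0 / D) (X 1 / D) (X + x) 1 = rotCoord (X 0 / D) (X 1 / D) x 1 := by
      change -(X 1 / D) * (X 0 + x 0) + X 0 / D * (X 1 + x 1) =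
        -(X 1 / D) * x 0 + X 0 / D * x 1
      linear_combination d1
    rwa [e1, e]
  · have e : rotCoord (X 0 / D) (X 1 / D) (X + x) 2 - X 2 = rotCoord (X 0 / D) (X 1 / D) x 2 := by
      change X 2 + x 2 - X 2 = x 2
      ring
    rwa [e1, e2, e]

/-- The scaling regime in terms of the position of the camera. -/
lemma exists_regime {C : ℝ} (hC : 1 ≤ C) {t : ℝ} (ht : 0 < t) (ht' : t ≤ 1 / 10000) :
    ∃ δ : ℝ, 0 < δ ∧ ∀ p : BeamParams, p.ScalingRegime δ → ∀ X : Space3,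
      C⁻¹ * p.Lx ≤ ‖crossRange X‖ → ‖crossRange X‖ ≤ C * p.Lx →
      C⁻¹ * p.Lz ≤ rangeCoord X → rangeCoord X ≤ C * p.Lz →
      (p.waveParams X).Regime t ∧ p.a ≤ p.ℓ ∧ p.dA ≤ t * ‖crossRange X‖ ∧
        1 / (p.rho * p.ro ^ 2 * ‖crossRange X‖) ≤ t := by
  have hC0 : 0 < C := by linarith
  -- The power `C ^ 16` pays for `(Z / a)^16 ≤ (C L_z / a)^16`. The factor `17` makes the
  -- logarithmic hypothesis control seventeen powers of `L_z / a`: sixteen are used, and the last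
  -- one leaves `a / L_z ≤ δ`.
  refine ⟨t / (17 * C ^ 16), by positivity, fun p hp X hX1 hX2 hZ1 hZ2 => ?_⟩
  have hδC : t / (17 * C ^ 16) * C ^ 16 ≤ t / 17 := by
    apply le_of_eq
    field_simp
  set δ := t / (17 * C ^ 16) with hδ
  have hδ0 : 0 < δ := by positivity
  obtain ⟨hk, hkd, ha, hl, hro, hLx, hLz, hdA, r1, r2, r3, r4, r5, r6, r7, r8, r9, r10, r11⟩ := hp
  have hpow : ∀ n : ℕ, n ≤ 16 → δ * C ^ n ≤ t := by
    intro n hn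
    calc δ * C ^ n ≤ δ * C ^ 16 := by gcongr
      _ ≤ t := by linarith
  have hδt : δ ≤ t := by simpa using hpow 0 (by norm_num)
  have hδ1 : δ ≤ 1 := by linarith
  have hδC1 : δ * C ≤ t := by simpa using hpow 1 (by norm_num)
  have hδC2 : δ * C ^ 2 ≤ t := hpow 2 (by norm_num)
  have hwl : 0 < p.wavelength := by
    rw [wavelength]
    have := Real.pi_pos
    positivity
  set D := ‖crossRange X‖ with hD
  set Z := rangeCoord X with hZ
  have hLxD : p.Lx ≤ C * D := by rwa [inv_mul_le_iff₀ hC0] at hX1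
  have hLzZ : p.Lz ≤ C * Z := by rwa [inv_mul_le_iff₀ hC0] at hZ1
  have hD0 : 0 < D := lt_of_lt_of_le (by positivity) hX1
  have hZ0 : 0 < Z := lt_of_lt_of_le (by positivity) hZ1
  have step : ∀ {u v : ℝ}, 0 ≤ v → u ≤ δ * v → u ≤ v := fun hv h =>
    h.trans (mul_le_of_le_one_left hv hδ1)
  have a_w := step hwl.le r1
  have w_ℓ := step hl.le r2
  have ℓ_ro := step hro.le r3
  have ro_Lx := step hLx.le r4
  have Lx_Lz := step hLz.le r5
  have ro_D : p.ro ≤ t * D := by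
    calc p.ro ≤ δ * (C * D) := r4.trans (by gcongr)
      _ = (δ * C) * D := by ring
      _ ≤ _ := by gcongr
  refine ⟨⟨hk, hkd, ha, hro, hD0, hZ0, ht, ht', ?_, ro_D, ?_, ?_, ?_, ?_⟩, a_w.trans w_ℓ, ?_, ?_⟩
  · calc p.a ≤ p.ℓ := a_w.trans w_ℓ
      _ ≤ δ * p.ro := r3
      _ ≤ t * p.ro := by gcongr
  · calc D ≤ C * (δ * (C * Z)) := hX2.trans (by gcongr; exact r5.trans (by gcongr))
      _ = (δ * C ^ 2) * Z := by ring
      _ ≤ t * Z := by gcongr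
  · have hL : 0 < p.rayleighLength := by rw [rayleighLength]; positivity
    calc Z ≤ C * (δ * p.rayleighLength) := hZ2.trans (by gcongr)
      _ = (δ * C) * p.rayleighLength := by ring
      _ ≤ t * p.rayleighLength := by gcongr
  · calc p.kd * D ≤ p.kd * (C * p.Lx) := by gcongr
      _ = C * (p.kd * p.Lx) := by ring
      _ ≤ C * δ := by gcongr
      _ ≤ t := by linarith
  · have haLz : p.a ≤ δ * p.Lz := by
      calc p.a ≤ δ * p.wavelength := r1
        _ ≤ δ * p.Lz := by
          gcongr
          linarith
    have hlog : 0 ≤ Real.log (p.Lz / p.a) := by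
      apply Real.log_nonneg
      rw [one_le_div ha]
      exact step hLz.le haLz
    have h1 : 17 * Real.log (p.Lz / p.a) ≤ t * (D / p.ro) ^ 2 := by
      have e1 : (p.Lx / p.ro) ^ 2 ≤ C ^ 2 * (D / p.ro) ^ 2 := by
        rw [← mul_pow, ← mul_div_assoc]
        gcongr
      have e2 : δ * C ^ 2 ≤ t / 17 := by
        calc δ * C ^ 2 ≤ δ * C ^ 16 := by
              gcongr
              norm_num
          _ ≤ _ := hδC
      calc 17 * Real.log (p.Lz / p.a) ≤ 17 * (δ * (C ^ 2 * (D / p.ro) ^ 2)) := by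
            gcongr
            exact r11.trans (by gcongr)
        _ = 17 * ((δ * C ^ 2) * (D / p.ro) ^ 2) := by ring
        _ ≤ 17 * (t / 17 * (D / p.ro) ^ 2) := by gcongr
        _ = _ := by ring
    have h2 : Real.exp (-(t * (D / p.ro) ^ 2)) ≤ ((p.Lz / p.a) ^ 17)⁻¹ := by
      rw [Real.exp_neg]
      apply inv_anti₀ (by positivity)
      calc (p.Lz / p.a) ^ 17 = Real.exp (17 * Real.log (p.Lz / p.a)) := by
            have := Real.exp_nat_mul (Real.log (p.Lz / p.a)) 17
            rw [Real.exp_log (by positivity)] at this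
            rw [← this]
            norm_num
        _ ≤ _ := Real.exp_le_exp.2 h1
    change (Z / p.a) ^ 16 * Real.exp (-(t * (D / p.ro) ^ 2)) ≤ t
    calc _ ≤ (C * p.Lz / p.a) ^ 16 * ((p.Lz / p.a) ^ 17)⁻¹ := by gcongr
      _ = C ^ 16 * (p.a / p.Lz) := by field_simp
      _ ≤ C ^ 16 * δ := by
          gcongr
          rw [div_le_iff₀ hLz]
          exact haLz
      _ ≤ t := by linarith
  · exact (step hro.le r7).trans ro_D
  · rw [rho, div_le_iff₀ (by positivity)]
    have h1 : p.ℓ ^ 3 ≤ p.ro ^ 3 := by gcongr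
    have h2 : p.ro ^ 3 ≤ t * (p.ro ^ 2 * D) := by
      calc p.ro ^ 3 = p.ro * p.ro ^ 2 := by ring
        _ ≤ (t * D) * p.ro ^ 2 := by gcongr
        _ = _ := by ring
    have h3 : t * (1 / p.ℓ ^ 3 * p.ro ^ 2 * D) = t * (p.ro ^ 2 * D) / p.ℓ ^ 3 := by ring
    rw [h3, le_div_iff₀ (by positivity)]
    linarith

end BeamParams

/-- The numerical part of the derivation of the summation rule: `κ` are cumulants, `mf` and `mg`
means, `q` is the pseudo-covariance, `R` the residual and `M` the product of the intensities. -/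
lemma summation_rule_of_cumulants {R M q mf mg κf κg κ4 κ21 κ12 m b N e ε : ℝ} (hmf0 : 0 ≤ mf)
    (hmg0 : 0 ≤ mg) (hq0 : 0 ≤ q) (hm0 : 0 ≤ m)
    (hM : M = (κf + mf ^ 2) * (κg + mg ^ 2))
    (hR : |R - κ4| ≤ 2 * mg * κ21 + 2 * mf * κ12 + 2 * mf ^ 2 * mg ^ 2)
    (huv : q ≤ e * b + mf * mg)
    (h1 : |κf - Real.pi ^ 2 / 2 * b| ≤ e * b) (h2 : |κg - Real.pi ^ 2 / 2 * b| ≤ e * b)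
    (h3 : |κ4 - Real.pi ^ 2 / 8 * (b ^ 2 / N)| ≤ e * (b ^ 2 / N))
    (h5 : mf ≤ e * m) (h6 : mg ≤ e * m) (h7 : κ21 ≤ 10 * (m * b)) (h8 : κ12 ≤ 10 * (m * b))
    (he0 : 0 < e) (he : 1000 * e ≤ ε) (he' : e ≤ 1 / 1000) (hb : 0 ≤ b) (hN : 0 < N)
    (hNe : 1 / N ≤ e) (hA : m ^ 2 = b / N) :
    |R + q ^ 2| ≤ ε * M ∧ q ^ 2 ≤ ε * M ∧ |2 * Real.pi ^ 2 * N * R - M| ≤ ε * M := by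
  set B := b ^ 2 / N with hB
  have hbN : b / N ≤ b * e := by
    rw [div_eq_mul_one_div]
    gcongr
  have hBb : B ≤ e * b ^ 2 := by
    have e1 : B = b ^ 2 * (1 / N) := by rw [hB]; ring
    rw [e1, mul_comm]
    gcongr
  have hB0 : 0 ≤ B := by positivity
  have hNB : N * B = b ^ 2 := by rw [hB]; field_simp
  -- The scale `m = A / D` is such that a third cumulant times a mean has exactly the order `B` of
  -- the fourth cumulant; smallness then comes from the factor `e` in the means.
  have hm2b : m ^ 2 * b = B := by rw [hA, hB]; ring
  have hm2 : m ^ 2 ≤ e * b := by rw [hA]; linarith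
  have hm4 : m ^ 4 ≤ B := by
    calc m ^ 4 = m ^ 2 * m ^ 2 := by ring
      _ ≤ m ^ 2 * (e * b) := by gcongr
      _ = e * B := by rw [← hm2b]; ring
      _ ≤ 1 * B := by gcongr; linarith
      _ = B := one_mul B
  have hπ0 := Real.pi_pos
  have hπ3 : 9 ≤ Real.pi ^ 2 := by nlinarith [Real.pi_gt_three]
  have hπ10 : Real.pi ^ 2 ≤ 10 := by nlinarith [Real.pi_lt_d2]
  have hmf2 : mf ^ 2 ≤ e * b := by
    calc mf ^ 2 ≤ (e * m) ^ 2 := by gcongr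
      _ = e ^ 2 * m ^ 2 := by ring
      _ ≤ 1 * (e * b) := by
        gcongr
        exact pow_le_one₀ he0.le (by linarith)
      _ = _ := one_mul _
  have hmg2 : mg ^ 2 ≤ e * b := by
    calc mg ^ 2 ≤ (e * m) ^ 2 := by gcongr
      _ = e ^ 2 * m ^ 2 := by ring
      _ ≤ 1 * (e * b) := by
        gcongr
        exact pow_le_one₀ he0.le (by linarith)
      _ = _ := one_mul _
  have hmfg : mf * mg ≤ e * b := by linarith [sq_nonneg (mf - mg)]
  -- the product of the mean intensities
  have s1 : |κf + mf ^ 2 - Real.pi ^ 2 / 2 * b| ≤ 2 * e * b := by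
    rw [abs_le] at h1 ⊢
    constructor <;> linarith [sq_nonneg mf]
  have s2 : |κg + mg ^ 2 - Real.pi ^ 2 / 2 * b| ≤ 2 * e * b := by
    rw [abs_le] at h2 ⊢
    constructor <;> linarith [sq_nonneg mg]
  -- Product of the two intensities: the cross terms contribute `20 e b²` and the product of errors
  -- at most `e b²`.
  have hM1 : |M - Real.pi ^ 4 / 4 * b ^ 2| ≤ 21 * e * b ^ 2 := by
    set α := κf + mf ^ 2 - Real.pi ^ 2 / 2 * b
    set β := κg + mg ^ 2 - Real.pi ^ 2 / 2 * b
    have e1 : M - Real.pi ^ 4 / 4 * b ^ 2 = Real.pi ^ 2 / 2 * b * (α + β) + α * β := by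
      rw [hM]
      simp only [α, β]
      ring
    have e2 : |α * β| ≤ (2 * e * b) * (2 * e * b) := by
      rw [abs_mul]
      gcongr
    have e3 : |Real.pi ^ 2 / 2 * b * (α + β)| ≤ 5 * b * (2 * e * b + 2 * e * b) := by
      rw [abs_mul, abs_of_nonneg (by positivity)]
      gcongr
      · linarith
      · exact (abs_add_le _ _).trans (add_le_add s1 s2)
    have e4 : e * (e * b ^ 2) ≤ 1 / 4 * (e * b ^ 2) := by
      gcongr
      linarith
    rw [e1]
    refine (abs_add_le _ _).trans ((add_le_add e3 e2).trans ?_)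
    linarith
  have hMb : b ^ 2 ≤ M := by
    have e1 := (abs_le.1 hM1).1
    have e2 : 81 / 4 * b ^ 2 ≤ Real.pi ^ 4 / 4 * b ^ 2 := by
      have : (9 : ℝ) ^ 2 ≤ (Real.pi ^ 2) ^ 2 := by gcongr
      gcongr
      linarith
    have e3 : 21 * e * b ^ 2 ≤ 21 * (1 / 1000) * b ^ 2 := by gcongr
    linarith [sq_nonneg b]
  have hfin : ∀ c : ℝ, 0 ≤ c → c ≤ 1000 → c * e * b ^ 2 ≤ ε * M := by
    intro c h0 h1
    calc c * e * b ^ 2 ≤ 1000 * e * b ^ 2 := by gcongr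
      _ ≤ ε * M := by gcongr; linarith
  -- the residual
  have hR1 : |R - Real.pi ^ 2 / 8 * B| ≤ 43 * e * B := by
    have e1 : 2 * mg * κ21 ≤ 20 * e * B := by
      calc _ ≤ 2 * mg * (10 * (m * b)) := by gcongr
        _ ≤ 2 * (e * m) * (10 * (m * b)) := by gcongr
        _ = 20 * e * (m ^ 2 * b) := by ring
        _ = _ := by rw [hm2b]
    have e2 : 2 * mf * κ12 ≤ 20 * e * B := by
      calc _ ≤ 2 * mf * (10 * (m * b)) := by gcongr
        _ ≤ 2 * (e * m) * (10 * (m * b)) := by gcongr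
        _ = 20 * e * (m ^ 2 * b) := by ring
        _ = _ := by rw [hm2b]
    have e3 : 2 * mf ^ 2 * mg ^ 2 ≤ 2 * e * B := by
      calc 2 * mf ^ 2 * mg ^ 2 ≤ 2 * (e * m) ^ 2 * (e * m) ^ 2 := by gcongr
        _ = 2 * e ^ 4 * m ^ 4 := by ring
        _ ≤ 2 * e * B := by
          gcongr
          exact pow_le_of_le_one he0.le (by linarith) (by norm_num)
    -- The constant is `43 = 20 + 20 + 2 + 1`, where the last term is the error of the fourth
    -- cumulant.
    have e4 := abs_sub_le R κ4 (Real.pi ^ 2 / 8 * B)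
    linarith
  have hq2 : q ^ 2 ≤ 4 * e * b ^ 2 := by
    have e1 : q ≤ 2 * e * b := by linarith
    calc q ^ 2 ≤ (2 * e * b) ^ 2 := by gcongr
      _ = 4 * e ^ 2 * b ^ 2 := by ring
      _ ≤ 4 * e * b ^ 2 := by
        gcongr
        exact pow_le_of_le_one he0.le (by linarith) (by norm_num)
  have hRabs : |R| ≤ 2 * e * b ^ 2 := by
    have e1 : 43 * e * B ≤ 43 * (1 / 1000) * B := by gcongr
    have e2 : Real.pi ^ 2 / 8 * B ≤ 10 / 8 * B := by gcongr
    have e3 : 0 ≤ Real.pi ^ 2 / 8 * B := by positivity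
    have e4 := abs_le.1 hR1
    rw [abs_le]
    constructor <;> linarith
  refine ⟨?_, hq2.trans (hfin 4 (by norm_num) (by norm_num)), ?_⟩
  · refine (abs_add_le _ _).trans (le_trans ?_ (hfin 6 (by norm_num) (by norm_num)))
    rw [abs_of_nonneg (sq_nonneg q)]
    linarith
  -- Both `2 π² N R` and `M` are compared with `π⁴ b² / 4`; the errors are `20 · 43 = 860` and `21`,
  -- which explains `881` and the factor `1000` between `e` and `ε`.
  · have e1 : 2 * Real.pi ^ 2 * N * R - Real.pi ^ 4 / 4 * b ^ 2 =
        2 * Real.pi ^ 2 * N * (R - Real.pi ^ 2 / 8 * B) := by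
      linear_combination (2 * Real.pi ^ 4 / 8) * hNB
    have e2 : |2 * Real.pi ^ 2 * N * R - Real.pi ^ 4 / 4 * b ^ 2| ≤ 860 * e * b ^ 2 := by
      rw [e1, abs_mul, abs_of_nonneg (by positivity)]
      calc _ ≤ 2 * 10 * N * (43 * e * B) := by gcongr
        _ = 860 * e * (N * B) := by ring
        _ = _ := by rw [hNB]
    refine le_trans ?_ (hfin 881 (by norm_num) (by norm_num))
    have e3 := abs_sub_le (2 * Real.pi ^ 2 * N * R) (Real.pi ^ 4 / 4 * b ^ 2) M
    rw [abs_sub_comm (Real.pi ^ 4 / 4 * b ^ 2) M] at e3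
    linarith

/-- The moments of sums over a Poisson process follow the Gaussian summation rule, up to the
stated residual, if the integrals of the summands satisfy the moment estimates. -/
lemma MomentEstimates.summation_rule {Ω E : Type*} [MeasurableSpace Ω] [MeasurableSpace E]
    {P : Measure Ω} [IsProbabilityMeasure P] {ν : Measure E} [SigmaFinite ν] {y : ℕ → Ω → E}
    {f g : E → ℂ} {ε e A b D N : ℝ} (H : MomentEstimates ν f g e A b D N)
    (h : IsPoissonProcess P ν y) (hf : BddInt ν f) (hg : BddInt ν g) {u v : Ω → ℂ}
    (hu : u = complexPointSum y f) (hv : v = complexPointSum y g) (he0 : 0 < e)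
    (he : 1000 * e ≤ ε) (he' : e ≤ 1 / 1000) (hb : 0 ≤ b) (hN : 0 < N) (hNe : 1 / N ≤ e)
    (hAD : 0 ≤ A / D) (hA : (A / D) ^ 2 = b / N) :
    |cov[fun ω => ‖u ω‖ ^ 2, fun ω => ‖v ω‖ ^ 2; P]
        - ‖∫ ω, u ω * (starRingEnd ℂ) (v ω) ∂P‖ ^ 2|
        ≤ ε * ((∫ ω, ‖u ω‖ ^ 2 ∂P) * ∫ ω, ‖v ω‖ ^ 2 ∂P) ∧
      ‖∫ ω, u ω * v ω ∂P‖ ^ 2 ≤ ε * ((∫ ω, ‖u ω‖ ^ 2 ∂P) * ∫ ω, ‖v ω‖ ^ 2 ∂P) ∧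
      |2 * Real.pi ^ 2 * N * nonGaussianResidual P u v
          - (∫ ω, ‖u ω‖ ^ 2 ∂P) * ∫ ω, ‖v ω‖ ^ 2 ∂P|
        ≤ ε * ((∫ ω, ‖u ω‖ ^ 2 ∂P) * ∫ ω, ‖v ω‖ ^ 2 ∂P) := by
  subst hu hv
  rw [covariance_norm_sq_sub (h.memLp_complexPointSum hf) (h.memLp_complexPointSum hg)]
  have huv : ‖∫ ω, complexPointSum y f ω * complexPointSum y g ω ∂P‖ ≤
      e * b + ‖∫ x, f x ∂ν‖ * ‖∫ x, g x ∂ν‖ := by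
    rw [h.integral_two hf hg, ← norm_mul]
    exact (norm_add_le _ _).trans (add_le_add H.mul le_rfl)
  exact summation_rule_of_cumulants (norm_nonneg _) (norm_nonneg _) (norm_nonneg _) hAD
    (by rw [h.integral_norm_sq hf, h.integral_norm_sq hg])
    (h.abs_nonGaussianResidual_sub_le hf hg) huv H.sq_left H.sq_right H.sq_mul_sq H.left H.right
    H.sq_mul H.mul_sq he0 he he' hb hN hNe hA

theorem proposition3p3 (C : ℝ) (hC : 1 ≤ C) (ε : ℝ) (hε : 0 < ε) :
    ∃ δ : ℝ, 0 < δ ∧ ∀ p : BeamParams, p.ScalingRegime δ →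
      ∀ X x : Space3,
        C⁻¹ * p.Lx ≤ ‖crossRange X‖ → ‖crossRange X‖ ≤ C * p.Lx →
        C⁻¹ * p.Lz ≤ rangeCoord X → rangeCoord X ≤ C * p.Lz →
        ‖x‖ ≤ p.dA →
      ∀ (Ω : Type*) [MeasurableSpace Ω] (P : Measure Ω) [IsProbabilityMeasure P]
        (y : ℕ → Ω → Space3),
        IsPoissonProcess P (ENNReal.ofReal p.rho • (volume : Measure Space3)) y →
      ∀ u₁ u₂ : Ω → ℂ,
        u₁ = p.scatteredField y (X + (1 / 2 : ℝ) • x) →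
        u₂ = p.scatteredField y (X - (1 / 2 : ℝ) • x) →
        -- all moments below exist
        MemLp u₁ 4 P ∧ MemLp u₂ 4 P ∧
        -- the Gaussian summation rule for the covariance of the intensity
        |cov[fun ω => ‖u₁ ω‖ ^ 2, fun ω => ‖u₂ ω‖ ^ 2; P]
            - ‖∫ ω, u₁ ω * (starRingEnd ℂ) (u₂ ω) ∂P‖ ^ 2|
          ≤ ε * ((∫ ω, ‖u₁ ω‖ ^ 2 ∂P) * ∫ ω, ‖u₂ ω‖ ^ 2 ∂P) ∧
        -- the pseudo-covariance is negligible
        ‖∫ ω, u₁ ω * u₂ ω ∂P‖ ^ 2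
          ≤ ε * ((∫ ω, ‖u₁ ω‖ ^ 2 ∂P) * ∫ ω, ‖u₂ ω‖ ^ 2 ∂P) ∧
        -- size of the residual relative to the main term
        |2 * Real.pi ^ 2 * p.rho * p.ro ^ 2 * ‖crossRange X‖ * nonGaussianResidual P u₁ u₂
            - (∫ ω, ‖u₁ ω‖ ^ 2 ∂P) * ∫ ω, ‖u₂ ω‖ ^ 2 ∂P|
          ≤ ε * ((∫ ω, ‖u₁ ω‖ ^ 2 ∂P) * ∫ ω, ‖u₂ ω‖ ^ 2 ∂P) ∧
        1 / (2 * Real.pi ^ 2 * p.rho * p.ro ^ 2 * ‖crossRange X‖) ≤ ε := by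
  set e := min (ε / 1000) (1 / 1000) with he
  have he0 : 0 < e := by positivity
  have heε : 1000 * e ≤ ε := by linarith [min_le_left (ε / 1000) (1 / 1000 : ℝ)]
  have he1 : e ≤ 1 / 1000 := min_le_right _ _
  obtain ⟨t₀, ht₀, hmom⟩ := BeamParams.exists_momentEstimates_particleField he0
  set t := min (min t₀ e) (1 / 10000) with ht
  have ht0 : 0 < t := by positivity
  have htt : t ≤ t₀ := (min_le_left _ _).trans (min_le_left _ _)
  have hte : t ≤ e := (min_le_left _ _).trans (min_le_right _ _)
  obtain ⟨δ, hδ, hreg⟩ := BeamParams.exists_regime hC ht0 (min_le_right _ _)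
  refine ⟨δ, hδ, fun p hp X x hX1 hX2 hZ1 hZ2 hx Ω _ P _ y hy u₁ u₂ hu₁ hu₂ => ?_⟩
  obtain ⟨hw, hal, hdA, hN⟩ := hreg p hp X hX1 hX2 hZ1 hZ2
  have hD : 0 < ‖crossRange X‖ := hw.D_pos
  have hro : 0 < p.ro := hw.ro_pos
  have hl := hp.ℓ_pos
  have hρ : 0 < p.rho := by
    rw [BeamParams.rho]
    positivity
  have hhalf : ‖(1 / 2 : ℝ) • x‖ ≤ t * ‖crossRange X‖ := by
    rw [norm_smul, Real.norm_of_nonneg (by norm_num)]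
    linarith [norm_nonneg x]
  -- The rotation that turns the cross-range vector of the camera into the first coordinate
  -- direction.
  have hcs : (X 0 / ‖crossRange X‖) ^ 2 + (X 1 / ‖crossRange X‖) ^ 2 = 1 := by
    rw [div_pow, div_pow, ← add_div, ← norm_crossRange_sq, div_self (by positivity)]
  have hc1 := BeamParams.close_rotCoord (p := p) hD hhalf
  have hc2 := BeamParams.close_rotCoord (p := p) (x := -((1 / 2 : ℝ) • x)) hD (by rwa [norm_neg])
  rw [← sub_eq_add_neg] at hc2
  have H := hmom p t X _ _ _ _ hcs hl hal hw htt hc1 hc2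
  have hpos : 0 < p.k ∧ 0 < p.kd ∧ 0 < p.a ∧ 0 < p.ro :=
    ⟨hw.k_pos, hw.kd_pos, hw.a_pos, hw.ro_pos⟩
  have hf := BeamParams.bddInt_particleField hpos (X + (1 / 2 : ℝ) • x)
  have hg := BeamParams.bddInt_particleField hpos (X - (1 / 2 : ℝ) • x)
  have hN0 : 0 < p.rho * p.ro ^ 2 * ‖crossRange X‖ := by positivity
  have : SigmaFinite (ENNReal.ofReal p.rho • (volume : Measure Space3)) :=
    inferInstanceAs (SigmaFinite (p.rho.toNNReal • (volume : Measure Space3)))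
  -- Zero reflectivity is allowed: then `b = 0` and the inequalities are trivial, which is why only
  -- `0 ≤ b` is required. The last argument is the identity `(A / D)² = b / N`.
  obtain ⟨a1, a2, a3⟩ := H.summation_rule hy hf hg hu₁ hu₂ he0 heε he1
    (by rw [BeamParams.intensityScale]; positivity) hN0 (hN.trans hte) (by positivity) (by
      rw [div_pow, sq_abs, BeamParams.intensityScale]
      field_simp)
  refine ⟨?_, ?_, a1, a2, ?_, ?_⟩
  · rw [hu₁]
    exact hy.memLp_complexPointSum hf
  · rw [hu₂]
    exact hy.memLp_complexPointSum hg
  · have e1 : 2 * Real.pi ^ 2 * p.rho * p.ro ^ 2 * ‖crossRange X‖ =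
        2 * Real.pi ^ 2 * (p.rho * p.ro ^ 2 * ‖crossRange X‖) := by ring
    rw [e1]
    exact a3
  · have e1 : p.rho * p.ro ^ 2 * ‖crossRange X‖ ≤
        2 * Real.pi ^ 2 * p.rho * p.ro ^ 2 * ‖crossRange X‖ := by
      have h9 : 9 ≤ Real.pi ^ 2 := by nlinarith [Real.pi_gt_three]
      nlinarith
    refine (one_div_le_one_div_of_le hN0 e1).trans (hN.trans ?_)
    linarith
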